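/- **Conventions.** $\mathsf{Prof}$ is the monoidal bicategory whose objects are small categories, whose 1-cells $P : A \nrightarrow B$ are profunctors, i.e. functors $B^{op}\times A \to \mathsf{Set}$, whose 2-cells are natural transformations, with composition $(Q\circ P)(c,a) = \int^{b} P(b,a)\times Q(c,b)$, tensor product the product of categories, and unit the terminal category $\mathbf 1$. A functor $F : A \to B$ gives the representable profunctor $F_* : A \nrightarrow B$, $F_*(b,a)=\mathrm{Hom}_B(b,Fa)$, and a natural transformation $t$ gives a 2-cell $t_*$. A *$\star$-autonomous structure* on a category $C$ is a monoidal structure $(\otimes, 1, \alpha,\lambda,\varrho)$ together with an equivalence $D : C \to C^{op}$ and bijections $\varphi: \mathrm{Hom}(x\otimes y, Dz)\cong \mathrm{Hom}(x, D(y\otimes z))$ natural in $x,y,z$. An *isomorphism* of two such structures on $C$ is a strong monoidal structure on the identity functor of $C$ together with a natural isomorphism of the dualities, compatible with the bijections $\varphi$. A *$\dagger$-Frobenius pseudomonoid* in $\mathsf{Prof}$ is a pseudomonoid $(A,\mu : A\times A\nrightarrow A,\eta : \mathbf 1\nrightarrow A)$ (with invertible associator and unitor 2-cells satisfying the pentagon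 and triangle axioms) such that $\mu$ and $\eta$ have right adjoints, together with a form $\sigma : A\times A\nrightarrow \mathbf 1$ which is the evaluation of a biexact pairing $A\dashv A$ (there are a coevaluation $\mathbf 1\nrightarrow A\times A$ and invertible 2-cells from both zig-zag composites to the identity) and an invertible 2-cell $\sigma\circ(\mu\times \mathrm{id})\cong\sigma\circ(\mathrm{id}\times\mu)$. An *isomorphism* of two such structures on $A$ consists of invertible 2-cells $\mu\cong\mu'$, $\eta\cong\eta'$, $\sigma\cong\sigma'$ compatible with the associators, the unitors and the 2-cells $\sigma\circ(\mu\times \mathrm{id})\cong\sigma\circ(\mathrm{id}\times\mu)$. Call such a structure on $C^{op}$ *representable* if $\mu$ and $\eta$ are isomorphic to representable profunctors $F_*$, $G_*$, and $\sigma(x,y)\cong\mathrm{Hom}_C(x,Dy)$, naturally in $x,y$, for some equivalence $D : C\to C^{op}$. **Theorem.** Let $C$ be a small category. 1. Every $\star$-autonomous structure $S$ on $C$ induces a (representable) $\dagger$-Frobenius pseudomonoid $\Phi(S)=(C^{op},\mu,\eta,\sigma)$ in $\mathsf{Prof}$, where $\mu=(\otimes^{op})_*$, i.e. $\mu(x,(y,z))=\mathrm{Hom}_C(y\otimes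 z,x)$; $\eta=(1^{op})_*$, i.e. $\eta(x)=\mathrm{Hom}_C(1,x)$; $\sigma(x,y)=\mathrm{Hom}_C(x,Dy)$; the associator and unitors are induced by $\alpha,\lambda,\varrho$, and the 2-cell $\sigma\circ(\mu\times \mathrm{id})\cong\sigma\circ(\mathrm{id}\times\mu)$ is induced by $\varphi$. 2. There is a construction $\Psi$ assigning to every representable $\dagger$-Frobenius pseudomonoid structure $P$ on $C^{op}$ a $\star$-autonomous structure $\Psi(P)$ on $C$, such that $\Phi(\Psi(P))\cong P$ for all such $P$ and $\Psi(\Phi(S))\cong S$ for all $\star$-autonomous structures $S$ on $C$. 3. If idempotents split in $C$ (i.e. $C$ is Cauchy complete), then every $\dagger$-Frobenius pseudomonoid structure on $C^{op}$ in $\mathsf{Prof}$ is representable, so that $\Phi$ and $\Psi$ are mutually inverse, up to isomorphism, between all $\star$-autonomous structures on $C$ and all $\dagger$-Frobenius pseudomonoid structures on $C^{op}$. -/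

import Mathlib

open CategoryTheory Opposite

universe u

namespace ProfBicat

section Profunctors

variable {A B C D : Type u} [SmallCategory A] [SmallCategory B] [SmallCategory C] [SmallCategory D]

/-- A natural isomorphism of profunctors from a family of bijections natural in both variables. -/
def isoMk {P Q : Profunctor.{u} A B} (e : ∀ (a : A) (b : Bᵒᵖ), (P.obj a).obj b ≃ (Q.obj a).obj b)
    (natB : ∀ (a : A) {b b' : Bᵒᵖ} (g : b ⟶ b') (p : (P.obj a).obj b),
      e a b' ((P.obj a).map g p) = (Q.obj a).map g (e a b p))
    (natA : ∀ {a a' : A} (f : a ⟶ a') (b : Bᵒᵖ) (p : (P.obj a).obj b),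
      e a' b ((P.map f).app b p) = (Q.map f).app b (e a b p)) : P ≅ Q :=
  NatIso.ofComponents
    (fun a => NatIso.ofComponents (fun b => (e a b).toIso)
      (fun g => by ext p; exact natB a g p))
    (fun f => by ext b p; exact natA f b p)

/-- One step of the coend relation on `Σ b, P(b, a) × Q(c, b)`. -/
inductive CoendRel (P : Profunctor.{u} A B) (Q : Profunctor.{u} B C) (a : A) (c : Cᵒᵖ) :
    (Σ b : B, (P.obj a).obj (op b) × (Q.obj b).obj c) →
      (Σ b : B, (P.obj a).obj (op b) × (Q.obj b).obj c) → Prop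
  | step {b b' : B} (f : b ⟶ b') (p : (P.obj a).obj (op b')) (q : (Q.obj b).obj c) :
      CoendRel P Q a c ⟨b, (P.obj a).map f.op p, q⟩ ⟨b', p, (Q.map f).app c q⟩

/-- The coend `∫^b P(b, a) × Q(c, b)`. -/
def CoendComp (P : Profunctor.{u} A B) (Q : Profunctor.{u} B C) (a : A) (c : Cᵒᵖ) : Type u :=
  Quot (CoendRel P Q a c)

namespace CoendComp

variable {P : Profunctor.{u} A B} {Q : Profunctor.{u} B C} {a : A} {c : Cᵒᵖ}

/-- The class of `(p, q)` with `p ∈ P(b, a)` and `q ∈ Q(c, b)`. -/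
def mk (b : B) (p : (P.obj a).obj (op b)) (q : (Q.obj b).obj c) : CoendComp P Q a c :=
  Quot.mk _ ⟨b, p, q⟩

theorem sound {b b' : B} (f : b ⟶ b') (p : (P.obj a).obj (op b')) (q : (Q.obj b).obj c) :
    (mk b ((P.obj a).map f.op p) q : CoendComp P Q a c) = mk b' p ((Q.map f).app c q) :=
  Quot.sound (CoendRel.step f p q)

theorem ind {motive : CoendComp P Q a c → Prop} (h : ∀ b p q, motive (mk b p q)) (x) :
    motive x := by
  obtain ⟨b, p, q⟩ := x
  exact h b p q

/-- A function on the coend from a dinatural family of functions. -/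
def lift {X : Type u} (t : ∀ b, (P.obj a).obj (op b) → (Q.obj b).obj c → X)
    (h : ∀ {b b' : B} (f : b ⟶ b') (p : (P.obj a).obj (op b')) (q : (Q.obj b).obj c),
      t b ((P.obj a).map f.op p) q = t b' p ((Q.map f).app c q)) : CoendComp P Q a c → X :=
  Quot.lift (fun x => t x.1 x.2.1 x.2.2) (by rintro _ _ ⟨f, p, q⟩; exact h f p q)

end CoendComp

/-- Composition of profunctors (in diagrammatic order): `(c, a) ↦ ∫^b P(b, a) × Q(c, b)`. -/
def comp (P : Profunctor.{u} A B) (Q : Profunctor.{u} B C) : Profunctor.{u} A C where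
  obj a :=
    { obj := fun c => CoendComp P Q a c
      map := fun g => ↾(CoendComp.lift (fun b p q => CoendComp.mk b p ((Q.obj b).map g q))
        (fun f p q => by
          rw [CoendComp.sound]
          congr 1
          exact (NatTrans.naturality_apply (Q.map f) g q)))
      map_id := fun c => by
        ext x; induction x using CoendComp.ind with | _ b p q
        exact congrArg (CoendComp.mk b p) (types_congr_hom ((Q.obj b).map_id c) q)
      map_comp := fun g g' => by
        ext x; induction x using CoendComp.ind with | _ b p q
        exact congrArg (CoendComp.mk b p) (types_congr_hom ((Q.obj b).map_comp g g') q) }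
  map f :=
    { app := fun c => ↾(CoendComp.lift (fun b p q => CoendComp.mk b ((P.map f).app (op b) p) q)
        (fun g p q => by
          rw [← CoendComp.sound]
          congr 1
          exact (NatTrans.naturality_apply (P.map f) g.op p)))
      naturality := fun c c' g => by
        ext x; induction x using CoendComp.ind with | _ b p q
        rfl }
  map_id a := by
    ext c x; induction x using CoendComp.ind with | _ b p q
    exact congrArg (CoendComp.mk b · q) (types_congr_hom (NatTrans.congr_app (P.map_id a) (op b)) p)
  map_comp f f' := by
    ext c x; induction x using CoendComp.ind with | _ b p q
    exact congrArg (CoendComp.mk b · q)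
      (types_congr_hom (NatTrans.congr_app (P.map_comp f f') (op b)) p)

/-- Functoriality of composition in 2-cells. -/
def compMap {P P' : Profunctor.{u} A B} {Q Q' : Profunctor.{u} B C} (s : P ⟶ P') (t : Q ⟶ Q') :
    comp P Q ⟶ comp P' Q' where
  app a :=
    { app := fun c => ↾(CoendComp.lift
        (fun b p q => CoendComp.mk b ((s.app a).app (op b) p) ((t.app b).app c q))
        (fun f p q => by
          have h1 := NatTrans.naturality_apply (s.app a) f.op p
          have h2 : (t.app _).app c ((Q.map f).app c q) = (Q'.map f).app c ((t.app _).app c q) :=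
            types_congr_hom (NatTrans.congr_app (t.naturality f) c) q
          rw [h1, h2, CoendComp.sound]))
      naturality := fun c c' g => by
        ext x; induction x using CoendComp.ind with | _ b p q
        exact congrArg (CoendComp.mk b _) (NatTrans.naturality_apply (t.app b) g q) }
  naturality a a' f := by
    ext c x; induction x using CoendComp.ind with | _ b p q
    exact congrArg (CoendComp.mk b · _) (types_congr_hom (NatTrans.congr_app (s.naturality f) (op b)) p)

/-- `(P ; Q) ; R ≅ P ; (Q ; R)`. -/
def compAssoc (P : Profunctor.{u} A B) (Q : Profunctor.{u} B C) (R : Profunctor.{u} C D) :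
    comp (comp P Q) R ≅ comp P (comp Q R) :=
  isoMk (fun a d =>
    { toFun := CoendComp.lift (fun c x r => CoendComp.lift (X := (((comp P (comp Q R)).obj a).obj d))
          (fun b p q => CoendComp.mk b p (CoendComp.mk c q r))
          (fun f p q => CoendComp.sound (Q := comp Q R) (c := d) f p (CoendComp.mk c q r)) x)
        (fun g x r => by
          induction x using CoendComp.ind with | _ b p q
          exact congrArg (CoendComp.mk b p) (CoendComp.sound g q r))
      invFun := CoendComp.lift (fun b p x => CoendComp.lift (X := ((comp (comp P Q) R).obj a).obj d)
          (fun c q r => CoendComp.mk c (CoendComp.mk b p q) r)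
          (fun f q r => CoendComp.sound (P := comp P Q) (a := a) f (CoendComp.mk b p q) r) x)
        (fun f p x => by
          induction x using CoendComp.ind with | _ c q r
          exact congrArg (CoendComp.mk c · r) (CoendComp.sound f p q))
      left_inv := fun x => by
        induction x using CoendComp.ind with | _ c x r
        induction x using CoendComp.ind with | _ b p q
        rfl
      right_inv := fun x => by
        induction x using CoendComp.ind with | _ b p x
        induction x using CoendComp.ind with | _ c q r
        rfl })
    (fun a _ _ g x => by
      induction x using CoendComp.ind with | _ c x r
      induction x using CoendComp.ind with | _ b p q
      rfl)
    (fun f d x => by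
      induction x using CoendComp.ind with | _ c x r
      induction x using CoendComp.ind with | _ b p q
      rfl)

/-- Composing with a representable profunctor: `F_* ; Q ≅ Q(-, F -)`. -/
def starComp (F : A ⥤ B) (Q : Profunctor.{u} B C) : comp F.toProfunctor Q ≅ F ⋙ Q :=
  isoMk (fun a c =>
    { toFun := CoendComp.lift (fun b (f : b ⟶ F.obj a) q => (Q.map f).app c q)
        (fun f (p : _ ⟶ F.obj a) q => by
          change (Q.map (f ≫ p)).app c q = _
          simp)
      invFun := fun q => CoendComp.mk (F.obj a) (𝟙 (F.obj a)) q
      left_inv := fun x => by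
        induction x using CoendComp.ind with | _ b f q
        have := CoendComp.sound (P := F.toProfunctor) (Q := Q) (a := a) (c := c) f (𝟙 (F.obj a)) q
        refine this.symm.trans (congrArg (CoendComp.mk b · q) ?_)
        exact Category.comp_id (X := b) f
      right_inv := fun q => by
        change (Q.map (𝟙 (F.obj a))).app c q = q
        simp })
    (fun a _ _ g x => by
      induction x using CoendComp.ind with | _ b f q
      exact NatTrans.naturality_apply (Q.map f) g q)
    (fun {a a'} h c x => by
      induction x using CoendComp.ind with | _ b f q
      change (Q.map (f ≫ F.map h)).app c q = (Q.map (F.map h)).app c ((Q.map f).app c q)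
      exact types_congr_hom (NatTrans.congr_app (Q.map_comp f (F.map h)) c) q)

/-- `𝟙 ; P ≅ P`. -/
def idComp (P : Profunctor.{u} A B) : comp Profunctor.id P ≅ P := starComp (𝟭 A) P

/-- `P ; 𝟙 ≅ P`. -/
def compId (P : Profunctor.{u} A B) : comp P Profunctor.id ≅ P :=
  isoMk (fun a c =>
    { toFun := CoendComp.lift (fun b p (f : unop c ⟶ b) => (P.obj a).map f.op p)
        (fun f p (q : unop c ⟶ _) => by
          change _ = (P.obj a).map (q ≫ f).op p
          simp)
      invFun := fun p => CoendComp.mk (unop c) p (𝟙 (unop c))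
      left_inv := fun x => by
        induction x using CoendComp.ind with | _ b p f
        have := CoendComp.sound (P := P) (Q := Profunctor.id) (a := a) (c := c) f p (𝟙 (unop c))
        refine this.trans (congrArg (CoendComp.mk b p) ?_)
        exact Category.id_comp (X := unop c) f
      right_inv := fun p => by
        change (P.obj a).map (𝟙 c) p = p
        simp })
    (fun a c c' g x => by
      induction x using CoendComp.ind with | _ b p f
      change (P.obj a).map (g.unop ≫ f).op p = (P.obj a).map g ((P.obj a).map f.op p)
      exact types_congr_hom ((P.obj a).map_comp (Quiver.Hom.op f) g) p)
    (fun {a a'} h c x => by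
      induction x using CoendComp.ind with | _ b p f
      exact (NatTrans.naturality_apply (P.map h) f.op p).symm)

end Profunctors

/-- A small category, regarded as an object of the bicategory of profunctors. -/
structure Prof : Type (u + 1) where
  of ::
  carrier : Type u
  [cat : SmallCategory carrier]

attribute [instance] Prof.cat

namespace Prof

/-- The bicategory of small categories, profunctors and natural transformations. -/
instance bicategory : Bicategory.{u, u + 1, u + 1} Prof.{u} where
  Hom A B := Profunctor.{u} A.carrier B.carrier
  id A := Profunctor.id
  comp P Q := ProfBicat.comp P Q
  homCategory A B := inferInstanceAs (Category (Profunctor.{u} A.carrier B.carrier))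
  whiskerLeft P _ _ t := compMap (𝟙 P) t
  whiskerRight s Q := compMap s (𝟙 Q)
  associator P Q R := compAssoc P Q R
  leftUnitor P := idComp P
  rightUnitor P := compId P
  whiskerLeft_id P Q := by
    ext a c x; induction x using CoendComp.ind; rfl
  whiskerLeft_comp P _ _ _ s t := by
    ext a c x; induction x using CoendComp.ind; rfl
  id_whiskerLeft {A B P Q} s := by
    ext a c x
    apply (idComp Q).app a |>.app c |>.toEquiv.injective
    induction x using CoendComp.ind with | _ b f q
    exact (types_congr_hom (NatTrans.congr_app (s.naturality f) c) q).symm.trans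
      (types_congr_hom (NatTrans.congr_app (Q.map_id a) c) _).symm
  comp_whiskerLeft P Q _ _ s := by
    ext a c x
    induction x using CoendComp.ind with | _ b x r
    induction x using CoendComp.ind
    rfl
  id_whiskerRight P Q := by
    ext a c x; induction x using CoendComp.ind; rfl
  comp_whiskerRight s t P := by
    ext a c x; induction x using CoendComp.ind; rfl
  whiskerRight_id {A B P Q} s := by
    ext a c x
    apply (compId Q).app a |>.app c |>.toEquiv.injective
    induction x using CoendComp.ind with | _ b p f
    exact (NatTrans.naturality_apply (s.app a) (Quiver.Hom.op f) p).symm.trans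
      (types_congr_hom ((Q.obj a).map_id c) _).symm
  whiskerRight_comp s P Q := by
    ext a c x
    induction x using CoendComp.ind with | _ b p x
    induction x using CoendComp.ind
    rfl
  whisker_assoc P _ _ s Q := by
    ext a c x
    induction x using CoendComp.ind with | _ b x r
    induction x using CoendComp.ind
    rfl
  whisker_exchange s t := by
    ext a c x; induction x using CoendComp.ind; rfl
  pentagon P Q R S := by
    ext a c x
    induction x using CoendComp.ind with | _ b x r
    induction x using CoendComp.ind with | _ b x r
    induction x using CoendComp.ind
    rfl
  triangle {A B C} P Q := by
    ext a c x
    induction x using CoendComp.ind with | _ b x r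
    induction x using CoendComp.ind with | _ b' p f
    exact (CoendComp.sound (P := P) (Q := Q) f p r).symm


open Bicategory

/-- The tensor product of objects: the product category. -/
abbrev tensorObj (A B : Prof.{u}) : Prof.{u} := Prof.of (A.carrier × B.carrier)

/-- The tensor unit: the category with one object and one morphism. -/
abbrev tensorUnit : Prof.{u} := Prof.of (Discrete PUnit.{u + 1})

/-- Two 2-cells agree if all their components agree. -/
theorem cell_ext {A B : Prof.{u}} {P Q : A ⟶ B} {s t : P ⟶ Q}
    (h : ∀ (a : A.carrier) (b : B.carrierᵒᵖ) (x : (P.obj a).obj b),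
      (s.app a).app b x = (t.app a).app b x) : s = t :=
  NatTrans.ext (funext fun a => NatTrans.ext (funext fun b => by ext x; exact h a b x))

infixr:75 " ⊠ " => ProfBicat.Prof.tensorObj

/-- The representable profunctor `F_*(b, a) = Hom(b, F a)` of a functor, as a 1-cell. -/
def star {A B : Prof.{u}} (F : A.carrier ⥤ B.carrier) : A ⟶ B := F.toProfunctor

/-- The restriction `Q(-, F -)` of a profunctor along a functor. -/
def restrict {A B C : Prof.{u}} (F : A.carrier ⥤ B.carrier) (Q : B ⟶ C) : A ⟶ C :=
  Functor.comp F Q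

/-- The tensor product of 1-cells: `((b, b'), (a, a')) ↦ P(b, a) × Q(b', a')`. -/
def tensorHom {A B A' B' : Prof.{u}} (P : A ⟶ B) (Q : A' ⟶ B') : A ⊠ A' ⟶ B ⊠ B' :=
  show Profunctor.{u} (A.carrier × A'.carrier) (B.carrier × B'.carrier) from
  { obj := fun a =>
      { obj := fun b => (P.obj a.1).obj (op b.unop.1) × (Q.obj a.2).obj (op b.unop.2)
        map := fun g => ↾(fun x => ((P.obj a.1).map g.unop.1.op x.1, (Q.obj a.2).map g.unop.2.op x.2))
        map_id := fun b => by
          refine ConcreteCategory.ext_apply fun x => ?_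
          exact congrArg₂ Prod.mk (types_congr_hom ((P.obj a.1).map_id _) x.1)
            (types_congr_hom ((Q.obj a.2).map_id _) x.2)
        map_comp := fun g g' => by
          refine ConcreteCategory.ext_apply fun x => ?_
          exact congrArg₂ Prod.mk (types_congr_hom ((P.obj a.1).map_comp g.unop.1.op g'.unop.1.op) x.1)
            (types_congr_hom ((Q.obj a.2).map_comp g.unop.2.op g'.unop.2.op) x.2) }
    map := fun f =>
      { app := fun b => ↾(fun x => ((P.map f.1).app _ x.1, (Q.map f.2).app _ x.2))
        naturality := fun b b' g => by
          refine ConcreteCategory.ext_apply fun x => ?_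
          exact congrArg₂ Prod.mk (NatTrans.naturality_apply (P.map f.1) g.unop.1.op x.1)
            (NatTrans.naturality_apply (Q.map f.2) g.unop.2.op x.2) }
    map_id := fun a => by
      refine NatTrans.ext (funext fun b => ConcreteCategory.ext_apply fun x => ?_)
      exact congrArg₂ Prod.mk (types_congr_hom (NatTrans.congr_app (P.map_id a.1) _) x.1)
        (types_congr_hom (NatTrans.congr_app (Q.map_id a.2) _) x.2)
    map_comp := fun f f' => by
      refine NatTrans.ext (funext fun b => ConcreteCategory.ext_apply fun x => ?_)
      exact congrArg₂ Prod.mk (types_congr_hom (NatTrans.congr_app (P.map_comp f.1 f'.1) _) x.1)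
        (types_congr_hom (NatTrans.congr_app (Q.map_comp f.2 f'.2) _) x.2) }

infixr:75 " ⊠₁ " => ProfBicat.Prof.tensorHom

/-- The tensor product of 2-cells. -/
def tensorMap {A B A' B' : Prof.{u}} {P P' : A ⟶ B} {Q Q' : A' ⟶ B'} (s : P ⟶ P') (t : Q ⟶ Q') :
    P ⊠₁ Q ⟶ P' ⊠₁ Q' :=
  show NatTrans (P ⊠₁ Q) (P' ⊠₁ Q') from
  { app := fun a =>
      { app := fun b => ↾(fun x => ((s.app a.1).app _ x.1, (t.app a.2).app _ x.2))
        naturality := fun b b' g => by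
          ext x
          exact congrArg₂ Prod.mk (NatTrans.naturality_apply (s.app a.1) g.unop.1.op x.1)
            (NatTrans.naturality_apply (t.app a.2) g.unop.2.op x.2) }
    naturality := fun a a' f => by
      ext b x
      exact congrArg₂ Prod.mk (types_congr_hom (NatTrans.congr_app (s.naturality f.1) _) x.1)
        (types_congr_hom (NatTrans.congr_app (t.naturality f.2) _) x.2) }

infixr:75 " ⊠₂ " => ProfBicat.Prof.tensorMap

/-- The tensor product of invertible 2-cells. -/
@[simps]
def tensorIso {A B A' B' : Prof.{u}} {P P' : A ⟶ B} {Q Q' : A' ⟶ B'} (s : P ≅ P') (t : Q ≅ Q') :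
    P ⊠₁ Q ≅ P' ⊠₁ Q' where
  hom := s.hom ⊠₂ t.hom
  inv := s.inv ⊠₂ t.inv
  hom_inv_id := by
    refine cell_ext fun a b x => ?_
    exact congrArg₂ Prod.mk (types_congr_hom (NatTrans.congr_app (NatTrans.congr_app s.hom_inv_id a.1) _) x.1)
      (types_congr_hom (NatTrans.congr_app (NatTrans.congr_app t.hom_inv_id a.2) _) x.2)
  inv_hom_id := by
    refine cell_ext fun a b x => ?_
    exact congrArg₂ Prod.mk (types_congr_hom (NatTrans.congr_app (NatTrans.congr_app s.inv_hom_id a.1) _) x.1)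
      (types_congr_hom (NatTrans.congr_app (NatTrans.congr_app t.inv_hom_id a.2) _) x.2)

/-- A natural family of bijections as an invertible 2-cell of `Prof`. -/
def cellMk {A B : Prof.{u}} {P Q : A ⟶ B}
    (e : ∀ (a : A.carrier) (b : B.carrierᵒᵖ), (P.obj a).obj b ≃ (Q.obj a).obj b)
    (natB : ∀ (a : A.carrier) {b b' : B.carrierᵒᵖ} (g : b ⟶ b') (p : (P.obj a).obj b),
      e a b' ((P.obj a).map g p) = (Q.obj a).map g (e a b p))
    (natA : ∀ {a a' : A.carrier} (f : a ⟶ a') (b : B.carrierᵒᵖ) (p : (P.obj a).obj b),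
      e a' b ((P.map f).app b p) = (Q.map f).app b (e a b p)) : P ≅ Q :=
  isoMk e natB natA

/-- The interchange isomorphism `(P ⊠ P') ; (Q ⊠ Q') ≅ (P ; Q) ⊠ (P' ; Q')`. -/
def tensorComp {A B C A' B' C' : Prof.{u}} (P : A ⟶ B) (Q : B ⟶ C) (P' : A' ⟶ B') (Q' : B' ⟶ C') :
    (P ⊠₁ P') ≫ (Q ⊠₁ Q') ≅ (P ≫ Q) ⊠₁ (P' ≫ Q') :=
  cellMk (fun a c =>
    { toFun := CoendComp.lift
        (X := CoendComp P Q a.1 (op c.unop.1) × CoendComp P' Q' a.2 (op c.unop.2))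
        (fun b p q => (CoendComp.mk b.1 p.1 q.1, CoendComp.mk b.2 p.2 q.2))
        (fun f p q => congrArg₂ Prod.mk (CoendComp.sound f.1 p.1 q.1) (CoendComp.sound f.2 p.2 q.2))
      invFun := fun x =>
        CoendComp.lift (X := CoendComp (P ⊠₁ P') (Q ⊠₁ Q') a c) (fun b p q =>
          CoendComp.lift (X := CoendComp (P ⊠₁ P') (Q ⊠₁ Q') a c) (fun b' p' q' =>
            CoendComp.mk (P := P ⊠₁ P') (Q := Q ⊠₁ Q') (a := a) (c := c) (b, b') (p, p') (q, q'))
            (fun f p' q' => by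
              have h := CoendComp.sound (P := P ⊠₁ P') (Q := Q ⊠₁ Q') (a := a) (c := c)
                (b := (b, _)) (b' := (b, _)) (𝟙 b, f) (p, p') (q, q')
              have h1 := types_congr_hom ((P.obj a.1).map_id (op b)) p
              have h2 := types_congr_hom (NatTrans.congr_app (Q.map_id b) (op c.unop.1)) q
              exact (congrArg (CoendComp.mk _ · _) (congrArg (Prod.mk · _) h1)).symm.trans
                (h.trans (congrArg (CoendComp.mk _ _ ·) (congrArg (Prod.mk · _) h2))))
            x.2)
          (fun f p q => by
            obtain ⟨y, x⟩ := x
            induction x using CoendComp.ind with | _ b' p' q'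
            have h := CoendComp.sound (P := P ⊠₁ P') (Q := Q ⊠₁ Q') (a := a) (c := c)
              (b := (_, b')) (b' := (_, b')) (f, 𝟙 b') (p, p') (q, q')
            have h1 := types_congr_hom ((P'.obj a.2).map_id (op b')) p'
            have h2 := types_congr_hom (NatTrans.congr_app (Q'.map_id b') (op c.unop.2)) q'
            exact (congrArg (CoendComp.mk _ · _) (congrArg (Prod.mk _ ·) h1)).symm.trans
              (h.trans (congrArg (CoendComp.mk _ _ ·) (congrArg (Prod.mk _ ·) h2))))
          x.1
      left_inv := fun x => by
        induction x using CoendComp.ind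
        rfl
      right_inv := fun x => by
        obtain ⟨x, y⟩ := x
        induction x using CoendComp.ind
        induction y using CoendComp.ind
        rfl })
    (fun a _ _ g x => by
      induction x using CoendComp.ind
      rfl)
    (fun h c x => by
      induction x using CoendComp.ind
      rfl)

/-- `𝟙 ⊠ 𝟙 ≅ 𝟙`. -/
def tensorId (A B : Prof.{u}) : 𝟙 A ⊠₁ 𝟙 B ≅ 𝟙 (A ⊠ B) :=
  cellMk (fun _ _ => Equiv.refl _) (fun _ _ _ _ _ => rfl) (fun _ _ _ => rfl)

/-- A natural isomorphism of functors induces an isomorphism of representable profunctors. -/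
def starIso {A B : Prof.{u}} {F G : A.carrier ⥤ B.carrier} (t : F ≅ G) : star F ≅ star G :=
  cellMk (fun a b =>
    { toFun := fun (f : unop b ⟶ F.obj a) => f ≫ t.hom.app a
      invFun := fun (f : unop b ⟶ G.obj a) => f ≫ t.inv.app a
      left_inv := fun (f : unop b ⟶ F.obj a) => by
        simp only [Category.assoc, Iso.hom_inv_id_app]
        exact Category.comp_id f
      right_inv := fun (f : unop b ⟶ G.obj a) => by
        simp only [Category.assoc, Iso.inv_hom_id_app]
        exact Category.comp_id f })
    (fun a b b' g (f : unop b ⟶ F.obj a) => Category.assoc g.unop f (t.hom.app a))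
    (fun {a a'} h b (f : unop b ⟶ F.obj a) => by
      change (f ≫ F.map h) ≫ t.hom.app a' = (f ≫ t.hom.app a) ≫ G.map h
      simp)

/-- `F_* ; Q ≅ Q(-, F -)`. -/
def starRestrict {A B C : Prof.{u}} (F : A.carrier ⥤ B.carrier) (Q : B ⟶ C) :
    star F ≫ Q ≅ restrict F Q :=
  starComp F Q

/-- `F_* ; G_* ≅ (G ∘ F)_*`. -/
def starStar {A B C : Prof.{u}} (F : A.carrier ⥤ B.carrier) (G : B.carrier ⥤ C.carrier) :
    star F ≫ star G ≅ (star (F ⋙ G) : A ⟶ C) :=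
  starComp F G.toProfunctor

/-- The functor `F × G`. -/
abbrev prodFunctor {A B A' B' : Prof.{u}} (F : A.carrier ⥤ B.carrier)
    (G : A'.carrier ⥤ B'.carrier) : (A ⊠ A').carrier ⥤ (B ⊠ B').carrier :=
  Functor.prod F G

/-- `F_* ⊠ G_* ≅ (F × G)_*`. -/
def starTensor {A B A' B' : Prof.{u}} (F : A.carrier ⥤ B.carrier) (G : A'.carrier ⥤ B'.carrier) :
    star F ⊠₁ star G ≅ star (prodFunctor F G) :=
  cellMk (fun _ _ => Equiv.refl _) (fun _ _ _ _ _ => rfl) (fun _ _ _ => rfl)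

/-- `F_* ⊠ 𝟙 ≅ (F × 𝟭)_*`. -/
def starTensorId {A B : Prof.{u}} (F : A.carrier ⥤ B.carrier) (D : Prof.{u}) :
    star F ⊠₁ 𝟙 D ≅ star (prodFunctor F (𝟭 D.carrier)) :=
  starTensor F (𝟭 D.carrier)

/-- `𝟙 ⊠ F_* ≅ (𝟭 × F)_*`. -/
def idTensorStar (D : Prof.{u}) {A B : Prof.{u}} (F : A.carrier ⥤ B.carrier) :
    𝟙 D ⊠₁ star F ≅ star (prodFunctor (𝟭 D.carrier) F) :=
  starTensor (𝟭 D.carrier) F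

/-- The functor `(A × B) × C ⥤ A × (B × C)`. -/
abbrev assocFunctor (A B C : Prof.{u}) : ((A ⊠ B) ⊠ C).carrier ⥤ (A ⊠ (B ⊠ C)).carrier :=
  prod.associator A.carrier B.carrier C.carrier

/-- The functor `1 × A ⥤ A`. -/
abbrev leftUnitFunctor (A : Prof.{u}) : (tensorUnit ⊠ A).carrier ⥤ A.carrier :=
  prod.leftUnitor A.carrier

/-- The functor `A × 1 ⥤ A`. -/
abbrev rightUnitFunctor (A : Prof.{u}) : (A ⊠ tensorUnit).carrier ⥤ A.carrier :=
  prod.rightUnitor A.carrier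

/-- The associator 1-cell `(A ⊠ B) ⊠ C ⟶ A ⊠ (B ⊠ C)`. -/
abbrev assoc (A B C : Prof.{u}) : (A ⊠ B) ⊠ C ⟶ A ⊠ (B ⊠ C) := star (assocFunctor A B C)

/-- The inverse associator 1-cell. -/
abbrev assocInv (A B C : Prof.{u}) : A ⊠ (B ⊠ C) ⟶ (A ⊠ B) ⊠ C :=
  star (prod.inverseAssociator A.carrier B.carrier C.carrier)

/-- The left unitor 1-cell `1 ⊠ A ⟶ A`. -/
abbrev leftUnit (A : Prof.{u}) : tensorUnit ⊠ A ⟶ A := star (leftUnitFunctor A)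

/-- The inverse left unitor 1-cell. -/
abbrev leftUnitInv (A : Prof.{u}) : A ⟶ tensorUnit ⊠ A := star (prod.leftInverseUnitor A.carrier)

/-- The right unitor 1-cell `A ⊠ 1 ⟶ A`. -/
abbrev rightUnit (A : Prof.{u}) : A ⊠ tensorUnit ⟶ A := star (rightUnitFunctor A)

/-- The inverse right unitor 1-cell. -/
abbrev rightUnitInv (A : Prof.{u}) : A ⟶ A ⊠ tensorUnit := star (prod.rightInverseUnitor A.carrier)

/-- For an adjunction `G ⊣ F`, composing with `F_*` is substituting `G` in the contravariant
variable: `P ; F_* ≅ P(G -, -)`. -/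
def compStar {A B C : Prof.{u}} {F : B.carrier ⥤ C.carrier} {G : C.carrier ⥤ B.carrier}
    (adj : G ⊣ F) (P : A ⟶ B) :
    P ≫ star F ≅ (show A ⟶ C from Functor.comp P ((Functor.whiskeringLeft _ _ _).obj G.op)) :=
  cellMk (P := P ≫ star F)
    (Q := show A ⟶ C from Functor.comp P ((Functor.whiskeringLeft _ _ _).obj G.op))
    (fun a c =>
    { toFun := CoendComp.lift (X := (P.obj a).obj (op (G.obj c.unop)))
        (fun b p (f : unop c ⟶ F.obj b) => (P.obj a).map ((adj.homEquiv _ _).symm f).op p)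
        (fun f p (q : unop c ⟶ F.obj _) => by
          change _ = (P.obj a).map ((adj.homEquiv _ _).symm (q ≫ F.map f)).op p
          rw [adj.homEquiv_naturality_right_symm]
          exact (types_congr_hom ((P.obj a).map_comp f.op ((adj.homEquiv _ _).symm q).op) p).symm)
      invFun := fun p =>
        CoendComp.mk (P := P) (Q := star F) (a := a) (c := c) (G.obj c.unop) p (adj.unit.app c.unop)
      left_inv := fun x => by
        induction x using CoendComp.ind with | _ b p f
        change unop c ⟶ F.obj b at f
        have := CoendComp.sound (P := P) (Q := star F) (a := a) (c := c)
          ((adj.homEquiv _ _).symm f) p (adj.unit.app c.unop)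
        refine this.trans (congrArg (CoendComp.mk b p) ?_)
        exact ((adj.homEquiv_unit _ _ _).symm.trans ((adj.homEquiv _ _).apply_symm_apply f))
      right_inv := fun p => by
        have h : (adj.homEquiv _ _).symm (adj.unit.app c.unop) = 𝟙 (G.obj c.unop) := by
          exact ((adj.homEquiv _ _).symm_apply_eq).2 (adj.homEquiv_id _).symm
        change (P.obj a).map ((adj.homEquiv _ _).symm (adj.unit.app c.unop)).op p = p
        rw [h]
        exact types_congr_hom ((P.obj a).map_id _) p })
    (fun a c c' g x => by
      induction x using CoendComp.ind with | _ b p f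
      change unop c ⟶ F.obj b at f
      change (P.obj a).map ((adj.homEquiv _ _).symm (g.unop ≫ f)).op p = _
      rw [adj.homEquiv_naturality_left_symm]
      exact types_congr_hom ((P.obj a).map_comp ((adj.homEquiv _ _).symm f).op (G.map g.unop).op) p)
    (fun {a a'} h c x => by
      induction x using CoendComp.ind with | _ b p f
      change unop c ⟶ F.obj b at f
      exact (NatTrans.naturality_apply (P.map h) ((adj.homEquiv _ _).symm f).op p).symm)

/-- Naturality of the associator in 1-cells:
`((P ⊠ Q) ⊠ R) ; assoc ≅ assoc ; (P ⊠ (Q ⊠ R))`. -/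
def assocNat {A B C A' B' C' : Prof.{u}} (P : A ⟶ A') (Q : B ⟶ B') (R : C ⟶ C') :
    ((P ⊠₁ Q) ⊠₁ R) ≫ assoc A' B' C' ≅ assoc A B C ≫ (P ⊠₁ (Q ⊠₁ R)) :=
  compStar (prod.associativity A'.carrier B'.carrier C'.carrier).symm.toAdjunction
      ((P ⊠₁ Q) ⊠₁ R) ≪≫
    cellMk (Q := restrict (prod.associator A.carrier B.carrier C.carrier) (P ⊠₁ (Q ⊠₁ R)))
      (fun _ _ => Equiv.prodAssoc _ _ _) (fun _ _ _ _ _ => rfl) (fun _ _ _ => rfl) ≪≫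
    (starRestrict _ _).symm

/-- `(P ⊠ 𝟙) ; (Q ⊠ 𝟙) ≅ (P ; Q) ⊠ 𝟙`. -/
def tensorCompRight {A B C : Prof.{u}} (P : A ⟶ B) (Q : B ⟶ C) (D : Prof.{u}) :
    (P ⊠₁ 𝟙 D) ≫ (Q ⊠₁ 𝟙 D) ≅ (P ≫ Q) ⊠₁ 𝟙 D :=
  tensorComp P Q (𝟙 D) (𝟙 D) ≪≫ tensorIso (Iso.refl _) (λ_ (𝟙 D))

/-- `(𝟙 ⊠ P) ; (𝟙 ⊠ Q) ≅ 𝟙 ⊠ (P ; Q)`. -/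
def tensorCompLeft {A B C : Prof.{u}} (D : Prof.{u}) (P : A ⟶ B) (Q : B ⟶ C) :
    (𝟙 D ⊠₁ P) ≫ (𝟙 D ⊠₁ Q) ≅ 𝟙 D ⊠₁ (P ≫ Q) :=
  tensorComp (𝟙 D) (𝟙 D) P Q ≪≫ tensorIso (λ_ (𝟙 D)) (Iso.refl _)

/-- `(P ⊠ 𝟙) ; (𝟙 ⊠ Q) ≅ (𝟙 ⊠ Q) ; (P ⊠ 𝟙)`. -/
def tensorSwap {A B C D : Prof.{u}} (P : A ⟶ B) (Q : C ⟶ D) :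
    (P ⊠₁ 𝟙 C) ≫ (𝟙 B ⊠₁ Q) ≅ (𝟙 A ⊠₁ Q) ≫ (P ⊠₁ 𝟙 D) :=
  tensorComp P (𝟙 B) (𝟙 C) Q ≪≫
    tensorIso (ρ_ P ≪≫ (λ_ P).symm) (λ_ Q ≪≫ (ρ_ Q).symm) ≪≫
      (tensorComp (𝟙 A) P Q (𝟙 D)).symm

/-- The coherence cell between the two ways of rebracketing a fourfold tensor product. -/
def pentagonCell (A B C D : Prof.{u}) :
    (assoc A B C ⊠₁ 𝟙 D) ≫ assoc A (B ⊠ C) D ≫ (𝟙 A ⊠₁ assoc B C D) ≅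
      assoc (A ⊠ B) C D ≫ assoc A B (C ⊠ D) :=
  whiskerRightIso (starTensorId (assocFunctor A B C) D) _ ≪≫
    whiskerLeftIso _ (whiskerLeftIso _ (idTensorStar A (assocFunctor B C D)) ≪≫
      starStar (assocFunctor A (B ⊠ C) D)
        (prodFunctor (𝟭 A.carrier) (assocFunctor B C D))) ≪≫
    starStar (C := A ⊠ (B ⊠ (C ⊠ D))) _ _ ≪≫
    starIso (F := prodFunctor (assocFunctor A B C) (𝟭 D.carrier) ⋙
        assocFunctor A (B ⊠ C) D ⋙ prodFunctor (𝟭 A.carrier) (assocFunctor B C D))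
      (G := assocFunctor (A ⊠ B) C D ⋙ assocFunctor A B (C ⊠ D)) (Iso.refl _) ≪≫
    (starStar (assocFunctor (A ⊠ B) C D) (assocFunctor A B (C ⊠ D))).symm

/-- The coherence cell between the two ways of removing a unit in the middle. -/
def triangleCell (A B : Prof.{u}) :
    assoc A tensorUnit B ≫ (𝟙 A ⊠₁ leftUnit B) ≅ rightUnit A ⊠₁ 𝟙 B :=
  whiskerLeftIso _ (idTensorStar A (leftUnitFunctor B)) ≪≫
    starStar (assocFunctor A tensorUnit B) (prodFunctor (𝟭 A.carrier) (leftUnitFunctor B)) ≪≫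
    starIso (B := A ⊠ B)
      (F := assocFunctor A tensorUnit B ⋙ prodFunctor (𝟭 A.carrier) (leftUnitFunctor B))
      (G := prodFunctor (rightUnitFunctor A) (𝟭 B.carrier)) (Iso.refl _) ≪≫
    (starTensorId (rightUnitFunctor A) B).symm


/-- Horizontal composition of 2-cells. -/
def hcomp {A B C : Prof.{u}} {P P' : A ⟶ B} {Q Q' : B ⟶ C} (s : P ⟶ P') (t : Q ⟶ Q') :
    P ≫ Q ⟶ P' ≫ Q' :=
  s ▷ Q ≫ P' ◁ t

/-- A biexact pairing `X ⊣ Y` with evaluation `ev`: a coevaluation `1 ⟶ Y ⊠ X` and invertible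
2-cells for the two zig-zags. -/
structure BiexactPairing {X Y : Prof.{u}} (ev : X ⊠ Y ⟶ tensorUnit) where
  coev : tensorUnit ⟶ Y ⊠ X
  zigzagLeft : rightUnitInv X ≫ (𝟙 X ⊠₁ coev) ≫ assocInv X Y X ≫ (ev ⊠₁ 𝟙 X) ≫ leftUnit X ≅ 𝟙 X
  zigzagRight : leftUnitInv Y ≫ (coev ⊠₁ 𝟙 Y) ≫ assoc Y X Y ≫ (𝟙 Y ⊠₁ ev) ≫ rightUnit Y ≅ 𝟙 Y

end Prof

open Bicategory Prof

/-- The 1-cells and 2-cells of a pseudomonoid structure on `A` in `Prof`. -/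
structure PseudomonoidData (A : Prof.{u}) where
  mul : A ⊠ A ⟶ A
  one : tensorUnit ⟶ A
  assoc : (mul ⊠₁ 𝟙 A) ≫ mul ≅ Prof.assoc A A A ≫ (𝟙 A ⊠₁ mul) ≫ mul
  leftUnit : (one ⊠₁ 𝟙 A) ≫ mul ≅ Prof.leftUnit A
  rightUnit : (𝟙 A ⊠₁ one) ≫ mul ≅ Prof.rightUnit A

namespace PseudomonoidData

variable {A : Prof.{u}} (M : PseudomonoidData A)

/-- `((ab)c)d ≅ (a(bc))d ≅ a((bc)d) ≅ a(b(cd))`. -/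
def pentagonLong :
    ((M.mul ⊠₁ 𝟙 A) ⊠₁ 𝟙 A) ≫ (M.mul ⊠₁ 𝟙 A) ≫ M.mul ⟶
      Prof.assoc (A ⊠ A) A A ≫ Prof.assoc A A (A ⊠ A) ≫
        (𝟙 A ⊠₁ (𝟙 A ⊠₁ M.mul)) ≫ (𝟙 A ⊠₁ M.mul) ≫ M.mul :=
  𝟙 _ ⊗≫
    (tensorCompRight (M.mul ⊠₁ 𝟙 A) M.mul A).hom ▷ M.mul ⊗≫
    (M.assoc.hom ⊠₂ 𝟙 (𝟙 A)) ▷ M.mul ⊗≫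
    (tensorCompRight (Prof.assoc A A A) ((𝟙 A ⊠₁ M.mul) ≫ M.mul) A).inv ▷ M.mul ⊗≫
    (Prof.assoc A A A ⊠₁ 𝟙 A) ◁ (tensorCompRight (𝟙 A ⊠₁ M.mul) M.mul A).inv ▷ M.mul ⊗≫
    (Prof.assoc A A A ⊠₁ 𝟙 A) ◁ ((𝟙 A ⊠₁ M.mul) ⊠₁ 𝟙 A) ◁ M.assoc.hom ⊗≫
    (Prof.assoc A A A ⊠₁ 𝟙 A) ◁ (assocNat (𝟙 A) M.mul (𝟙 A)).hom ▷ ((𝟙 A ⊠₁ M.mul) ≫ M.mul) ⊗≫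
    (Prof.assoc A A A ⊠₁ 𝟙 A) ◁ Prof.assoc A (A ⊠ A) A ◁
      (tensorCompLeft A (M.mul ⊠₁ 𝟙 A) M.mul).hom ▷ M.mul ⊗≫
    (Prof.assoc A A A ⊠₁ 𝟙 A) ◁ Prof.assoc A (A ⊠ A) A ◁
      (𝟙 (𝟙 A) ⊠₂ M.assoc.hom) ▷ M.mul ⊗≫
    (Prof.assoc A A A ⊠₁ 𝟙 A) ◁ Prof.assoc A (A ⊠ A) A ◁
      (tensorCompLeft A (Prof.assoc A A A) ((𝟙 A ⊠₁ M.mul) ≫ M.mul)).inv ▷ M.mul ⊗≫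
    (Prof.assoc A A A ⊠₁ 𝟙 A) ◁ Prof.assoc A (A ⊠ A) A ◁ (𝟙 A ⊠₁ Prof.assoc A A A) ◁
      (tensorCompLeft A (𝟙 A ⊠₁ M.mul) M.mul).inv ▷ M.mul ⊗≫
    (pentagonCell A A A A).hom ▷ ((𝟙 A ⊠₁ (𝟙 A ⊠₁ M.mul)) ≫ (𝟙 A ⊠₁ M.mul) ≫ M.mul) ⊗≫
    𝟙 _

/-- `((ab)c)d ≅ (ab)(cd) ≅ a(b(cd))`. -/
def pentagonShort :
    ((M.mul ⊠₁ 𝟙 A) ⊠₁ 𝟙 A) ≫ (M.mul ⊠₁ 𝟙 A) ≫ M.mul ⟶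
      Prof.assoc (A ⊠ A) A A ≫ Prof.assoc A A (A ⊠ A) ≫
        (𝟙 A ⊠₁ (𝟙 A ⊠₁ M.mul)) ≫ (𝟙 A ⊠₁ M.mul) ≫ M.mul :=
  ((M.mul ⊠₁ 𝟙 A) ⊠₁ 𝟙 A) ◁ M.assoc.hom ⊗≫
    (assocNat M.mul (𝟙 A) (𝟙 A)).hom ▷ ((𝟙 A ⊠₁ M.mul) ≫ M.mul) ⊗≫
    Prof.assoc (A ⊠ A) A A ◁ (𝟙 M.mul ⊠₂ (tensorId A A).hom) ▷ ((𝟙 A ⊠₁ M.mul) ≫ M.mul) ⊗≫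
    Prof.assoc (A ⊠ A) A A ◁ (tensorSwap M.mul M.mul).hom ▷ M.mul ⊗≫
    Prof.assoc (A ⊠ A) A A ◁ (𝟙 (A ⊠ A) ⊠₁ M.mul) ◁ M.assoc.hom ⊗≫
    Prof.assoc (A ⊠ A) A A ◁ ((tensorId A A).inv ⊠₂ 𝟙 M.mul) ▷
      (Prof.assoc A A A ≫ (𝟙 A ⊠₁ M.mul) ≫ M.mul) ⊗≫
    Prof.assoc (A ⊠ A) A A ◁ (assocNat (𝟙 A) (𝟙 A) M.mul).hom ▷ ((𝟙 A ⊠₁ M.mul) ≫ M.mul) ⊗≫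
    𝟙 _

/-- `(a1)b ≅ a(1b) ≅ ab`. -/
def triangleLong :
    ((𝟙 A ⊠₁ M.one) ⊠₁ 𝟙 A) ≫ (M.mul ⊠₁ 𝟙 A) ≫ M.mul ⟶ (Prof.rightUnit A ⊠₁ 𝟙 A) ≫ M.mul :=
  ((𝟙 A ⊠₁ M.one) ⊠₁ 𝟙 A) ◁ M.assoc.hom ⊗≫
    (assocNat (𝟙 A) M.one (𝟙 A)).hom ▷ ((𝟙 A ⊠₁ M.mul) ≫ M.mul) ⊗≫
    Prof.assoc A tensorUnit A ◁ (tensorCompLeft A (M.one ⊠₁ 𝟙 A) M.mul).hom ▷ M.mul ⊗≫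
    Prof.assoc A tensorUnit A ◁ (𝟙 (𝟙 A) ⊠₂ M.leftUnit.hom) ▷ M.mul ⊗≫
    (triangleCell A A).hom ▷ M.mul ⊗≫
    𝟙 _

/-- `(a1)b ≅ ab`. -/
def triangleShort :
    ((𝟙 A ⊠₁ M.one) ⊠₁ 𝟙 A) ≫ (M.mul ⊠₁ 𝟙 A) ≫ M.mul ⟶ (Prof.rightUnit A ⊠₁ 𝟙 A) ≫ M.mul :=
  𝟙 _ ⊗≫
    (tensorCompRight (𝟙 A ⊠₁ M.one) M.mul A).hom ▷ M.mul ⊗≫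
    (M.rightUnit.hom ⊠₂ 𝟙 (𝟙 A)) ▷ M.mul ⊗≫
    𝟙 _

/-- The coherence axioms of a pseudomonoid. -/
structure IsPseudomonoid : Prop where
  pentagon : M.pentagonLong = M.pentagonShort
  triangle : M.triangleLong = M.triangleShort

end PseudomonoidData

/-- The 1-cells and 2-cells of a Frobenius pseudomonoid structure on `A` in `Prof`. -/
structure FrobeniusData (A : Prof.{u}) extends PseudomonoidData A where
  form : A ⊠ A ⟶ tensorUnit
  invariance : (mul ⊠₁ 𝟙 A) ≫ form ≅ Prof.assoc A A A ≫ (𝟙 A ⊠₁ mul) ≫ form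

namespace FrobeniusData

variable {A : Prof.{u}}

/-- The axioms of a `†`-Frobenius pseudomonoid: the pseudomonoid axioms, the form is the
evaluation of a biexact pairing `A ⊣ A`, and multiplication and unit have right adjoints. -/
structure IsDaggerFrobenius (P : FrobeniusData A) : Prop where
  isPseudomonoid : P.IsPseudomonoid
  biexact : Nonempty (BiexactPairing P.form)
  mul_adjoint : IsLeftAdjoint P.mul
  one_adjoint : IsLeftAdjoint P.one

/-- Isomorphisms of Frobenius structures on `A`: invertible 2-cells between the multiplications,
units and forms, compatible with all structure 2-cells. -/
structure Iso (P Q : FrobeniusData A) where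
  mul : P.mul ≅ Q.mul
  one : P.one ≅ Q.one
  form : P.form ≅ Q.form
  assoc_comm : P.assoc.hom ≫ Prof.assoc A A A ◁ hcomp (𝟙 (𝟙 A) ⊠₂ mul.hom) mul.hom =
    hcomp (mul.hom ⊠₂ 𝟙 (𝟙 A)) mul.hom ≫ Q.assoc.hom
  leftUnit_comm : P.leftUnit.hom = hcomp (one.hom ⊠₂ 𝟙 (𝟙 A)) mul.hom ≫ Q.leftUnit.hom
  rightUnit_comm : P.rightUnit.hom = hcomp (𝟙 (𝟙 A) ⊠₂ one.hom) mul.hom ≫ Q.rightUnit.hom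
  invariance_comm : P.invariance.hom ≫ Prof.assoc A A A ◁ hcomp (𝟙 (𝟙 A) ⊠₂ mul.hom) form.hom =
    hcomp (mul.hom ⊠₂ 𝟙 (𝟙 A)) form.hom ≫ Q.invariance.hom

end FrobeniusData

section Representable

open MonoidalCategory

variable (A : Prof.{u}) [MonoidalCategory A.carrier]

/-- The tensor product functor. -/
abbrev tensorFunctor : (A ⊠ A).carrier ⥤ A.carrier := tensor A.carrier

/-- The functor from the terminal category selecting the unit object. -/
abbrev unitFunctor : tensorUnit.carrier ⥤ A.carrier := Functor.fromPUnit (𝟙_ A.carrier)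

/-- The associator as a natural isomorphism `⊗ ∘ (⊗ × 𝟭) ≅ ⊗ ∘ (𝟭 × ⊗) ∘ assoc`. -/
def assocNatIso : prodFunctor (tensorFunctor A) (𝟭 A.carrier) ⋙ tensorFunctor A ≅
    assocFunctor A A A ⋙ prodFunctor (𝟭 A.carrier) (tensorFunctor A) ⋙ tensorFunctor A :=
  NatIso.ofComponents (fun X => α_ X.1.1 X.1.2 X.2)
    (fun f => associator_naturality f.1.1 f.1.2 f.2)

/-- The left unitor as a natural isomorphism. -/
def leftUnitNatIso : prodFunctor (unitFunctor A) (𝟭 A.carrier) ⋙ tensorFunctor A ≅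
    leftUnitFunctor A :=
  NatIso.ofComponents (fun X => λ_ X.2)
    (fun f => (congrArg (· ≫ _) (id_tensorHom _ f.2)).trans (leftUnitor_naturality f.2))

/-- The right unitor as a natural isomorphism. -/
def rightUnitNatIso : prodFunctor (𝟭 A.carrier) (unitFunctor A) ⋙ tensorFunctor A ≅
    rightUnitFunctor A :=
  NatIso.ofComponents (fun X => ρ_ X.1)
    (fun f => (congrArg (· ≫ _) (tensorHom_id f.1 _)).trans (rightUnitor_naturality f.1))

/-- The representable pseudomonoid of a monoidal category `A`: multiplication `⊗_*`, unit `1_*`,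
and structure cells `α_*`, `λ_*`, `ρ_*`. -/
def PseudomonoidData.ofMonoidal : PseudomonoidData A where
  mul := star (tensorFunctor A)
  one := star (unitFunctor A)
  assoc :=
    whiskerRightIso (starTensorId (tensorFunctor A) A) _ ≪≫ starStar _ _ ≪≫
      starIso (assocNatIso A) ≪≫ (starStar _ _).symm ≪≫
      whiskerLeftIso _ ((starStar _ _).symm ≪≫
        whiskerRightIso (idTensorStar A (tensorFunctor A)).symm _)
  leftUnit := whiskerRightIso (starTensorId (unitFunctor A) A) _ ≪≫ starStar _ _ ≪≫
    starIso (leftUnitNatIso A)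
  rightUnit := whiskerRightIso (idTensorStar A (unitFunctor A)) _ ≪≫ starStar _ _ ≪≫
    starIso (rightUnitNatIso A)

end Representable

/-- A `⋆`-autonomous structure on a category `C`: a monoidal structure, an equivalence
`D : C ⥤ Cᵒᵖ`, and natural bijections `Hom(x ⊗ y, D z) ≃ Hom(x, D (y ⊗ z))`. -/
structure StarAutonomous (C : Type u) [SmallCategory C] where
  monoidal : MonoidalCategory C
  D : C ⥤ Cᵒᵖ
  isEquivalence : D.IsEquivalence
  homEquiv (x y z : C) :
    (MonoidalCategory.tensorObj x y ⟶ (D.obj z).unop) ≃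
      (x ⟶ (D.obj (MonoidalCategory.tensorObj y z)).unop)
  homEquiv_naturality {x x' y y' z z' : C} (f : x' ⟶ x) (g : y' ⟶ y) (h : z' ⟶ z)
    (k : MonoidalCategory.tensorObj x y ⟶ (D.obj z).unop) :
    homEquiv x' y' z' (MonoidalCategory.tensorHom f g ≫ k ≫ (D.map h).unop) =
      f ≫ homEquiv x y z k ≫ (D.map (MonoidalCategory.tensorHom g h)).unop

namespace StarAutonomous

variable {C : Type u} [SmallCategory C]

/-- The profunctor `(⋆, (x, y)) ↦ Hom_C(x, D y)` from `Cᵒᵖ × Cᵒᵖ` to the terminal category. -/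
def dualForm (D : C ⥤ Cᵒᵖ) : Prof.of Cᵒᵖ ⊠ Prof.of Cᵒᵖ ⟶ tensorUnit :=
  show Profunctor.{u} (Cᵒᵖ × Cᵒᵖ) (Discrete PUnit.{u + 1}) from
  { obj := fun x => (Functor.const _).obj (x.1.unop ⟶ (D.obj x.2.unop).unop)
    map := fun {x x'} f => (Functor.const _).map
      (↾(fun (k : x.1.unop ⟶ (D.obj x.2.unop).unop) => f.1.unop ≫ k ≫ (D.map f.2.unop).unop))
    map_id := fun x => by
      refine NatTrans.ext (funext fun b => ConcreteCategory.ext_apply fun k => ?_)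
      change x.1.unop ⟶ (D.obj x.2.unop).unop at k
      change 𝟙 x.1.unop ≫ k ≫ (D.map (𝟙 x.2.unop)).unop = k
      simp
    map_comp := fun {x y z} f g => by
      refine NatTrans.ext (funext fun b => ConcreteCategory.ext_apply fun k => ?_)
      change x.1.unop ⟶ (D.obj x.2.unop).unop at k
      change (g.1.unop ≫ f.1.unop) ≫ k ≫ (D.map (g.2.unop ≫ f.2.unop)).unop =
        g.1.unop ≫ (f.1.unop ≫ k ≫ (D.map f.2.unop).unop) ≫ (D.map g.2.unop).unop
      simp }

variable (S : StarAutonomous C)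

/-- The natural bijections `Hom(x ⊗ y, D z) ≃ Hom(x, D (y ⊗ z))` as a 2-cell between restrictions
of the form. -/
def formCell :
    letI := S.monoidal
    restrict (prodFunctor (tensorFunctor (Prof.of Cᵒᵖ)) (𝟭 Cᵒᵖ)) (dualForm S.D) ≅
      restrict (assocFunctor (Prof.of Cᵒᵖ) (Prof.of Cᵒᵖ) (Prof.of Cᵒᵖ))
        (restrict (prodFunctor (𝟭 Cᵒᵖ) (tensorFunctor (Prof.of Cᵒᵖ))) (dualForm S.D)) :=
  letI := S.monoidal
  cellMk (fun x _ => S.homEquiv x.1.1.unop x.1.2.unop x.2.unop)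
    (fun _ _ _ _ _ => rfl)
    (fun f _ k => S.homEquiv_naturality f.1.1.unop f.1.2.unop f.2.unop k)

/-- The Frobenius structure on `Cᵒᵖ` induced by a `⋆`-autonomous structure on `C`: the
representable pseudomonoid of the opposite monoidal category, with form `Hom_C(x, D y)`. -/
def toFrobeniusData : FrobeniusData (Prof.of Cᵒᵖ) :=
  letI := S.monoidal
  { PseudomonoidData.ofMonoidal (Prof.of Cᵒᵖ) with
    form := dualForm S.D
    invariance :=
      whiskerRightIso (starTensorId (tensorFunctor (Prof.of Cᵒᵖ)) (Prof.of Cᵒᵖ)) _ ≪≫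
        starRestrict _ _ ≪≫ S.formCell ≪≫ (starRestrict _ _).symm ≪≫
        whiskerLeftIso _ ((starRestrict _ _).symm ≪≫
          whiskerRightIso (idTensorStar (Prof.of Cᵒᵖ) (tensorFunctor (Prof.of Cᵒᵖ))).symm _) }

/-- Isomorphisms of `⋆`-autonomous structures on `C`: a strong monoidal structure on the identity
functor and an isomorphism of the dualities, compatible with the bijections
`Hom(x ⊗ y, D z) ≃ Hom(x, D (y ⊗ z))`. -/
structure Iso (S T : StarAutonomous C) where
  monoidal : @Functor.Monoidal C _ S.monoidal C _ T.monoidal (𝟭 C)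
  dual : S.D ≅ T.D
  homEquiv_comm (x y z : C) (k : S.monoidal.tensorObj x y ⟶ (S.D.obj z).unop) :
    letI μ (x y : C) : T.monoidal.tensorObj x y ⟶ S.monoidal.tensorObj x y :=
      @Functor.LaxMonoidal.μ C _ S.monoidal C _ T.monoidal (𝟭 C) monoidal.toLaxMonoidal x y
    T.homEquiv x y z (μ x y ≫ k ≫ (dual.inv.app z).unop) =
      S.homEquiv x y z k ≫ (dual.inv.app (S.monoidal.tensorObj y z)).unop ≫
        (T.D.map (μ y z)).unop

end StarAutonomous

/-- A Frobenius structure on `Cᵒᵖ` is representable if its multiplication and unit are the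
representable profunctors of functors, and its form is `Hom_C(x, D y)` for an equivalence `D`. -/
def FrobeniusData.IsRepresentable {C : Type u} [SmallCategory C]
    (P : FrobeniusData (Prof.of Cᵒᵖ)) : Prop :=
  (∃ F : Cᵒᵖ × Cᵒᵖ ⥤ Cᵒᵖ, Nonempty (P.mul ≅ star (A := Prof.of Cᵒᵖ ⊠ Prof.of Cᵒᵖ) F)) ∧
    (∃ G : Discrete PUnit.{u + 1} ⥤ Cᵒᵖ, Nonempty (P.one ≅ star (A := tensorUnit) G)) ∧
    ∃ D : C ⥤ Cᵒᵖ, D.IsEquivalence ∧ Nonempty (P.form ≅ StarAutonomous.dualForm D)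

end ProfBicat

/-! The engine is Yoneda. A profunctor `P` for which every `P(-, x)` has a universal element is
`F_*` for a functor `F`, and a 2-cell between two such profunctors is a natural transformation of
the representing functors, read off by `Rep.app` from its value on universal elements. Composites
and tensor products of represented 1-cells are represented, and whiskering, tensoring and
composition of 2-cells become the expected operations on components. All the bookkeeping cells of
the monoidal bicategory (associators, unitors, interchange, the pentagon and triangle cells) have
identity components (`Strict`). Hence the large pasting diagrams in the pseudomonoid axioms collapse
to the usual pentagon and triangle (`pentagon_iff`, `triangle_iff`), and a pseudomonoid on `Cᵒᵖ`
with represented multiplication and unit is a monoidal structure on `C`.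

The form is not represented, since its target is the terminal category, but composites of a
represented 1-cell with it can still be evaluated by co-Yoneda (`eval_bijective`). The invariance
2-cell thus becomes a natural family of bijections `σ(ab, c) ≃ σ(a, bc)`, which for `σ = Hom(x, D
y)` is the family `φ`.

For the dagger conditions, `F_*` has right adjoint `Hom(F -, -)`. A form on `X ⊠ Y` curries to a
1-cell from `X` to the opposite of `Y`, a coevaluation curries to a 1-cell back, and the two
zig-zags are the two composites of these, the second one up to transposition. So a biexact pairing
is the same as an equivalence in `Prof`. For `Hom(x, D y)` with `D` an equivalence, the curried
1-cell is represented by an inverse of `D`, up to double opposites.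

Given idempotent splitting, a left adjoint 1-cell is represented: the unit of the adjunction at an
identity picks out one element `p` from which all others are obtained by restriction, in a way
chosen by the counit; the failure of uniqueness is measured by an idempotent, and splitting it gives
a universal element (`exists_universal_of_adjunction`). This applies to the multiplication, the unit
and both curried 1-cells.

Finally, `Ψ(P)` is read off from representations of the data of `P`, with `Φ(Ψ(P)) ≅ P` given by
`toStarAutonomousIso`. The other composite needs no separate computation: isomorphisms `Φ(S) ≅ Φ(T)`
come down to isomorphisms `S ≅ T` (`isoOfFrobeniusIso`), and this is applied to `Φ(Ψ(Φ(S))) ≅ Φ(S)`.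
-/

namespace ProfBicat

namespace Prof

open Bicategory

/-! ### Represented profunctors and components of 2-cells -/

section Rep

variable {X Y Z W : Prof.{u}}

/-- A representation of a 1-cell by a functor, through universal elements. -/
class Rep (P : X ⟶ Y) where
  functor : X.carrier ⥤ Y.carrier
  elem (x : X.carrier) : (P.obj x).obj (op (functor.obj x))
  map_elem {x x' : X.carrier} (f : x ⟶ x') :
    (P.map f).app _ (elem x) = (P.obj x').map (functor.map f).op (elem x')
  bijective (x : X.carrier) (y : Y.carrier) :
    Function.Bijective (fun f : y ⟶ functor.obj x => (P.obj x).map f.op (elem x))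

namespace Rep

/-- The component at `x` of the natural transformation corresponding to a 2-cell. -/
noncomputable def app {P Q : X ⟶ Y} [Rep P] [Rep Q] (s : P ⟶ Q) (x : X.carrier) :
    (functor P).obj x ⟶ (functor Q).obj x :=
  ((Rep.bijective (P := Q) x _).2 ((s.app x).app _ (elem x))).choose

theorem app_spec {P Q : X ⟶ Y} [Rep P] [Rep Q] (s : P ⟶ Q) (x : X.carrier) :
    (s.app x).app _ (elem x) = (Q.obj x).map (app s x).op (elem x) :=
  ((Rep.bijective (P := Q) x _).2 ((s.app x).app _ (elem x))).choose_spec.symm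

/-- The uniqueness half of universality. The computations of `app` below reduce to it: a candidate
component is checked on the universal element alone. -/
theorem app_eq {P Q : X ⟶ Y} [Rep P] [Rep Q] (s : P ⟶ Q) (x : X.carrier)
    (f : (functor P).obj x ⟶ (functor Q).obj x)
    (h : (s.app x).app _ (elem x) = (Q.obj x).map f.op (elem x)) : app s x = f :=
  (Rep.bijective (P := Q) x _).1 ((app_spec s x).symm.trans h)

theorem map_map (P : X ⟶ Y) {x : X.carrier} {y y' y'' : Y.carrier} (f : y ⟶ y') (g : y' ⟶ y'')
    (p : (P.obj x).obj (op y'')) :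
    (P.obj x).map f.op ((P.obj x).map g.op p) = (P.obj x).map (f ≫ g).op p :=
  (types_congr_hom ((P.obj x).map_comp g.op f.op) p).symm

theorem map_id (P : X ⟶ Y) {x : X.carrier} {y : Y.carrier} (p : (P.obj x).obj (op y)) :
    (P.obj x).map (𝟙 y).op p = p :=
  types_congr_hom ((P.obj x).map_id (op y)) p

theorem app_apply {P Q : X ⟶ Y} [Rep P] [Rep Q] (s : P ⟶ Q) {x : X.carrier} {y : Y.carrier}
    (f : y ⟶ (functor P).obj x) :
    (s.app x).app _ ((P.obj x).map f.op (elem x)) = (Q.obj x).map (f ≫ app s x).op (elem x) := by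
  refine (NatTrans.naturality_apply (s.app x) f.op (elem x)).trans ?_
  rw [app_spec, map_map]

/-- Yoneda: every element of `P` is a restriction of a universal one, so naturality determines a
2-cell from its components. -/
theorem ext_app {P Q : X ⟶ Y} [Rep P] [Rep Q] {s t : P ⟶ Q} (h : ∀ x, app s x = app t x) :
    s = t := by
  refine cell_ext fun x y p => ?_
  obtain ⟨f, rfl⟩ := (Rep.bijective (P := P) x y.unop).2 p
  refine (app_apply s f).trans (Eq.trans ?_ (app_apply t f).symm)
  rw [h]

theorem app_naturality {P Q : X ⟶ Y} [Rep P] [Rep Q] (s : P ⟶ Q) {x x' : X.carrier} (f : x ⟶ x') :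
    (functor P).map f ≫ app s x' = app s x ≫ (functor Q).map f := by
  apply (Rep.bijective (P := Q) x' _).1
  change (Q.obj x').map _ _ = (Q.obj x').map _ _
  rw [← app_apply, ← map_elem, ← map_map, ← map_elem]
  refine (types_congr_hom (NatTrans.congr_app (s.naturality f) _) (elem x)).trans ?_
  change (Q.map f).app _ ((s.app x).app _ (elem x)) = _
  rw [app_spec]
  exact NatTrans.naturality_apply (Q.map f) (app s x).op (elem x)

section Instances

instance star (F : X.carrier ⥤ Y.carrier) : Rep (Prof.star F : X ⟶ Y) where
  functor := F
  elem x := 𝟙 (F.obj x)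
  map_elem f := (Category.id_comp _).trans (Category.comp_id _).symm
  bijective x y := by
    have h : (fun f : y ⟶ F.obj x => ((Prof.star F).obj x).map f.op (𝟙 (F.obj x))) =
        fun f => f := funext fun f => Category.comp_id f
    rw [h]
    exact Function.bijective_id

instance id (X : Prof.{u}) : Rep (𝟙 X) := Rep.star (𝟭 X.carrier)

instance tensor {X' Y' : Prof.{u}} (P : X ⟶ Y) (Q : X' ⟶ Y') [Rep P] [Rep Q] : Rep (P ⊠₁ Q) where
  functor := Functor.prod (functor P) (functor Q)
  elem x := (elem x.1, elem x.2)
  map_elem f := Prod.ext (map_elem f.1) (map_elem f.2)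
  bijective x y := (bijective (P := P) x.1 y.1).prodMap (bijective (P := Q) x.2 y.2)

/-- Sliding `f` across the coend normalises the first factor to the universal element. -/
theorem mk_eq (P : X ⟶ Y) [Rep P] (Q : Y ⟶ Z) {x : X.carrier} {z : Z.carrierᵒᵖ} {y : Y.carrier}
    (f : y ⟶ (functor P).obj x) (q : (Q.obj y).obj z) :
    (CoendComp.mk y ((P.obj x).map f.op (elem x)) q : CoendComp P Q x z) =
      CoendComp.mk ((functor P).obj x) (elem x) ((Q.map f).app z q) :=
  CoendComp.sound f (elem x) q

/-- Elements of `(P ; Q)(z, x)` for `P` represented by `F` are elements of `Q(z, F x)`. -/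
def eval (P : X ⟶ Y) [Rep P] (Q : Y ⟶ Z) (x : X.carrier) (z : Z.carrierᵒᵖ)
    (q : (Q.obj ((functor P).obj x)).obj z) : CoendComp P Q x z :=
  CoendComp.mk _ (elem x) q

/-- Co-Yoneda. The inverse writes the first factor of a class as the restriction of the universal
element along a unique `g` and lets `g` act on the second factor. `Q` is arbitrary here, so this
also serves for composites with a form. -/
theorem eval_bijective (P : X ⟶ Y) [Rep P] (Q : Y ⟶ Z) (x : X.carrier) (z : Z.carrierᵒᵖ) :
    Function.Bijective (eval P Q x z) := by
  let e (y : Y.carrier) := Equiv.ofBijective _ (bijective (P := P) x y)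
  have he (y y' : Y.carrier) (f : y ⟶ y') (g) :
      (e y).symm ((P.obj x).map f.op ((e y') g)) = f ≫ g :=
    (Equiv.symm_apply_eq _).2 (map_map P f g (elem x))
  let inv : CoendComp P Q x z → (Q.obj ((functor P).obj x)).obj z :=
    CoendComp.lift (fun y p q => (Q.map ((e y).symm p)).app z q) (fun f p q => by
      obtain ⟨g, rfl⟩ := (e _).surjective p
      rw [he, Equiv.symm_apply_apply]
      exact types_congr_hom (NatTrans.congr_app (Q.map_comp f g) z) q)
  refine Function.bijective_iff_has_inverse.2 ⟨inv, fun q => ?_, fun t => ?_⟩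
  · change (Q.map ((e _).symm (elem x))).app z q = q
    have : (e _).symm (elem x) = 𝟙 _ := (Equiv.symm_apply_eq _).2 (map_id P (elem x)).symm
    rw [this]
    exact types_congr_hom (NatTrans.congr_app (Q.map_id _) z) q
  · induction t using CoendComp.ind with | _ y p q
    obtain ⟨g, rfl⟩ := (e _).surjective p
    change CoendComp.mk _ (elem x) ((Q.map ((e y).symm (e y g))).app z q) = _
    rw [Equiv.symm_apply_apply]
    exact (mk_eq P Q g q).symm

instance comp (P : X ⟶ Y) (Q : Y ⟶ Z) [Rep P] [Rep Q] : Rep (P ≫ Q) where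
  functor := functor P ⋙ functor Q
  elem x := CoendComp.mk ((functor P).obj x) (elem x) (elem ((functor P).obj x))
  map_elem {x x'} f := by
    refine (congrArg (CoendComp.mk (P := P) (Q := Q) _ · _) (map_elem f)).trans ?_
    refine (mk_eq P Q _ _).trans ?_
    exact congrArg (CoendComp.mk (P := P) (Q := Q) _ _) (map_elem ((functor P).map f))
  bijective x z := (eval_bijective P Q x (op z)).comp (bijective (P := Q) _ z)

end Instances

section App

theorem app_id (P : X ⟶ Y) [Rep P] (x : X.carrier) : app (𝟙 P) x = 𝟙 _ :=
  app_eq _ _ _ (map_id P _).symm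

theorem app_comp {P Q R : X ⟶ Y} [Rep P] [Rep Q] [Rep R] (s : P ⟶ Q) (t : Q ⟶ R) (x : X.carrier) :
    app (s ≫ t) x = app s x ≫ app t x :=
  app_eq _ _ _ ((congrArg ((t.app x).app _) (app_spec s x)).trans (app_apply t _))

theorem app_whiskerLeft (P : X ⟶ Y) {Q R : Y ⟶ Z} [Rep P] [Rep Q] [Rep R] (t : Q ⟶ R)
    (x : X.carrier) : app (P ◁ t) x = app t ((functor P).obj x) :=
  app_eq _ _ _ (congrArg (CoendComp.mk _ _) (app_spec t _))

theorem app_whiskerRight {P Q : X ⟶ Y} (R : Y ⟶ Z) [Rep P] [Rep Q] [Rep R] (s : P ⟶ Q)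
    (x : X.carrier) : app (s ▷ R) x = (functor R).map (app s x) :=
  app_eq _ _ _ (by
    refine (congrArg (CoendComp.mk (P := Q) (Q := R) _ · (elem _)) (app_spec s x)).trans ?_
    refine (mk_eq Q R _ _).trans ?_
    exact congrArg (CoendComp.mk _ _) (map_elem (P := R) (app s x)))

theorem app_tensorMap {X' Y' : Prof.{u}} {P Q : X ⟶ Y} {P' Q' : X' ⟶ Y'} [Rep P] [Rep Q] [Rep P']
    [Rep Q'] (s : P ⟶ Q) (t : P' ⟶ Q') (x : (X ⊠ X').carrier) :
    app (s ⊠₂ t) x = Prod.mkHom (app s x.1) (app t x.2) :=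
  app_eq _ _ _ (Prod.ext (app_spec s x.1) (app_spec t x.2))

theorem app_associator_hom (P : X ⟶ Y) (Q : Y ⟶ Z) (R : Z ⟶ W) [Rep P] [Rep Q] [Rep R]
    (x : X.carrier) : app (α_ P Q R).hom x = 𝟙 _ :=
  app_eq _ _ _ (map_id _ _).symm

/-- A one-sided inverse `g` is enough, because `app s.inv x` is already known to invert `f` on the
other side. -/
theorem app_inv {P Q : X ⟶ Y} [Rep P] [Rep Q] (s : P ≅ Q) (x : X.carrier)
    (f : (functor P).obj x ⟶ (functor Q).obj x) (g : (functor Q).obj x ⟶ (functor P).obj x)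
    (hf : app s.hom x = f) (hfg : g ≫ f = 𝟙 _) :
    app s.inv x = g := by
  have h := app_comp s.hom s.inv x
  rw [s.hom_inv_id, app_id] at h
  rw [← Category.id_comp (app s.inv x), ← hfg, Category.assoc, ← hf, ← h, Category.comp_id]

theorem app_leftUnitor_hom (P : X ⟶ Y) [Rep P] (x : X.carrier) : app (λ_ P).hom x = 𝟙 _ :=
  app_eq _ _ _ (by
    refine (types_congr_hom (NatTrans.congr_app (P.map_id x) _) (elem x)).trans ?_
    exact (map_id _ _).symm)

theorem app_rightUnitor_hom (P : X ⟶ Y) [Rep P] (x : X.carrier) : app (ρ_ P).hom x = 𝟙 _ :=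
  app_eq _ _ _ rfl

theorem app_tensorComp_hom {X' Y' Z' : Prof.{u}} (P : X ⟶ Y) (Q : Y ⟶ Z) (P' : X' ⟶ Y')
    (Q' : Y' ⟶ Z') [Rep P] [Rep Q] [Rep P'] [Rep Q'] (x : (X ⊠ X').carrier) :
    app (tensorComp P Q P' Q').hom x = 𝟙 _ :=
  app_eq _ _ _ (map_id ((P ≫ Q) ⊠₁ (P' ≫ Q')) _).symm

theorem app_tensorId_hom (X Y : Prof.{u}) (x : (X ⊠ Y).carrier) :
    app (tensorId X Y).hom x = 𝟙 _ :=
  app_eq _ _ _ (map_id (𝟙 (X ⊠ Y)) _).symm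

theorem app_starIso_hom {F G : X.carrier ⥤ Y.carrier} (t : F ≅ G) (x : X.carrier) :
    app (starIso t : Prof.star F ≅ Prof.star G).hom x = t.hom.app x :=
  app_eq _ _ _ ((Category.id_comp _).trans (Category.comp_id _).symm)

theorem app_starStar_hom (F : X.carrier ⥤ Y.carrier) (G : Y.carrier ⥤ Z.carrier) (x : X.carrier) :
    app (starStar F G).hom x = 𝟙 _ :=
  app_eq _ _ _ (by
    change 𝟙 _ ≫ G.map (𝟙 _) = 𝟙 _ ≫ 𝟙 _
    simp)

theorem app_starTensor_hom {X' Y' : Prof.{u}} (F : X.carrier ⥤ Y.carrier)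
    (G : X'.carrier ⥤ Y'.carrier) (x : (X ⊠ X').carrier) : app (starTensor F G).hom x = 𝟙 _ :=
  app_eq _ _ _ (map_id (Prof.star (prodFunctor F G)) _).symm

theorem app_assocNat_hom {X' Y' Z' : Prof.{u}} (P : X ⟶ X') (Q : Y ⟶ Y') (R : Z ⟶ Z')
    [Rep P] [Rep Q] [Rep R] (x : ((X ⊠ Y) ⊠ Z).carrier) : app (assocNat P Q R).hom x = 𝟙 _ :=
  app_eq _ _ _ (by
    refine congrArg (CoendComp.mk _ _) (Eq.trans ?_
      (map_id (P ⊠₁ (Q ⊠₁ R)) (elem (P := P ⊠₁ (Q ⊠₁ R)) (x.1.1, x.1.2, x.2))).symm)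
    -- The arrow produced by the substitution along the equivalence is an identity only after
    -- computation, so it is generalised to a variable `f` with `f = 𝟙 _`, which can then be
    -- eliminated.
    have key : ∀ (f : (functor ((P ⊠₁ Q) ⊠₁ R)).obj x ⟶ (functor ((P ⊠₁ Q) ⊠₁ R)).obj x), f = 𝟙 _ →
      Equiv.prodAssoc _ _ _ ((((P ⊠₁ Q) ⊠₁ R).obj x).map f.op (elem x)) =
        (elem (P := P ⊠₁ (Q ⊠₁ R)) (x.1.1, x.1.2, x.2)) := by
      rintro _ rfl
      exact congrArg (Equiv.prodAssoc _ _ _) (map_id ((P ⊠₁ Q) ⊠₁ R) (elem x))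
    refine key _ ?_
    exact Category.comp_id (𝟙 ((functor ((P ⊠₁ Q) ⊠₁ R)).obj x)))

end App

end Rep

end Rep

end Prof

end ProfBicat

/-! ### Strict 2-cells: coherence cells with identity components -/

namespace ProfBicat

namespace Prof

open Bicategory

section Rep

variable {X Y Z W : Prof.{u}}

namespace Rep

/-- The component of `s` at `x` is `f`, up to equality of its source and target. -/
def HasApp {P Q : X ⟶ Y} [Rep P] [Rep Q] (s : P ⟶ Q) (x : X.carrier) {a b : Y.carrier}
    (f : a ⟶ b) : Prop :=
  ∃ (ha : (functor P).obj x = a) (hb : b = (functor Q).obj x),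
    app s x = eqToHom ha ≫ f ≫ eqToHom hb

/-- A 2-cell all of whose components are identities, up to equality of objects. -/
class Strict {P Q : X ⟶ Y} [Rep P] [Rep Q] (s : P ⟶ Q) : Prop where
  hasApp (x : X.carrier) : HasApp s x (𝟙 ((functor P).obj x))

namespace HasApp

theorem ofApp {P Q : X ⟶ Y} [Rep P] [Rep Q] {s : P ⟶ Q} {x : X.carrier}
    {f : (functor P).obj x ⟶ (functor Q).obj x} (h : app s x = f) : HasApp s x f :=
  ⟨rfl, rfl, by simp [h]⟩

theorem app_eq {P Q : X ⟶ Y} [Rep P] [Rep Q] {s : P ⟶ Q} {x : X.carrier}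
    {f : (functor P).obj x ⟶ (functor Q).obj x} (h : HasApp s x f) : app s x = f := by
  obtain ⟨_, _, h⟩ := h
  simpa using h

theorem comp {P Q R : X ⟶ Y} [Rep P] [Rep Q] [Rep R] {s : P ⟶ Q} {t : Q ⟶ R} {x : X.carrier}
    {a b c : Y.carrier} {f : a ⟶ b} {g : b ⟶ c} (hs : HasApp s x f) (ht : HasApp t x g) :
    HasApp (s ≫ t) x (f ≫ g) := by
  obtain ⟨rfl, rfl, hs⟩ := hs
  obtain ⟨hb, rfl, ht⟩ := ht
  refine ofApp ?_
  simp [app_comp, hs, ht]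

/-- A strict cell contributes only an `eqToHom`, which the existential endpoints in `HasApp` absorb,
so `f` itself is unchanged. This and its variants let an evaluation skip bookkeeping cells. -/
theorem comp_strict {P Q R : X ⟶ Y} [Rep P] [Rep Q] [Rep R] {s : P ⟶ Q} {x : X.carrier}
    {a b : Y.carrier} {f : a ⟶ b} (hs : HasApp s x f) (t : Q ⟶ R) [Strict t] :
    HasApp (s ≫ t) x f := by
  obtain ⟨_, hb, ht⟩ := Strict.hasApp (s := t) x
  obtain ⟨rfl, rfl, hs⟩ := hs
  exact ⟨rfl, hb, by simp [app_comp, hs, ht]⟩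

theorem strict_comp {P Q R : X ⟶ Y} [Rep P] [Rep Q] [Rep R] (s : P ⟶ Q) [Strict s] {t : Q ⟶ R}
    {x : X.carrier} {a b : Y.carrier} {f : a ⟶ b} (ht : HasApp t x f) :
    HasApp (s ≫ t) x f := by
  obtain ⟨_, hb, hs⟩ := Strict.hasApp (s := s) x
  obtain ⟨rfl, rfl, ht⟩ := ht
  exact ⟨hb, rfl, by simp [app_comp, hs, ht]⟩

/-- The coherence cell that `⊗≫` inserts is assumed strict, hence leaves no trace in the component.
-/
theorem bicategoricalComp {P Q Q' R : X ⟶ Y} [Rep P] [Rep Q] [Rep Q'] [Rep R]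
    [BicategoricalCoherence Q Q'] [Strict (BicategoricalCoherence.iso (f := Q) (g := Q')).hom]
    {s : P ⟶ Q} {t : Q' ⟶ R} {x : X.carrier} {a b c : Y.carrier} {f : a ⟶ b} {g : b ⟶ c}
    (hs : HasApp s x f) (ht : HasApp t x g) : HasApp (s ⊗≫ t) x (f ≫ g) :=
  hs.comp (strict_comp _ ht)

theorem bicategoricalComp_strict {P Q Q' R : X ⟶ Y} [Rep P] [Rep Q] [Rep Q'] [Rep R]
    [BicategoricalCoherence Q Q'] [Strict (BicategoricalCoherence.iso (f := Q) (g := Q')).hom]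
    {s : P ⟶ Q} {x : X.carrier} {a b : Y.carrier} {f : a ⟶ b} (hs : HasApp s x f) (t : Q' ⟶ R)
    [Strict t] : HasApp (s ⊗≫ t) x f :=
  (hs.comp_strict _).comp_strict t

theorem strict_bicategoricalComp {P Q Q' R : X ⟶ Y} [Rep P] [Rep Q] [Rep Q'] [Rep R]
    [BicategoricalCoherence Q Q'] [Strict (BicategoricalCoherence.iso (f := Q) (g := Q')).hom]
    (s : P ⟶ Q) [Strict s] {t : Q' ⟶ R} {x : X.carrier} {a b : Y.carrier} {f : a ⟶ b}
    (ht : HasApp t x f) : HasApp (s ⊗≫ t) x f :=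
  strict_comp s (strict_comp _ ht)

theorem whiskerLeft (P : X ⟶ Y) {Q R : Y ⟶ Z} [Rep P] [Rep Q] [Rep R] {t : Q ⟶ R} {x : X.carrier}
    {a b : Z.carrier} {f : a ⟶ b} (h : HasApp t ((functor P).obj x) f) : HasApp (P ◁ t) x f := by
  obtain ⟨rfl, rfl, h⟩ := h
  exact ofApp ((app_whiskerLeft P t x).trans (by simpa using h))

theorem whiskerRight {P Q : X ⟶ Y} (R : Y ⟶ Z) [Rep P] [Rep Q] [Rep R] {s : P ⟶ Q} {x : X.carrier}
    {a b : Y.carrier} {f : a ⟶ b} (h : HasApp s x f) :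
    HasApp (s ▷ R) x ((functor R).map f) := by
  obtain ⟨rfl, rfl, h⟩ := h
  exact ofApp ((app_whiskerRight R s x).trans (congrArg (functor R).map (by simpa using h)))

theorem tensorMap {X' Y' : Prof.{u}} {P Q : X ⟶ Y} {P' Q' : X' ⟶ Y'} [Rep P] [Rep Q] [Rep P']
    [Rep Q'] {s : P ⟶ Q} {t : P' ⟶ Q'} {x : X.carrier} {x' : X'.carrier} {a b : Y.carrier}
    {a' b' : Y'.carrier} {f : a ⟶ b} {g : a' ⟶ b'} (hs : HasApp s x f) (ht : HasApp t x' g) :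
    HasApp (s ⊠₂ t) (show (X ⊠ X').carrier from (x, x')) (Prod.mkHom f g) := by
  obtain ⟨rfl, rfl, hs⟩ := hs
  obtain ⟨rfl, rfl, ht⟩ := ht
  exact ofApp ((app_tensorMap s t (x, x')).trans
    (congrArg₂ Prod.mkHom (by simpa using hs) (by simpa using ht)))

end HasApp

namespace Strict

open HasApp

instance id (P : X ⟶ Y) [Rep P] : Strict (𝟙 P) := ⟨fun x => ofApp (app_id P x)⟩

instance comp {P Q R : X ⟶ Y} [Rep P] [Rep Q] [Rep R] (s : P ⟶ Q) (t : Q ⟶ R) [Strict s]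
    [Strict t] : Strict (s ≫ t) := ⟨fun x => (hasApp x).comp_strict t⟩

instance bicategoricalComp {P Q Q' R : X ⟶ Y} [Rep P] [Rep Q] [Rep Q'] [Rep R]
    [BicategoricalCoherence Q Q'] [Strict (BicategoricalCoherence.iso (f := Q) (g := Q')).hom]
    (s : P ⟶ Q) (t : Q' ⟶ R) [Strict s] [Strict t] : Strict (s ⊗≫ t) :=
  ⟨fun x => (hasApp x).bicategoricalComp_strict t⟩

instance whiskerLeft (P : X ⟶ Y) {Q R : Y ⟶ Z} [Rep P] [Rep Q] [Rep R] (t : Q ⟶ R) [Strict t] :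
    Strict (P ◁ t) := ⟨fun _ => (hasApp _).whiskerLeft P⟩

instance whiskerRight {P Q : X ⟶ Y} (R : Y ⟶ Z) [Rep P] [Rep Q] [Rep R] (s : P ⟶ Q) [Strict s] :
    Strict (s ▷ R) := ⟨fun x => by
  have := (hasApp (s := s) x).whiskerRight R
  rwa [CategoryTheory.Functor.map_id] at this⟩

instance tensorMap {X' Y' : Prof.{u}} {P Q : X ⟶ Y} {P' Q' : X' ⟶ Y'} [Rep P] [Rep Q] [Rep P']
    [Rep Q'] (s : P ⟶ Q) (t : P' ⟶ Q') [Strict s] [Strict t] : Strict (s ⊠₂ t) :=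
  ⟨fun x => (hasApp x.1).tensorMap (hasApp x.2)⟩

theorem inv {P Q : X ⟶ Y} [Rep P] [Rep Q] (s : P ≅ Q) [Strict s.hom] : Strict s.inv := ⟨fun x => by
  obtain ⟨_, hb, h⟩ := hasApp (s := s.hom) x
  exact ⟨rfl, hb.symm, app_inv s x _ _ h (by simp)⟩⟩

instance associator_hom (P : X ⟶ Y) (Q : Y ⟶ Z) (R : Z ⟶ W) [Rep P] [Rep Q] [Rep R] :
    Strict (α_ P Q R).hom := ⟨fun x => ofApp (app_associator_hom P Q R x)⟩
instance associator_inv (P : X ⟶ Y) (Q : Y ⟶ Z) (R : Z ⟶ W) [Rep P] [Rep Q] [Rep R] :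
    Strict (α_ P Q R).inv := inv _
instance leftUnitor_hom (P : X ⟶ Y) [Rep P] : Strict (λ_ P).hom :=
  ⟨fun x => ofApp (app_leftUnitor_hom P x)⟩
instance leftUnitor_inv (P : X ⟶ Y) [Rep P] : Strict (λ_ P).inv := inv _
instance rightUnitor_hom (P : X ⟶ Y) [Rep P] : Strict (ρ_ P).hom :=
  ⟨fun x => ofApp (app_rightUnitor_hom P x)⟩
instance rightUnitor_inv (P : X ⟶ Y) [Rep P] : Strict (ρ_ P).inv := inv _

instance iso_refl_hom (P : X ⟶ Y) [Rep P] : Strict (Iso.refl P).hom := id P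
instance iso_refl_inv (P : X ⟶ Y) [Rep P] : Strict (Iso.refl P).inv := id P
instance iso_symm_hom {P Q : X ⟶ Y} [Rep P] [Rep Q] (s : P ≅ Q) [h : Strict s.inv] :
    Strict s.symm.hom := h
instance iso_trans_hom {P Q R : X ⟶ Y} [Rep P] [Rep Q] [Rep R] (s : P ≅ Q) (t : Q ≅ R)
    [Strict s.hom] [Strict t.hom] : Strict (s ≪≫ t).hom := comp s.hom t.hom
instance iso_trans_inv {P Q R : X ⟶ Y} [Rep P] [Rep Q] [Rep R] (s : P ≅ Q) (t : Q ≅ R)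
    [Strict s.inv] [Strict t.inv] : Strict (s ≪≫ t).inv := comp t.inv s.inv
instance whiskerLeftIso_hom (P : X ⟶ Y) {Q R : Y ⟶ Z} [Rep P] [Rep Q] [Rep R] (t : Q ≅ R)
    [Strict t.hom] : Strict (whiskerLeftIso P t).hom := whiskerLeft P t.hom
instance whiskerRightIso_hom {P Q : X ⟶ Y} (R : Y ⟶ Z) [Rep P] [Rep Q] [Rep R] (s : P ≅ Q)
    [Strict s.hom] : Strict (whiskerRightIso s R).hom := whiskerRight R s.hom
instance tensorIso_hom {X' Y' : Prof.{u}} {P Q : X ⟶ Y} {P' Q' : X' ⟶ Y'} [Rep P] [Rep Q] [Rep P']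
    [Rep Q'] (s : P ≅ Q) (t : P' ≅ Q') [Strict s.hom] [Strict t.hom] :
    Strict (tensorIso s t).hom := tensorMap s.hom t.hom
instance tensorIso_inv {X' Y' : Prof.{u}} {P Q : X ⟶ Y} {P' Q' : X' ⟶ Y'} [Rep P] [Rep Q] [Rep P']
    [Rep Q'] (s : P ≅ Q) (t : P' ≅ Q') [Strict s.inv] [Strict t.inv] :
    Strict (tensorIso s t).inv := tensorMap s.inv t.inv

section Coherence

/-- This instance and the next ones follow the inductive construction of `BicategoricalCoherence`,
so that instance search proves strictness of the cells inserted by `⊗≫` along the way it built them.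
-/
instance coherence_refl (P : X ⟶ Y) [Rep P] :
    Strict (BicategoricalCoherence.refl P).iso.hom := id P
instance coherence_whiskerLeft (P : X ⟶ Y) (Q R : Y ⟶ Z) [Rep P] [Rep Q] [Rep R]
    [BicategoricalCoherence Q R] [Strict (BicategoricalCoherence.iso (f := Q) (g := R)).hom] :
    Strict (BicategoricalCoherence.whiskerLeft P Q R).iso.hom := whiskerLeftIso_hom P _
instance coherence_whiskerRight (P Q : X ⟶ Y) (R : Y ⟶ Z) [Rep P] [Rep Q] [Rep R]
    [BicategoricalCoherence P Q] [Strict (BicategoricalCoherence.iso (f := P) (g := Q)).hom] :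
    Strict (BicategoricalCoherence.whiskerRight P Q R).iso.hom := whiskerRightIso_hom R _
instance coherence_assoc (P : X ⟶ Y) (Q : Y ⟶ Z) (R : Z ⟶ W) (S : X ⟶ W) [Rep P] [Rep Q] [Rep R]
    [Rep S] [BicategoricalCoherence (P ≫ Q ≫ R) S]
    [Strict (BicategoricalCoherence.iso (f := P ≫ Q ≫ R) (g := S)).hom] :
    Strict (BicategoricalCoherence.assoc P Q R S).iso.hom := iso_trans_hom _ _
instance coherence_assoc' (P : X ⟶ Y) (Q : Y ⟶ Z) (R : Z ⟶ W) (S : X ⟶ W) [Rep P] [Rep Q] [Rep R]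
    [Rep S] [BicategoricalCoherence S (P ≫ Q ≫ R)]
    [Strict (BicategoricalCoherence.iso (f := S) (g := P ≫ Q ≫ R)).hom] :
    Strict (BicategoricalCoherence.assoc' P Q R S).iso.hom := iso_trans_hom _ _

end Coherence

instance tensorComp_hom {X' Y' Z' : Prof.{u}} (P : X ⟶ Y) (Q : Y ⟶ Z) (P' : X' ⟶ Y')
    (Q' : Y' ⟶ Z') [Rep P] [Rep Q] [Rep P'] [Rep Q'] : Strict (tensorComp P Q P' Q').hom :=
  ⟨fun x => ofApp (app_tensorComp_hom P Q P' Q' x)⟩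
instance tensorComp_inv {X' Y' Z' : Prof.{u}} (P : X ⟶ Y) (Q : Y ⟶ Z) (P' : X' ⟶ Y')
    (Q' : Y' ⟶ Z') [Rep P] [Rep Q] [Rep P'] [Rep Q'] : Strict (tensorComp P Q P' Q').inv := inv _
instance tensorId_hom (X Y : Prof.{u}) : Strict (tensorId X Y).hom :=
  ⟨fun x => ofApp (app_tensorId_hom X Y x)⟩
instance tensorId_inv (X Y : Prof.{u}) : Strict (tensorId X Y).inv := inv _
instance starStar_hom (F : X.carrier ⥤ Y.carrier) (G : Y.carrier ⥤ Z.carrier) :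
    Strict (starStar F G).hom := ⟨fun x => ofApp (app_starStar_hom F G x)⟩
instance starStar_inv (F : X.carrier ⥤ Y.carrier) (G : Y.carrier ⥤ Z.carrier) :
    Strict (starStar F G).inv := inv _
instance starTensor_hom {X' Y' : Prof.{u}} (F : X.carrier ⥤ Y.carrier)
    (G : X'.carrier ⥤ Y'.carrier) : Strict (starTensor F G).hom :=
  ⟨fun x => ofApp (app_starTensor_hom F G x)⟩
instance starTensor_inv {X' Y' : Prof.{u}} (F : X.carrier ⥤ Y.carrier)
    (G : X'.carrier ⥤ Y'.carrier) : Strict (starTensor F G).inv := inv _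
instance starTensorId_hom (F : X.carrier ⥤ Y.carrier) (Z : Prof.{u}) :
    Strict (starTensorId F Z).hom := starTensor_hom F _
instance starTensorId_inv (F : X.carrier ⥤ Y.carrier) (Z : Prof.{u}) :
    Strict (starTensorId F Z).inv := starTensor_inv F _
instance idTensorStar_hom (Z : Prof.{u}) (F : X.carrier ⥤ Y.carrier) :
    Strict (idTensorStar Z F).hom := starTensor_hom _ F
instance idTensorStar_inv (Z : Prof.{u}) (F : X.carrier ⥤ Y.carrier) :
    Strict (idTensorStar Z F).inv := starTensor_inv _ F
instance assocNat_hom {X' Y' Z' : Prof.{u}} (P : X ⟶ X') (Q : Y ⟶ Y') (R : Z ⟶ Z')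
    [Rep P] [Rep Q] [Rep R] : Strict (assocNat P Q R).hom :=
  ⟨fun x => ofApp (app_assocNat_hom P Q R x)⟩
instance tensorCompRight_hom (P : X ⟶ Y) (Q : Y ⟶ Z) (W : Prof.{u}) [Rep P] [Rep Q] :
    Strict (tensorCompRight P Q W).hom := iso_trans_hom _ _
instance tensorCompRight_inv (P : X ⟶ Y) (Q : Y ⟶ Z) (W : Prof.{u}) [Rep P] [Rep Q] :
    Strict (tensorCompRight P Q W).inv := iso_trans_inv _ _
instance tensorCompLeft_hom (W : Prof.{u}) (P : X ⟶ Y) (Q : Y ⟶ Z) [Rep P] [Rep Q] :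
    Strict (tensorCompLeft W P Q).hom := iso_trans_hom _ _
instance tensorCompLeft_inv (W : Prof.{u}) (P : X ⟶ Y) (Q : Y ⟶ Z) [Rep P] [Rep Q] :
    Strict (tensorCompLeft W P Q).inv := iso_trans_inv _ _
instance tensorSwap_hom (P : X ⟶ Y) (Q : Z ⟶ W) [Rep P] [Rep Q] : Strict (tensorSwap P Q).hom :=
  inferInstanceAs (Strict (_ ≪≫ _ ≪≫ _).hom)
instance pentagonCell_hom (X Y Z W : Prof.{u}) : Strict (pentagonCell X Y Z W).hom := by
  -- The two rebracketing functors coincide, so the identity isomorphism has identity components;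
  -- the other factors are strict by instance search.
  have : Strict (starIso (A := ((X ⊠ Y) ⊠ Z) ⊠ W) (B := X ⊠ (Y ⊠ (Z ⊠ W)))
      (F := prodFunctor (assocFunctor X Y Z) (𝟭 W.carrier) ⋙
        assocFunctor X (Y ⊠ Z) W ⋙ prodFunctor (𝟭 X.carrier) (assocFunctor Y Z W))
      (G := assocFunctor (X ⊠ Y) Z W ⋙ assocFunctor X Y (Z ⊠ W)) (Iso.refl _)).hom :=
    ⟨fun x => ofApp (app_starIso_hom _ x)⟩
  unfold pentagonCell
  infer_instance
instance triangleCell_hom (X Y : Prof.{u}) : Strict (triangleCell X Y).hom := by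
  have : Strict (starIso (A := (X ⊠ tensorUnit) ⊠ Y) (B := X ⊠ Y)
      (F := assocFunctor X tensorUnit Y ⋙ prodFunctor (𝟭 X.carrier) (leftUnitFunctor Y))
      (G := prodFunctor (rightUnitFunctor X) (𝟭 Y.carrier)) (Iso.refl _)).hom :=
    ⟨fun x => ofApp (app_starIso_hom _ x)⟩
  unfold triangleCell
  infer_instance

end Strict

end Rep

end Rep

end Prof

end ProfBicat

/-! ### The pseudomonoid axioms evaluated on objects -/

namespace ProfBicat

open Bicategory Prof

namespace Prof.Rep

/-- The components of an invertible 2-cell are invertible. -/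
noncomputable def appIso {X Y : Prof.{u}} {P Q : X ⟶ Y} [Rep P] [Rep Q] (s : P ≅ Q)
    (x : X.carrier) : (functor P).obj x ≅ (functor Q).obj x where
  hom := app s.hom x
  inv := app s.inv x
  hom_inv_id := by rw [← app_comp, s.hom_inv_id, app_id]
  inv_hom_id := by rw [← app_comp, s.inv_hom_id, app_id]

end Prof.Rep

namespace PseudomonoidData

variable {A : Prof.{u}} (M : PseudomonoidData A)

open Prof.Rep HasApp

/-- The object of `A` representing the unit. -/
def unitObj [Rep M.one] : A.carrier := (Rep.functor M.one).obj ⟨PUnit.unit⟩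

/-- The terminal category has only identities, so the functor representing the unit carries no
information beyond its object. -/
theorem unit_map [Rep M.one] {p q : tensorUnit.{u}.carrier} (f : p ⟶ q) :
    (functor M.one).map f = 𝟙 M.unitObj := by
  obtain ⟨⟨⟩⟩ := p
  obtain ⟨⟨⟩⟩ := q
  exact (functor M.one).map_id _

variable [Rep M.mul]

/-- The product of two objects, for a representable multiplication. -/
def mulObj (a b : A.carrier) : A.carrier := (functor M.mul).obj (a, b)

/-- The product of two morphisms. -/
def mulMap {a a' b b' : A.carrier} (f : a ⟶ a') (g : b ⟶ b') : M.mulObj a b ⟶ M.mulObj a' b' :=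
  (functor M.mul).map (X := (a, b)) (Y := (a', b')) (Prod.mkHom f g)

theorem mulMap_id (a b : A.carrier) : M.mulMap (𝟙 a) (𝟙 b) = 𝟙 _ :=
  (functor M.mul).map_id (a, b)

theorem mulMap_comp {a a' a'' b b' b'' : A.carrier} (f : a ⟶ a') (f' : a' ⟶ a'') (g : b ⟶ b')
    (g' : b' ⟶ b'') : M.mulMap (f ≫ f') (g ≫ g') = M.mulMap f g ≫ M.mulMap f' g' :=
  (functor M.mul).map_comp (X := (a, b)) (Y := (a', b')) (Z := (a'', b'')) (Prod.mkHom f g)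
    (Prod.mkHom f' g')

/-- The associator on objects. -/
noncomputable def assocIso (a b c : A.carrier) :
    M.mulObj (M.mulObj a b) c ≅ M.mulObj a (M.mulObj b c) :=
  appIso M.assoc ((a, b), c)

theorem assocIso_naturality {a a' b b' c c' : A.carrier} (f : a ⟶ a') (g : b ⟶ b') (h : c ⟶ c') :
    M.mulMap (M.mulMap f g) h ≫ (M.assocIso a' b' c').hom =
      (M.assocIso a b c).hom ≫ M.mulMap f (M.mulMap g h) :=
  app_naturality M.assoc.hom (x := ((a, b), c)) (x' := ((a', b'), c'))
    (Prod.mkHom (Prod.mkHom f g) h)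

theorem hasApp_assoc (a b c : A.carrier) :
    HasApp M.assoc.hom (show ((A ⊠ A) ⊠ A).carrier from ((a, b), c)) (M.assocIso a b c).hom :=
  ofApp rfl

-- Of all the factors of the pasting only the three containing the associator are not strict, and
-- they give the three arrows on the right. Each `strict_bicategoricalComp` discards one bookkeeping
-- factor; the final `bicategoricalComp_strict` discards the whole remaining tail, whose strictness
-- is one large instance search.
set_option synthInstance.maxSize 1000 in
theorem app_pentagonLong (a b c d : A.carrier) :
    Rep.app M.pentagonLong (((a, b), c), d) =
      M.mulMap (M.assocIso a b c).hom (𝟙 d) ≫ (M.assocIso a (M.mulObj b c) d).hom ≫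
        M.mulMap (𝟙 a) (M.assocIso b c d).hom := by
  refine HasApp.app_eq ?_
  unfold pentagonLong
  refine strict_bicategoricalComp _ <| strict_bicategoricalComp _ <|
    HasApp.bicategoricalComp (((M.hasApp_assoc a b c).tensorMap (Strict.hasApp d)).whiskerRight _) <|
    strict_bicategoricalComp _ <| strict_bicategoricalComp _ <|
    HasApp.bicategoricalComp
      (((M.hasApp_assoc a (M.mulObj b c) d).whiskerLeft _).whiskerLeft _) <|
    strict_bicategoricalComp _ <| strict_bicategoricalComp _ <|
    bicategoricalComp_strict (HasApp.whiskerLeft _ (HasApp.whiskerLeft _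
      (((Strict.hasApp a).tensorMap (M.hasApp_assoc b c d)).whiskerRight M.mul))) _

theorem app_pentagonShort (a b c d : A.carrier) :
    Rep.app M.pentagonShort (((a, b), c), d) =
      (M.assocIso (M.mulObj a b) c d).hom ≫ (M.assocIso a b (M.mulObj c d)).hom := by
  refine HasApp.app_eq ?_
  unfold pentagonShort
  refine HasApp.bicategoricalComp ((M.hasApp_assoc (M.mulObj a b) c d).whiskerLeft _) <|
    strict_bicategoricalComp _ <| strict_bicategoricalComp _ <| strict_bicategoricalComp _ <|
    bicategoricalComp_strict
      (((M.hasApp_assoc a b (M.mulObj c d)).whiskerLeft _).whiskerLeft _) _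

/-- Source and target are represented, so by `ext_app` the equation of 2-cells may be tested on
components. -/
theorem pentagon_iff : M.pentagonLong = M.pentagonShort ↔ ∀ a b c d : A.carrier,
      M.mulMap (M.assocIso a b c).hom (𝟙 d) ≫ (M.assocIso a (M.mulObj b c) d).hom ≫
        M.mulMap (𝟙 a) (M.assocIso b c d).hom =
      (M.assocIso (M.mulObj a b) c d).hom ≫ (M.assocIso a b (M.mulObj c d)).hom :=
  ⟨fun h a b c d => (M.app_pentagonLong a b c d).symm.trans
      ((congrArg (Rep.app · _) h).trans (M.app_pentagonShort a b c d)),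
    fun h => ext_app fun _ => (M.app_pentagonLong _ _ _ _).trans
      ((h _ _ _ _).trans (M.app_pentagonShort _ _ _ _).symm)⟩

variable [Rep M.one]

/-- The left unitor on objects. -/
noncomputable def leftUnitIso (a : A.carrier) : M.mulObj M.unitObj a ≅ a :=
  appIso M.leftUnit (⟨PUnit.unit⟩, a)

/-- The right unitor on objects. -/
noncomputable def rightUnitIso (a : A.carrier) : M.mulObj a M.unitObj ≅ a :=
  appIso M.rightUnit (a, ⟨PUnit.unit⟩)

theorem leftUnitIso_naturality {a a' : A.carrier} (f : a ⟶ a') :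
    M.mulMap (𝟙 M.unitObj) f ≫ (M.leftUnitIso a').hom = (M.leftUnitIso a).hom ≫ f := by
  refine Eq.trans ?_ (app_naturality M.leftUnit.hom (x := (⟨PUnit.unit⟩, a))
    (x' := (⟨PUnit.unit⟩, a')) (Prod.mkHom (𝟙 _) f))
  exact congrArg (fun k => M.mulMap k f ≫ (M.leftUnitIso a').hom) (M.unit_map _).symm

theorem rightUnitIso_naturality {a a' : A.carrier} (f : a ⟶ a') :
    M.mulMap f (𝟙 M.unitObj) ≫ (M.rightUnitIso a').hom = (M.rightUnitIso a).hom ≫ f := by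
  refine Eq.trans ?_ (app_naturality M.rightUnit.hom (x := (a, ⟨PUnit.unit⟩))
    (x' := (a', ⟨PUnit.unit⟩)) (Prod.mkHom f (𝟙 _)))
  exact congrArg (fun k => M.mulMap f k ≫ (M.rightUnitIso a').hom) (M.unit_map _).symm

theorem hasApp_leftUnit (a : A.carrier) :
    HasApp M.leftUnit.hom (show (tensorUnit ⊠ A).carrier from (⟨PUnit.unit⟩, a))
      (M.leftUnitIso a).hom :=
  ofApp rfl

theorem hasApp_rightUnit (a : A.carrier) :
    HasApp M.rightUnit.hom (show (A ⊠ tensorUnit).carrier from (a, ⟨PUnit.unit⟩))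
      (M.rightUnitIso a).hom :=
  ofApp rfl

theorem app_triangleLong (a b : A.carrier) :
    Rep.app M.triangleLong ((a, ⟨PUnit.unit⟩), b) =
      (M.assocIso a M.unitObj b).hom ≫ M.mulMap (𝟙 a) (M.leftUnitIso b).hom := by
  refine HasApp.app_eq ?_
  unfold triangleLong
  refine HasApp.bicategoricalComp ((M.hasApp_assoc a M.unitObj b).whiskerLeft _) <|
    strict_bicategoricalComp _ <| strict_bicategoricalComp _ <|
    bicategoricalComp_strict (HasApp.whiskerLeft _ (HasApp.whiskerRight M.mul
      ((Strict.hasApp a).tensorMap (M.hasApp_leftUnit b)))) _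

theorem app_triangleShort (a b : A.carrier) :
    Rep.app M.triangleShort ((a, ⟨PUnit.unit⟩), b) = M.mulMap (M.rightUnitIso a).hom (𝟙 b) := by
  refine HasApp.app_eq ?_
  unfold triangleShort
  refine strict_bicategoricalComp _ <| strict_bicategoricalComp _ <|
    bicategoricalComp_strict (HasApp.whiskerRight M.mul
      ((M.hasApp_rightUnit a).tensorMap (Strict.hasApp b))) _

theorem triangle_iff : M.triangleLong = M.triangleShort ↔ ∀ a b : A.carrier,
      (M.assocIso a M.unitObj b).hom ≫ M.mulMap (𝟙 a) (M.leftUnitIso b).hom =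
        M.mulMap (M.rightUnitIso a).hom (𝟙 b) :=
  ⟨fun h a b => (M.app_triangleLong a b).symm.trans
      ((congrArg (Rep.app · _) h).trans (M.app_triangleShort a b)),
    fun h => ext_app fun _ => (M.app_triangleLong _ _).trans
      ((h _ _).trans (M.app_triangleShort _ _).symm)⟩

end PseudomonoidData

end ProfBicat

/-! ### Isomorphisms of represented pseudomonoids, and the monoidal case -/

namespace ProfBicat

open Bicategory Prof

namespace Prof.Rep

variable {X Y Z : Prof.{u}}

/-- A 1-cell represented by `F` is isomorphic to `F_*`. -/
noncomputable def isoStar (P : X ⟶ Y) [Rep P] : Prof.star (functor P) ≅ P :=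
  cellMk (fun x y => Equiv.ofBijective _ (bijective (P := P) x y.unop))
    (fun _ _ _ g f => (map_map P g.unop f _).symm)
    (fun {x x'} h y f => by
      refine (map_map P f ((functor P).map h) _).symm.trans ?_
      refine (congrArg ((P.obj x').map f.op) (map_elem h).symm).trans ?_
      exact (NatTrans.naturality_apply (P.map h) f.op (elem x)).symm)

instance (P : X ⟶ Y) [Rep P] : Strict (isoStar P).hom := ⟨fun _ => HasApp.ofApp (app_eq _ _ _ rfl)⟩
instance (P : X ⟶ Y) [Rep P] : Strict (isoStar P).inv := Strict.inv _

/-- The invertible 2-cell with given components. -/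
noncomputable def isoOfNatIso {P Q : X ⟶ Y} [Rep P] [Rep Q] (t : functor P ≅ functor Q) : P ≅ Q :=
  (isoStar P).symm ≪≫ starIso t ≪≫ isoStar Q

theorem app_isoOfNatIso {P Q : X ⟶ Y} [Rep P] [Rep Q] (t : functor P ≅ functor Q) (x : X.carrier) :
    app (isoOfNatIso t).hom x = t.hom.app x :=
  HasApp.app_eq (HasApp.strict_comp (isoStar P).inv
    (HasApp.comp_strict (HasApp.ofApp (app_starIso_hom t x)) (isoStar Q).hom))

/-- A representation transported along an isomorphism with `F_*`. -/
@[reducible]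
noncomputable def ofIso {P : X ⟶ Y} {F : X.carrier ⥤ Y.carrier} (e : P ≅ Prof.star F) : Rep P where
  functor := F
  elem x := (e.inv.app x).app _ (𝟙 (F.obj x))
  map_elem {x x'} f := by
    refine (types_congr_hom (NatTrans.congr_app (e.inv.naturality f) _) (𝟙 (F.obj x))).symm.trans ?_
    refine Eq.trans ?_ (NatTrans.naturality_apply (e.inv.app x') (F.map f).op (𝟙 (F.obj x')))
    exact congrArg ((e.inv.app x').app _) (map_elem (P := Prof.star F) f)
  bijective x y := by
    -- By naturality, restricting the preimage of the identity along `f` is applying `e.inv` to `f`,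
    -- and `e.inv` is bijective in each component.
    have h : (fun f : y ⟶ F.obj x => (P.obj x).map f.op ((e.inv.app x).app _ (𝟙 (F.obj x)))) =
        fun f : y ⟶ F.obj x => (e.inv.app x).app (op y) f := funext fun f =>
      (NatTrans.naturality_apply (e.inv.app x) f.op (𝟙 (F.obj x))).symm.trans
        (congrArg ((e.inv.app x).app (op y)) (Category.comp_id f))
    rw [h]
    exact ((e.symm.app x).app (op y)).toEquiv.bijective

/-- The Godement formula. The equation `hb` lets the intermediate object be given in whatever form
the caller has it. -/
theorem hasApp_hcomp {P P' : X ⟶ Y} {Q Q' : Y ⟶ Z} [Rep P] [Rep P'] [Rep Q] [Rep Q'] {s : P ⟶ P'}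
    {t : Q ⟶ Q'} {x : X.carrier} {a b : Y.carrier} {f : a ⟶ b} (hs : HasApp s x f)
    (hb : b = (functor P').obj x) :
    HasApp (hcomp s t) x ((functor Q).map f ≫ app t b) := by
  subst hb
  exact (hs.whiskerRight Q).comp (HasApp.whiskerLeft P' (HasApp.ofApp rfl))

end Prof.Rep

namespace PseudomonoidData

open Prof.Rep

section

variable {A : Prof.{u}} {M N : PseudomonoidData A} [Rep M.one] [Rep N.one]

/-- The component of an isomorphism of units. -/
noncomputable def oneCompIso (o : M.one ≅ N.one) : M.unitObj ≅ N.unitObj :=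
  appIso o ⟨PUnit.unit⟩

theorem hasApp_one (o : M.one ≅ N.one) :
    HasApp o.hom (show tensorUnit.{u}.carrier from ⟨PUnit.unit⟩) (oneCompIso o).hom :=
  HasApp.ofApp rfl

end

section Iso

variable {A : Prof.{u}} {M N : PseudomonoidData A} [Rep M.mul] [Rep N.mul]

/-- The components of an isomorphism of multiplications. -/
noncomputable def mulCompIso (m : M.mul ≅ N.mul) (a b : A.carrier) : M.mulObj a b ≅ N.mulObj a b :=
  appIso m (a, b)

theorem mulCompIso_naturality (m : M.mul ≅ N.mul) {a a' b b' : A.carrier} (f : a ⟶ a')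
    (g : b ⟶ b') :
    M.mulMap f g ≫ (mulCompIso m a' b').hom = (mulCompIso m a b).hom ≫ N.mulMap f g :=
  app_naturality m.hom (x := (a, b)) (x' := (a', b')) (Prod.mkHom f g)

theorem hasApp_mul (m : M.mul ≅ N.mul) (a b : A.carrier) :
    HasApp m.hom (show (A ⊠ A).carrier from (a, b)) (mulCompIso m a b).hom :=
  HasApp.ofApp rfl

/-- Translates compatibility with the associators into the hexagon of a monoidal functor carried by
the identity; the two unit versions below do the same for the unitors. -/
theorem assoc_comm_iff (m : M.mul ≅ N.mul) :
    M.assoc.hom ≫ Prof.assoc A A A ◁ hcomp (𝟙 (𝟙 A) ⊠₂ m.hom) m.hom =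
      hcomp (m.hom ⊠₂ 𝟙 (𝟙 A)) m.hom ≫ N.assoc.hom ↔ ∀ a b c : A.carrier,
      (M.assocIso a b c).hom ≫ M.mulMap (𝟙 a) (mulCompIso m b c).hom ≫
          (mulCompIso m a (N.mulObj b c)).hom =
        (M.mulMap (mulCompIso m a b).hom (𝟙 c) ≫ (mulCompIso m (N.mulObj a b) c).hom) ≫
          (N.assocIso a b c).hom := by
  have h₁ (a b c : A.carrier) : Rep.app (M.assoc.hom ≫ Prof.assoc A A A ◁
      hcomp (𝟙 (𝟙 A) ⊠₂ m.hom) m.hom) ((a, b), c) = (M.assocIso a b c).hom ≫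
        M.mulMap (𝟙 a) (mulCompIso m b c).hom ≫ (mulCompIso m a (N.mulObj b c)).hom :=
    HasApp.app_eq ((M.hasApp_assoc a b c).comp (HasApp.whiskerLeft _
      (hasApp_hcomp ((Strict.hasApp a).tensorMap (hasApp_mul m b c)) rfl)))
  have h₂ (a b c : A.carrier) : Rep.app (hcomp (m.hom ⊠₂ 𝟙 (𝟙 A)) m.hom ≫ N.assoc.hom)
      ((a, b), c) = (M.mulMap (mulCompIso m a b).hom (𝟙 c) ≫
        (mulCompIso m (N.mulObj a b) c).hom) ≫ (N.assocIso a b c).hom :=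
    HasApp.app_eq ((hasApp_hcomp ((hasApp_mul m a b).tensorMap (Strict.hasApp c)) rfl).comp
      (N.hasApp_assoc a b c))
  exact ⟨fun h a b c => (h₁ a b c).symm.trans ((congrArg (Rep.app · _) h).trans (h₂ a b c)),
    fun h => ext_app fun _ => (h₁ _ _ _).trans ((h _ _ _).trans (h₂ _ _ _).symm)⟩

variable [Rep M.one] [Rep N.one]

theorem leftUnit_comm_iff (m : M.mul ≅ N.mul) (o : M.one ≅ N.one) :
    M.leftUnit.hom = hcomp (o.hom ⊠₂ 𝟙 (𝟙 A)) m.hom ≫ N.leftUnit.hom ↔ ∀ a : A.carrier,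
      (M.leftUnitIso a).hom = (M.mulMap (oneCompIso o).hom (𝟙 a) ≫
        (mulCompIso m N.unitObj a).hom) ≫ (N.leftUnitIso a).hom := by
  have h₂ (a : A.carrier) : Rep.app (hcomp (o.hom ⊠₂ 𝟙 (𝟙 A)) m.hom ≫ N.leftUnit.hom)
      (⟨PUnit.unit⟩, a) = (M.mulMap (oneCompIso o).hom (𝟙 a) ≫
        (mulCompIso m N.unitObj a).hom) ≫ (N.leftUnitIso a).hom :=
    HasApp.app_eq ((hasApp_hcomp ((hasApp_one o).tensorMap (Strict.hasApp a)) rfl).comp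
      (N.hasApp_leftUnit a))
  exact ⟨fun h a => (congrArg (Rep.app · _) h).trans (h₂ a),
    fun h => ext_app fun ⟨⟨⟨⟩⟩, _⟩ => (h _).trans (h₂ _).symm⟩

theorem rightUnit_comm_iff (m : M.mul ≅ N.mul) (o : M.one ≅ N.one) :
    M.rightUnit.hom = hcomp (𝟙 (𝟙 A) ⊠₂ o.hom) m.hom ≫ N.rightUnit.hom ↔ ∀ a : A.carrier,
      (M.rightUnitIso a).hom = (M.mulMap (𝟙 a) (oneCompIso o).hom ≫
        (mulCompIso m a N.unitObj).hom) ≫ (N.rightUnitIso a).hom := by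
  have h₂ (a : A.carrier) : Rep.app (hcomp (𝟙 (𝟙 A) ⊠₂ o.hom) m.hom ≫ N.rightUnit.hom)
      (a, ⟨PUnit.unit⟩) = (M.mulMap (𝟙 a) (oneCompIso o).hom ≫
        (mulCompIso m a N.unitObj).hom) ≫ (N.rightUnitIso a).hom :=
    HasApp.app_eq ((hasApp_hcomp ((Strict.hasApp a).tensorMap (hasApp_one o)) rfl).comp
      (N.hasApp_rightUnit a))
  exact ⟨fun h a => (congrArg (Rep.app · _) h).trans (h₂ a),
    fun h => ext_app fun ⟨_, ⟨⟨⟩⟩⟩ => (h _).trans (h₂ _).symm⟩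

end Iso

section Monoidal

open MonoidalCategory

variable (A : Prof.{u}) [MonoidalCategory A.carrier]

instance : Rep (ofMonoidal A).mul := Rep.star (tensorFunctor A)
instance : Rep (ofMonoidal A).one := Rep.star (unitFunctor A)

-- In the definition of `ofMonoidal` the only factor that is not strict is `starIso (assocNatIso
-- A)`.
set_option synthInstance.maxSize 1000 in
theorem ofMonoidal_assocIso (a b c : A.carrier) :
    ((ofMonoidal A).assocIso a b c).hom = (α_ a b c).hom := by
  have h : HasApp (starIso (assocNatIso A)).hom _ (α_ a b c).hom :=
    HasApp.ofApp (app_starIso_hom (assocNatIso A) ((a, b), c))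
  exact HasApp.app_eq (HasApp.strict_comp
    (whiskerRightIso (starTensorId (tensorFunctor A) A) (Prof.star (tensorFunctor A))).hom
    (HasApp.strict_comp (starStar (prodFunctor (tensorFunctor A) (𝟭 A.carrier))
      (tensorFunctor A)).hom (HasApp.comp_strict h ((starStar (assocFunctor A A A)
        (prodFunctor (𝟭 A.carrier) (tensorFunctor A) ⋙ tensorFunctor A)).symm ≪≫
      whiskerLeftIso (Prof.assoc A A A) ((starStar (prodFunctor (𝟭 A.carrier) (tensorFunctor A))
        (tensorFunctor A)).symm ≪≫ whiskerRightIso (idTensorStar A (tensorFunctor A)).symm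
        (Prof.star (tensorFunctor A)))).hom)))

theorem ofMonoidal_leftUnitIso (a : A.carrier) :
    ((ofMonoidal A).leftUnitIso a).hom = (λ_ a).hom :=
  HasApp.app_eq (HasApp.strict_comp
    (whiskerRightIso (starTensorId (unitFunctor A) A) (Prof.star (tensorFunctor A))).hom
    (HasApp.strict_comp (starStar _ _).hom
      (HasApp.ofApp (app_starIso_hom (leftUnitNatIso A) (⟨PUnit.unit⟩, a)))))

theorem ofMonoidal_rightUnitIso (a : A.carrier) :
    ((ofMonoidal A).rightUnitIso a).hom = (ρ_ a).hom :=
  HasApp.app_eq (HasApp.strict_comp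
    (whiskerRightIso (idTensorStar A (unitFunctor A)) (Prof.star (tensorFunctor A))).hom
    (HasApp.strict_comp (starStar _ _).hom
      (HasApp.ofApp (app_starIso_hom (rightUnitNatIso A) (a, ⟨PUnit.unit⟩)))))

theorem ofMonoidal_isPseudomonoid : (ofMonoidal A).IsPseudomonoid where
  pentagon := (pentagon_iff _).2 fun a b c d => by
    simp only [ofMonoidal_assocIso]
    -- Mathlib's pentagon is written with whiskerings, while `mulMap` is the tensor product of two
    -- morphisms.
    have h := MonoidalCategory.pentagon a b c d
    simp only [← tensorHom_id, ← id_tensorHom] at h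
    exact h
  triangle := (triangle_iff _).2 fun a b => by
    simp only [ofMonoidal_assocIso, ofMonoidal_leftUnitIso, ofMonoidal_rightUnitIso]
    have h := MonoidalCategory.triangle a b
    simp only [← tensorHom_id, ← id_tensorHom] at h
    exact h

end Monoidal

end PseudomonoidData

end ProfBicat

/-! ### Values of forms, and invariance as a family of bijections -/

namespace ProfBicat

open Bicategory Prof

namespace Prof.Rep

variable {X Y Z : Prof.{u}}

/-- The analogue of `app_whiskerRight` when the second factor `R`, typically a form, is not
represented. -/
theorem whiskerRight_eval {P Q : X ⟶ Y} [Rep P] [Rep Q] (s : P ⟶ Q) (R : Y ⟶ Z) (x : X.carrier)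
    (z : Z.carrierᵒᵖ) (r : (R.obj ((functor P).obj x)).obj z) :
    ((s ▷ R).app x).app z (eval P R x z r) = eval Q R x z ((R.map (app s x)).app z r) :=
  (congrArg (CoendComp.mk (P := Q) (Q := R) _ · r) (app_spec s x)).trans (mk_eq Q R _ r)

theorem map_eval (P : X ⟶ Y) [Rep P] (R : Y ⟶ Z) {x x' : X.carrier} (f : x ⟶ x')
    (z : Z.carrierᵒᵖ) (r : (R.obj ((functor P).obj x)).obj z) :
    ((P ≫ R).map f).app z (eval P R x z r) =
      eval P R x' z ((R.map ((functor P).map f)).app z r) :=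
  (congrArg (CoendComp.mk (P := P) (Q := R) _ · r) (map_elem f)).trans (mk_eq P R _ r)

end Prof.Rep

namespace Prof

variable {A B : Prof.{u}} (σ : A ⊠ B ⟶ tensorUnit)

/-- The values of a form. -/
def Form (a : A.carrier) (b : B.carrier) : Type u := (σ.obj (a, b)).obj (op ⟨PUnit.unit⟩)

/-- The action of morphisms on the values of a form. -/
def formMap {a a' : A.carrier} {b b' : B.carrier} (f : a ⟶ a') (g : b ⟶ b') (q : Form σ a b) : Form σ a' b' :=
  (σ.map (X := (a, b)) (Y := (a', b')) (Prod.mkHom f g)).app _ q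

theorem formMap_id (a : A.carrier) (b : B.carrier) (q : Form σ a b) : formMap σ (𝟙 a) (𝟙 b) q = q :=
  types_congr_hom (NatTrans.congr_app (σ.map_id (a, b)) _) q

theorem formMap_comp {a a' a'' : A.carrier} {b b' b'' : B.carrier} (f : a ⟶ a') (f' : a' ⟶ a'') (g : b ⟶ b')
    (g' : b' ⟶ b'') (q : Form σ a b) :
    formMap σ (f ≫ f') (g ≫ g') q = formMap σ f' g' (formMap σ f g q) :=
  types_congr_hom (NatTrans.congr_app
    (σ.map_comp (X := (a, b)) (Y := (a', b')) (Z := (a'', b'')) (Prod.mkHom f g)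
      (Prod.mkHom f' g')) _) q

variable {σ} {τ : A ⊠ B ⟶ tensorUnit}

/-- The components of an isomorphism of forms. -/
def formEquiv (e : σ ≅ τ) (a : A.carrier) (b : B.carrier) : Form σ a b ≃ Form τ a b :=
  ((e.app (a, b)).app (op ⟨PUnit.unit⟩)).toEquiv

theorem formEquiv_formMap (e : σ ≅ τ) {a a' : A.carrier} {b b' : B.carrier} (f : a ⟶ a') (g : b ⟶ b')
    (q : Form σ a b) : formEquiv e a' b' (formMap σ f g q) = formMap τ f g (formEquiv e a b q) :=
  types_congr_hom (NatTrans.congr_app (e.hom.naturality (X := (a, b)) (Y := (a', b'))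
    (Prod.mkHom f g)) _) q

end Prof

namespace FrobeniusData

open Prof.Rep

variable {A : Prof.{u}}

section Invar

variable (P : FrobeniusData A) [Rep P.mul]

/-- The elements of `σ ∘ (μ × 1)`. -/
noncomputable def evalLeft (a b c : A.carrier) : Form P.form (P.mulObj a b) c ≃
    (((P.mul ⊠₁ 𝟙 A) ≫ P.form).obj ((a, b), c)).obj (op ⟨PUnit.unit⟩) :=
  Equiv.ofBijective _ (eval_bijective (P.mul ⊠₁ 𝟙 A) P.form ((a, b), c) (op ⟨PUnit.unit⟩))

/-- The elements of `σ ∘ (1 × μ)`. -/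
noncomputable def evalRight (a b c : A.carrier) : Form P.form a (P.mulObj b c) ≃
    ((Prof.assoc A A A ≫ (𝟙 A ⊠₁ P.mul) ≫ P.form).obj ((a, b), c)).obj (op ⟨PUnit.unit⟩) :=
  (Equiv.ofBijective _ (eval_bijective (𝟙 A ⊠₁ P.mul) P.form (a, (b, c)) (op ⟨PUnit.unit⟩))).trans
    (Equiv.ofBijective _ (eval_bijective (Prof.assoc A A A) ((𝟙 A ⊠₁ P.mul) ≫ P.form) ((a, b), c)
      (op ⟨PUnit.unit⟩)))

/-- The bijections `σ(ab, c) ≃ σ(a, bc)`. -/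
noncomputable def invar (a b c : A.carrier) :
    Form P.form (P.mulObj a b) c ≃ Form P.form a (P.mulObj b c) :=
  (P.evalLeft a b c).trans ((((P.invariance.app ((a, b), c)).app (op ⟨PUnit.unit⟩)).toEquiv).trans
    (P.evalRight a b c).symm)

theorem evalRight_invar {a b c : A.carrier} (q : Form P.form (P.mulObj a b) c) :
    P.evalRight a b c (P.invar a b c q) =
      (P.invariance.hom.app ((a, b), c)).app (op ⟨PUnit.unit⟩) (P.evalLeft a b c q) :=
  (P.evalRight a b c).apply_symm_apply _

theorem invar_eq {a b c : A.carrier} (q : Form P.form (P.mulObj a b) c)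
    (r : Form P.form a (P.mulObj b c))
    (h : (P.invariance.hom.app ((a, b), c)).app (op ⟨PUnit.unit⟩) (P.evalLeft a b c q) =
      P.evalRight a b c r) : P.invar a b c q = r :=
  (P.evalRight a b c).injective ((P.evalRight_invar q).trans h)

theorem evalLeft_map {a a' b b' c c' : A.carrier} (f : a ⟶ a') (g : b ⟶ b') (h : c ⟶ c')
    (q : Form P.form (P.mulObj a b) c) :
    (((P.mul ⊠₁ 𝟙 A) ≫ P.form).map (X := ((a, b), c)) (Y := ((a', b'), c'))
      (Prod.mkHom (Prod.mkHom f g) h)).app (op ⟨PUnit.unit⟩) (P.evalLeft a b c q) =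
      P.evalLeft a' b' c' (formMap P.form (P.mulMap f g) h q) :=
  map_eval (P.mul ⊠₁ 𝟙 A) P.form (x := ((a, b), c)) (x' := ((a', b'), c'))
    (Prod.mkHom (Prod.mkHom f g) h) _ q

theorem evalRight_map {a a' b b' c c' : A.carrier} (f : a ⟶ a') (g : b ⟶ b') (h : c ⟶ c')
    (q : Form P.form a (P.mulObj b c)) :
    ((Prof.assoc A A A ≫ (𝟙 A ⊠₁ P.mul) ≫ P.form).map (X := ((a, b), c)) (Y := ((a', b'), c'))
      (Prod.mkHom (Prod.mkHom f g) h)).app (op ⟨PUnit.unit⟩) (P.evalRight a b c q) =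
      P.evalRight a' b' c' (formMap P.form f (P.mulMap g h) q) :=
  (map_eval (Prof.assoc A A A) ((𝟙 A ⊠₁ P.mul) ≫ P.form) (x := ((a, b), c)) (x' := ((a', b'), c'))
    (Prod.mkHom (Prod.mkHom f g) h) _ _).trans (congrArg (eval _ _ _ _)
      (map_eval (𝟙 A ⊠₁ P.mul) P.form (x := (a, (b, c))) (x' := (a', (b', c')))
        (Prod.mkHom f (Prod.mkHom g h)) _ q))

/-- Naturality of the invariance 2-cell, transported through the two co-Yoneda bijections `evalLeft`
and `evalRight`. -/
theorem invar_naturality {a a' b b' c c' : A.carrier} (f : a ⟶ a') (g : b ⟶ b') (h : c ⟶ c')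
    (q : Form P.form (P.mulObj a b) c) :
    P.invar a' b' c' (formMap P.form (P.mulMap f g) h q) =
      formMap P.form f (P.mulMap g h) (P.invar a b c q) := by
  refine P.invar_eq _ _ ?_
  rw [← evalLeft_map, ← evalRight_map, evalRight_invar]
  exact types_congr_hom (NatTrans.congr_app (P.invariance.hom.naturality (X := ((a, b), c))
    (Y := ((a', b'), c')) (Prod.mkHom (Prod.mkHom f g) h)) (op ⟨PUnit.unit⟩)) _

end Invar

section Iso

open PseudomonoidData

variable {P Q : FrobeniusData A} [Rep P.mul] [Rep Q.mul] (m : P.mul ≅ Q.mul) (e : P.form ≅ Q.form)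

theorem hcomp_evalLeft (a b c : A.carrier) (q : Form P.form (P.mulObj a b) c) :
    ((hcomp (m.hom ⊠₂ 𝟙 (𝟙 A)) e.hom).app ((a, b), c)).app (op ⟨PUnit.unit⟩) (P.evalLeft a b c q) =
      Q.evalLeft a b c (formEquiv e _ _ (formMap P.form (mulCompIso m a b).hom (𝟙 c) q)) := by
  refine (congrArg (((Q.mul ⊠₁ 𝟙 A) ◁ e.hom).app ((a, b), c) |>.app (op ⟨PUnit.unit⟩))
    (whiskerRight_eval (m.hom ⊠₂ 𝟙 (𝟙 A)) P.form ((a, b), c) (op ⟨PUnit.unit⟩) q)).trans ?_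
  refine congrArg (fun k => Q.evalLeft a b c (formEquiv e _ _ ((P.form.map k).app _ q))) ?_
  exact HasApp.app_eq ((hasApp_mul m a b).tensorMap (Strict.hasApp c))

theorem hcomp_evalRight (a b c : A.carrier) (q : Form P.form a (P.mulObj b c)) :
    ((Prof.assoc A A A ◁ hcomp (𝟙 (𝟙 A) ⊠₂ m.hom) e.hom).app ((a, b), c)).app (op ⟨PUnit.unit⟩)
        (P.evalRight a b c q) =
      Q.evalRight a b c (formEquiv e _ _ (formMap P.form (𝟙 a) (mulCompIso m b c).hom q)) := by
  refine congrArg (eval _ _ _ _)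
    ((congrArg (((𝟙 A ⊠₁ Q.mul) ◁ e.hom).app (a, (b, c)) |>.app (op ⟨PUnit.unit⟩))
      (whiskerRight_eval (𝟙 (𝟙 A) ⊠₂ m.hom) P.form (a, (b, c)) (op ⟨PUnit.unit⟩) q)).trans ?_)
  refine congrArg (fun k => eval (𝟙 A ⊠₁ Q.mul) Q.form (a, (b, c)) (op ⟨PUnit.unit⟩)
    (formEquiv e _ _ ((P.form.map k).app _ q))) ?_
  exact HasApp.app_eq ((Strict.hasApp a).tensorMap (hasApp_mul m b c))

/-- The composites with the form are not represented, so `ext_app` does not apply. Instead both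
2-cells are compared on elements, all of which are values of `evalLeft`, and the results are
compared through the injective `evalRight`. -/
theorem invariance_comm_iff :
    P.invariance.hom ≫ Prof.assoc A A A ◁ hcomp (𝟙 (𝟙 A) ⊠₂ m.hom) e.hom =
      hcomp (m.hom ⊠₂ 𝟙 (𝟙 A)) e.hom ≫ Q.invariance.hom ↔
    ∀ (a b c : A.carrier) (q : Form P.form (P.mulObj a b) c),
      formEquiv e _ _ (formMap P.form (𝟙 a) (mulCompIso m b c).hom (P.invar a b c q)) =
        Q.invar a b c (formEquiv e _ _ (formMap P.form (mulCompIso m a b).hom (𝟙 c) q)) := by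
  have h₁ (a b c : A.carrier) (q : Form P.form (P.mulObj a b) c) :
      ((P.invariance.hom ≫ Prof.assoc A A A ◁ hcomp (𝟙 (𝟙 A) ⊠₂ m.hom) e.hom).app ((a, b), c)).app
          (op ⟨PUnit.unit⟩) (P.evalLeft a b c q) =
        Q.evalRight a b c (formEquiv e _ _
          (formMap P.form (𝟙 a) (mulCompIso m b c).hom (P.invar a b c q))) :=
    (congrArg ((Prof.assoc A A A ◁ hcomp (𝟙 (𝟙 A) ⊠₂ m.hom) e.hom).app ((a, b), c) |>.app
      (op ⟨PUnit.unit⟩)) (P.evalRight_invar q).symm).trans (hcomp_evalRight m e a b c _)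
  have h₂ (a b c : A.carrier) (q : Form P.form (P.mulObj a b) c) :
      ((hcomp (m.hom ⊠₂ 𝟙 (𝟙 A)) e.hom ≫ Q.invariance.hom).app ((a, b), c)).app
          (op ⟨PUnit.unit⟩) (P.evalLeft a b c q) =
        Q.evalRight a b c (Q.invar a b c
          (formEquiv e _ _ (formMap P.form (mulCompIso m a b).hom (𝟙 c) q))) :=
    (congrArg (Q.invariance.hom.app ((a, b), c) |>.app (op ⟨PUnit.unit⟩))
      (hcomp_evalLeft m e a b c q)).trans (Q.evalRight_invar _).symm
  refine ⟨fun h a b c q => (Q.evalRight a b c).injective ((h₁ a b c q).symm.trans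
    (Eq.trans ?_ (h₂ a b c q))), fun h => cell_ext ?_⟩
  · rw [h]
  · rintro ⟨⟨a, b⟩, c⟩ ⟨⟨⟨⟩⟩⟩ x
    obtain ⟨q, rfl⟩ := (P.evalLeft a b c).surjective x
    exact (h₁ a b c q).trans ((congrArg _ (h a b c q)).trans (h₂ a b c q).symm)

end Iso

end FrobeniusData

end ProfBicat

/-! ### Passing between pseudomonoids on the opposite category and monoidal structures -/

namespace ProfBicat

open Bicategory Prof

namespace PseudomonoidData

open Prof.Rep

section MulMapIso

variable {A : Prof.{u}} (M : PseudomonoidData A) [Rep M.mul]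

/-- The product of two isomorphisms. -/
def mulMapIso {a a' b b' : A.carrier} (f : a ≅ a') (g : b ≅ b') :
    M.mulObj a b ≅ M.mulObj a' b' where
  hom := M.mulMap f.hom g.hom
  inv := M.mulMap f.inv g.inv
  hom_inv_id := by rw [← mulMap_comp, f.hom_inv_id, g.hom_inv_id, mulMap_id]
  inv_hom_id := by rw [← mulMap_comp, f.inv_hom_id, g.inv_hom_id, mulMap_id]

/-- Reversing arrows turns the inverse associator on `Cᵒᵖ` into the associator on `C`, so the
monoidal axioms on `C` need the inverted forms of naturality, pentagon and triangle. -/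
theorem assocIso_inv_naturality {a a' b b' c c' : A.carrier} (f : a ⟶ a') (g : b ⟶ b')
    (h : c ⟶ c') :
    M.mulMap f (M.mulMap g h) ≫ (M.assocIso a' b' c').inv =
      (M.assocIso a b c).inv ≫ M.mulMap (M.mulMap f g) h := by
  rw [Iso.eq_inv_comp, ← Category.assoc, Iso.comp_inv_eq, assocIso_naturality]

/-- The pentagon is an equation between isomorphisms, so the inverses agree as well. -/
theorem pentagon_inv (hM : M.pentagonLong = M.pentagonShort) (a b c d : A.carrier) :
    (M.mulMap (𝟙 a) (M.assocIso b c d).inv ≫ (M.assocIso a (M.mulObj b c) d).inv) ≫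
        M.mulMap (M.assocIso a b c).inv (𝟙 d) =
      (M.assocIso a b (M.mulObj c d)).inv ≫ (M.assocIso (M.mulObj a b) c d).inv :=
  congrArg Iso.inv (Iso.ext (M.pentagon_iff.1 hM a b c d) :
    M.mulMapIso (M.assocIso a b c) (Iso.refl d) ≪≫ M.assocIso a (M.mulObj b c) d ≪≫
      M.mulMapIso (Iso.refl a) (M.assocIso b c d) =
    M.assocIso (M.mulObj a b) c d ≪≫ M.assocIso a b (M.mulObj c d))

variable [Rep M.one]

theorem leftUnitIso_inv_naturality {a a' : A.carrier} (f : a ⟶ a') :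
    f ≫ (M.leftUnitIso a').inv = (M.leftUnitIso a).inv ≫ M.mulMap (𝟙 M.unitObj) f := by
  rw [Iso.eq_inv_comp, ← Category.assoc, Iso.comp_inv_eq, leftUnitIso_naturality]

theorem rightUnitIso_inv_naturality {a a' : A.carrier} (f : a ⟶ a') :
    f ≫ (M.rightUnitIso a').inv = (M.rightUnitIso a).inv ≫ M.mulMap f (𝟙 M.unitObj) := by
  rw [Iso.eq_inv_comp, ← Category.assoc, Iso.comp_inv_eq, rightUnitIso_naturality]

theorem triangle_inv (hM : M.triangleLong = M.triangleShort) (a b : A.carrier) :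
    M.mulMap (𝟙 a) (M.leftUnitIso b).inv ≫ (M.assocIso a M.unitObj b).inv =
      M.mulMap (M.rightUnitIso a).inv (𝟙 b) :=
  congrArg Iso.inv (Iso.ext (M.triangle_iff.1 hM a b) :
    M.assocIso a M.unitObj b ≪≫ M.mulMapIso (Iso.refl a) (M.leftUnitIso b) =
      M.mulMapIso (M.rightUnitIso a) (Iso.refl b))

end MulMapIso

section Opposite

variable {C : Type u} [SmallCategory C] (M : PseudomonoidData (Prof.of Cᵒᵖ)) [Rep M.mul]
  [Rep M.one]

/-- The tensor product on `C` of a representable pseudomonoid structure on `Cᵒᵖ`. -/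
@[reducible]
noncomputable def monoidalStruct : MonoidalCategoryStruct C where
  tensorObj x y := (M.mulObj (op x) (op y)).unop
  whiskerLeft x _ _ f := (M.mulMap (𝟙 (op x)) f.op).unop
  whiskerRight f y := (M.mulMap f.op (𝟙 (op y))).unop
  tensorHom f g := (M.mulMap f.op g.op).unop
  tensorUnit := M.unitObj.unop
  associator x y z := (M.assocIso (op x) (op y) (op z)).symm.unop
  leftUnitor x := (M.leftUnitIso (op x)).symm.unop
  rightUnitor x := (M.rightUnitIso (op x)).symm.unop

/-- The monoidal structure on `C` of a representable pseudomonoid structure on `Cᵒᵖ`. -/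
@[reducible]
noncomputable def monoidal (hM : M.IsPseudomonoid) : MonoidalCategory C :=
  letI := M.monoidalStruct
  .ofTensorHom
    (id_tensorHom_id := fun x y => congrArg Quiver.Hom.unop (M.mulMap_id (op x) (op y)))
    (id_tensorHom := fun _ _ _ _ => rfl)
    (tensorHom_id := fun _ _ => rfl)
    (tensorHom_comp_tensorHom := fun f₁ f₂ g₁ g₂ =>
      congrArg Quiver.Hom.unop (M.mulMap_comp g₁.op f₁.op g₂.op f₂.op).symm)
    (associator_naturality := fun f g h =>
      congrArg Quiver.Hom.unop (M.assocIso_inv_naturality f.op g.op h.op).symm)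
    (leftUnitor_naturality := fun f =>
      congrArg Quiver.Hom.unop (M.leftUnitIso_inv_naturality f.op).symm)
    (rightUnitor_naturality := fun f =>
      congrArg Quiver.Hom.unop (M.rightUnitIso_inv_naturality f.op).symm)
    (pentagon := fun x y z w => by
      refine Eq.trans ?_
        (congrArg Quiver.Hom.unop (M.pentagon_inv hM.pentagon (op x) (op y) (op z) (op w)))
      rfl)
    (triangle := fun x y =>
      congrArg Quiver.Hom.unop (M.triangle_inv hM.triangle (op x) (op y)))

end Opposite

end PseudomonoidData

namespace FrobeniusData

open Prof.Rep PseudomonoidData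

variable {C : Type u} [SmallCategory C] (P : FrobeniusData (Prof.of Cᵒᵖ)) [Rep P.mul] [Rep P.one]

/-- The `⋆`-autonomous structure of a representable Frobenius structure on `Cᵒᵖ`. -/
noncomputable def toStarAutonomous (hP : P.IsPseudomonoid) (D : C ⥤ Cᵒᵖ) [hD : D.IsEquivalence]
    (e : P.form ≅ StarAutonomous.dualForm D) : StarAutonomous C where
  monoidal := P.monoidal hP
  D := D
  isEquivalence := hD
  homEquiv x y z := (formEquiv e (P.mulObj (op x) (op y)) (op z)).symm.trans
    ((P.invar (op x) (op y) (op z)).trans (formEquiv e (op x) (P.mulObj (op y) (op z))))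
  homEquiv_naturality {x x' y y' z z'} f g h k := by
    -- Naturality of the inverse of `e`, so that all three factors of the bijection are natural.
    have h₁ : (formEquiv e (P.mulObj (op x') (op y')) (op z')).symm
        (formMap (StarAutonomous.dualForm D) (P.mulMap f.op g.op) h.op k) =
          formMap P.form (P.mulMap f.op g.op) h.op
            ((formEquiv e (P.mulObj (op x) (op y)) (op z)).symm k) :=
      (Equiv.symm_apply_eq _).2 ((congrArg (formMap _ _ _) (Equiv.apply_symm_apply _ _).symm).trans
        (formEquiv_formMap e _ _ _).symm)
    refine (congrArg (fun q => formEquiv e _ _ (P.invar (op x') (op y') (op z') q)) h₁).trans ?_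
    rw [invar_naturality, formEquiv_formMap]
    rfl

end FrobeniusData

namespace StarAutonomous

open Prof.Rep PseudomonoidData

variable {C : Type u} [SmallCategory C] (S : StarAutonomous C)

instance : Rep S.toFrobeniusData.mul :=
  letI := S.monoidal
  Rep.star (tensorFunctor (Prof.of Cᵒᵖ))
instance : Rep S.toFrobeniusData.one :=
  letI := S.monoidal
  Rep.star (unitFunctor (Prof.of Cᵒᵖ))

theorem toFrobeniusData_isPseudomonoid : S.toFrobeniusData.IsPseudomonoid :=
  letI := S.monoidal
  ofMonoidal_isPseudomonoid (Prof.of Cᵒᵖ)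

theorem toFrobeniusData_assocIso (a b c : Cᵒᵖ) :
    (S.toFrobeniusData.assocIso a b c).hom = (S.monoidal.associator a.unop b.unop c.unop).inv.op :=
  letI := S.monoidal
  ofMonoidal_assocIso (Prof.of Cᵒᵖ) a b c

theorem toFrobeniusData_leftUnitIso (a : Cᵒᵖ) :
    (S.toFrobeniusData.leftUnitIso a).hom = (S.monoidal.leftUnitor a.unop).inv.op :=
  letI := S.monoidal
  ofMonoidal_leftUnitIso (Prof.of Cᵒᵖ) a

theorem toFrobeniusData_rightUnitIso (a : Cᵒᵖ) :
    (S.toFrobeniusData.rightUnitIso a).hom = (S.monoidal.rightUnitor a.unop).inv.op :=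
  letI := S.monoidal
  ofMonoidal_rightUnitIso (Prof.of Cᵒᵖ) a

/-- The structural factors of `invariance` only insert actions of identities, removed by
`formMap_id`; what is left is `formCell`, that is, `φ`. -/
theorem toFrobeniusData_invar (x y z : C) (k : S.monoidal.tensorObj x y ⟶ (S.D.obj z).unop) :
    S.toFrobeniusData.invar (op x) (op y) (op z) k = S.homEquiv x y z k := by
  refine S.toFrobeniusData.invar_eq _ _ ?_
  exact congrArg (fun k => S.toFrobeniusData.evalRight (op x) (op y) (op z) (S.homEquiv x y z k))
    (formMap_id (dualForm S.D) (op (S.monoidal.tensorObj x y)) (op z) k)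

end StarAutonomous

end ProfBicat

/-! ### A representable Frobenius structure is recovered from its star-autonomous structure -/

namespace ProfBicat

open Bicategory Prof

namespace FrobeniusData

open Prof.Rep PseudomonoidData

variable {C : Type u} [SmallCategory C] (P : FrobeniusData (Prof.of Cᵒᵖ)) [Rep P.mul] [Rep P.one]

/-- A representable Frobenius structure on `Cᵒᵖ` is induced by its `⋆`-autonomous structure. -/
noncomputable def toStarAutonomousIso (hP : P.IsPseudomonoid) (D : C ⥤ Cᵒᵖ) [D.IsEquivalence]
    (e : P.form ≅ StarAutonomous.dualForm D) :
    Iso (P.toStarAutonomous hP D e).toFrobeniusData P := by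
  let S := P.toStarAutonomous hP D e
  -- The tensor product of `S` was defined by the functor representing `P.mul`, so identities on
  -- objects form a natural isomorphism.
  let t : functor S.toFrobeniusData.mul ≅ functor P.mul :=
    NatIso.ofComponents (fun x => CategoryTheory.Iso.refl _)
      (fun f => (Category.comp_id _).trans (Category.id_comp _).symm)
  -- The unit functor of `S` is constant, so naturality requires the functor representing `P.one` to
  -- send each morphism to an identity.
  let o : functor S.toFrobeniusData.one ≅ functor P.one :=
    NatIso.ofComponents (fun x => CategoryTheory.Iso.refl P.unitObj)
      (fun f => (Category.comp_id _).trans ((P.unit_map f).symm.trans (Category.id_comp _).symm))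
  have hm (a b : Cᵒᵖ) : (mulCompIso (isoOfNatIso t) a b).hom = 𝟙 (P.mulObj a b) :=
    app_isoOfNatIso t (a, b)
  have ho : (oneCompIso (isoOfNatIso o)).hom = 𝟙 P.unitObj := app_isoOfNatIso o ⟨PUnit.unit⟩
  have hr (a b c : Cᵒᵖ) : S.toFrobeniusData.mulMap (𝟙 a) (mulCompIso (isoOfNatIso t) b c).hom =
      𝟙 (P.mulObj a (P.mulObj b c)) :=
    (congrArg (P.mulMap (𝟙 a)) (hm b c)).trans (P.mulMap_id _ _)
  have hl (a b c : Cᵒᵖ) : S.toFrobeniusData.mulMap (mulCompIso (isoOfNatIso t) a b).hom (𝟙 c) =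
      𝟙 (P.mulObj (P.mulObj a b) c) :=
    (congrArg (P.mulMap · (𝟙 c)) (hm a b)).trans (P.mulMap_id _ _)
  refine
    { mul := isoOfNatIso t
      one := isoOfNatIso o
      form := e.symm
      assoc_comm := (assoc_comm_iff _).2 fun a b c => ?_
      leftUnit_comm := (leftUnit_comm_iff _ _).2 fun a => ?_
      rightUnit_comm := (rightUnit_comm_iff _ _).2 fun a => ?_
      invariance_comm := (invariance_comm_iff _ _).2 fun a b c q => ?_ }
  · refine Eq.trans (congrArg₂ (fun u v => (S.toFrobeniusData.assocIso a b c).hom ≫ u ≫ v)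
      (hr a b c) (hm a (P.mulObj b c))) (Eq.trans ?_ (congrArg₂ (fun u v => (u ≫ v) ≫
        (P.assocIso a b c).hom) (hl a b c) (hm (P.mulObj a b) c)).symm)
    refine Eq.trans (congrArg (· ≫ _) (S.toFrobeniusData_assocIso a b c)) ?_
    change (P.assocIso a b c).hom ≫ 𝟙 (P.mulObj a (P.mulObj b c)) ≫ 𝟙 _ =
      (𝟙 (P.mulObj (P.mulObj a b) c) ≫ 𝟙 _) ≫ (P.assocIso a b c).hom
    simp
  · refine Eq.trans (S.toFrobeniusData_leftUnitIso a) (Eq.trans ?_ (congrArg₂ (fun u v => (u ≫ v) ≫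
      (P.leftUnitIso a).hom) ((congrArg (P.mulMap · (𝟙 a)) ho).trans (P.mulMap_id _ _))
        (hm P.unitObj a)).symm)
    change (P.leftUnitIso a).hom = (𝟙 (P.mulObj P.unitObj a) ≫ 𝟙 _) ≫ (P.leftUnitIso a).hom
    simp
  · refine Eq.trans (S.toFrobeniusData_rightUnitIso a) (Eq.trans ?_ (congrArg₂ (fun u v => (u ≫ v) ≫
      (P.rightUnitIso a).hom) ((congrArg (P.mulMap (𝟙 a)) ho).trans (P.mulMap_id _ _))
        (hm a P.unitObj)).symm)
    change (P.rightUnitIso a).hom = (𝟙 (P.mulObj a P.unitObj) ≫ 𝟙 _) ≫ (P.rightUnitIso a).hom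
    simp
  · refine Eq.trans (congrArg₂ (fun u v => formEquiv e.symm _ _ (formMap _ (𝟙 a) u v)) (hm b c)
      (S.toFrobeniusData_invar a.unop b.unop c.unop q)) (Eq.trans ?_ (congrArg (fun u =>
        P.invar a b c (formEquiv e.symm _ _ (formMap _ u (𝟙 c) q))) (hm a b)).symm)
    refine (congrArg (formEquiv e.symm _ _) (formMap_id (StarAutonomous.dualForm D) a (P.mulObj b c)
      _)).trans (Eq.trans ?_ (congrArg (fun u => P.invar a b c (formEquiv e.symm _ _ u))
        (formMap_id (StarAutonomous.dualForm D) (P.mulObj a b) c q)).symm)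
    -- The bijections of `S` are `invar` conjugated by `e`, and transporting them back along
    -- `e.symm` cancels `e`.
    exact (formEquiv e a (P.mulObj b c)).symm_apply_apply _

end FrobeniusData

end ProfBicat

/-! ### Isomorphisms of Frobenius structures come from star-autonomous isomorphisms -/

namespace ProfBicat

open Bicategory Prof

namespace PseudomonoidData

open Prof.Rep

variable {A : Prof.{u}} {M N : PseudomonoidData A} [Rep M.mul] [Rep N.mul]

/-- The compatibility square rearranged with inverse associators, which after reversing arrows is
the associativity axiom of `Functor.CoreMonoidal`; the two unit lemmas below play the same role. -/
theorem mulCompIso_assoc_inv (m : M.mul ≅ N.mul)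
    (h : M.assoc.hom ≫ Prof.assoc A A A ◁ hcomp (𝟙 (𝟙 A) ⊠₂ m.hom) m.hom =
      hcomp (m.hom ⊠₂ 𝟙 (𝟙 A)) m.hom ≫ N.assoc.hom) (a b c : A.carrier) :
    ((M.assocIso a b c).inv ≫ (mulCompIso m (M.mulObj a b) c).hom) ≫
        N.mulMap (mulCompIso m a b).hom (𝟙 c) =
      ((mulCompIso m a (M.mulObj b c)).hom ≫ N.mulMap (𝟙 a) (mulCompIso m b c).hom) ≫
        (N.assocIso a b c).inv := by
  have h := (assoc_comm_iff m).1 h a b c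
  rw [mulCompIso_naturality, mulCompIso_naturality] at h
  rw [Iso.eq_comp_inv, Category.assoc, Category.assoc, Iso.inv_comp_eq, h, Category.assoc]

variable [Rep M.one] [Rep N.one]

theorem mulCompIso_leftUnit_inv (m : M.mul ≅ N.mul) (o : M.one ≅ N.one)
    (h : M.leftUnit.hom = hcomp (o.hom ⊠₂ 𝟙 (𝟙 A)) m.hom ≫ N.leftUnit.hom) (a : A.carrier) :
    (N.leftUnitIso a).inv = ((M.leftUnitIso a).inv ≫ (mulCompIso m M.unitObj a).hom) ≫
      N.mulMap (oneCompIso o).hom (𝟙 a) := by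
  have h := (leftUnit_comm_iff m o).1 h a
  rw [mulCompIso_naturality] at h
  rw [← cancel_mono (N.leftUnitIso a).hom, Category.assoc (M.leftUnitIso a).inv, Category.assoc, ← h,
    Iso.inv_hom_id, Iso.inv_hom_id]

theorem mulCompIso_rightUnit_inv (m : M.mul ≅ N.mul) (o : M.one ≅ N.one)
    (h : M.rightUnit.hom = hcomp (𝟙 (𝟙 A) ⊠₂ o.hom) m.hom ≫ N.rightUnit.hom) (a : A.carrier) :
    (N.rightUnitIso a).inv = ((M.rightUnitIso a).inv ≫ (mulCompIso m a M.unitObj).hom) ≫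
      N.mulMap (𝟙 a) (oneCompIso o).hom := by
  have h := (rightUnit_comm_iff m o).1 h a
  rw [mulCompIso_naturality] at h
  rw [← cancel_mono (N.rightUnitIso a).hom, Category.assoc (M.rightUnitIso a).inv, Category.assoc, ← h,
    Iso.inv_hom_id, Iso.inv_hom_id]

end PseudomonoidData

namespace StarAutonomous

open Prof.Rep PseudomonoidData

variable {C : Type u} [SmallCategory C]

section DualForm

variable {D D' : C ⥤ Cᵒᵖ}

/-- The morphism `D z ⟶ D' z` induced by an isomorphism of forms. -/
def dualHom (e : dualForm D ≅ dualForm D') (z : C) : (D.obj z).unop ⟶ (D'.obj z).unop :=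
  formEquiv e (op (D.obj z).unop) (op z) (𝟙 (D.obj z).unop)

/-- Yoneda in the first variable: `k` is the restriction along itself of the identity of `D z`. -/
theorem formEquiv_eq_comp (e : dualForm D ≅ dualForm D') {x z : C} (k : x ⟶ (D.obj z).unop) :
    formEquiv e (op x) (op z) k = k ≫ dualHom e z := by
  have h := formEquiv_formMap e (a := op (D.obj z).unop) (b := op z) k.op (𝟙 (op z))
    (𝟙 (D.obj z).unop)
  refine Eq.trans (congrArg (formEquiv e (op x) (op z)) ?_) (h.trans ?_)
  · change k = k ≫ 𝟙 _ ≫ (D.map (𝟙 z)).unop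
    simp
  · change k ≫ dualHom e z ≫ (D'.map (𝟙 z)).unop = _
    simp

/-- Naturality of `e` in the second variable, evaluated at the identity of `D z`. -/
theorem dualHom_naturality (e : dualForm D ≅ dualForm D') {z z' : C} (g : z' ⟶ z) :
    (D.map g).unop ≫ dualHom e z' = dualHom e z ≫ (D'.map g).unop := by
  have h := formEquiv_formMap e (a := op (D.obj z).unop) (b := op z) (𝟙 _) g.op
    (𝟙 (D.obj z).unop)
  refine (formEquiv_eq_comp e _).symm.trans (Eq.trans (congrArg (formEquiv e _ _) ?_) (h.trans ?_))
  · change (D.map g).unop = 𝟙 _ ≫ 𝟙 _ ≫ (D.map g).unop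
    simp
  · change 𝟙 _ ≫ dualHom e z ≫ (D'.map g).unop = _
    simp

theorem dualHom_comp_symm (e : dualForm D ≅ dualForm D') (z : C) :
    dualHom e z ≫ dualHom e.symm z = 𝟙 _ :=
  (formEquiv_eq_comp e.symm _).symm.trans
    ((formEquiv e (op (D.obj z).unop) (op z)).symm_apply_apply _)

/-- Isomorphic forms have isomorphic dualities. -/
def dualIso (e : dualForm D ≅ dualForm D') : D ≅ D' :=
  NatIso.ofComponents (fun z =>
      -- The dualities take values in `Cᵒᵖ`, so the forward component is induced by the inverse of
      -- `e`; its inverse then unopposes to `dualHom e z`, as `homEquiv_comm` requires.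
      { hom := (dualHom e.symm z).op
        inv := (dualHom e z).op
        hom_inv_id := congrArg Quiver.Hom.op (dualHom_comp_symm e z)
        inv_hom_id := congrArg Quiver.Hom.op (dualHom_comp_symm e.symm z) })
    (fun g => congrArg Quiver.Hom.op (dualHom_naturality e.symm g).symm)

end DualForm

theorem toFrobeniusData_assocIso_inv (S : StarAutonomous C) (a b c : Cᵒᵖ) :
    (S.toFrobeniusData.assocIso a b c).inv = (S.monoidal.associator a.unop b.unop c.unop).hom.op :=
  congrArg CategoryTheory.Iso.inv (CategoryTheory.Iso.ext (S.toFrobeniusData_assocIso a b c) :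
    S.toFrobeniusData.assocIso a b c = (S.monoidal.associator a.unop b.unop c.unop).symm.op)

theorem toFrobeniusData_leftUnitIso_inv (S : StarAutonomous C) (a : Cᵒᵖ) :
    (S.toFrobeniusData.leftUnitIso a).inv = (S.monoidal.leftUnitor a.unop).hom.op :=
  congrArg CategoryTheory.Iso.inv (CategoryTheory.Iso.ext (S.toFrobeniusData_leftUnitIso a) :
    S.toFrobeniusData.leftUnitIso a = (S.monoidal.leftUnitor a.unop).symm.op)

theorem toFrobeniusData_rightUnitIso_inv (S : StarAutonomous C) (a : Cᵒᵖ) :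
    (S.toFrobeniusData.rightUnitIso a).inv = (S.monoidal.rightUnitor a.unop).hom.op :=
  congrArg CategoryTheory.Iso.inv (CategoryTheory.Iso.ext (S.toFrobeniusData_rightUnitIso a) :
    S.toFrobeniusData.rightUnitIso a = (S.monoidal.rightUnitor a.unop).symm.op)

variable {S T : StarAutonomous C}

/-- The strong monoidal structure on the identity functor induced by an isomorphism of the
corresponding Frobenius structures. -/
noncomputable def coreMonoidalOfIso (i : FrobeniusData.Iso S.toFrobeniusData T.toFrobeniusData) :
    @Functor.CoreMonoidal C _ S.monoidal C _ T.monoidal (𝟭 C) :=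
  @Functor.CoreMonoidal.mk C _ S.monoidal C _ T.monoidal (𝟭 C)
    -- In `Cᵒᵖ` the components run from the structure of `S` to that of `T`; unopposed they run from
    -- `T` to `S`, which is the direction of `ε` and `μ` for the identity functor from `S` to `T`.
    (oneCompIso i.one).unop
    (fun x y => (mulCompIso i.mul (op x) (op y)).unop)
    (fun {x y} f z => by
      have h := congrArg Quiver.Hom.unop (mulCompIso_naturality i.mul f.op (𝟙 (op z)))
      exact Eq.trans (congrArg (· ≫ (mulCompIso i.mul (op y) (op z)).hom.unop)
        (@MonoidalCategory.tensorHom_id C _ T.monoidal _ _ f z).symm) (h.symm.trans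
          (congrArg ((mulCompIso i.mul (op x) (op z)).hom.unop ≫ ·)
            (@MonoidalCategory.tensorHom_id C _ S.monoidal _ _ f z))))
    (fun {x y} z f => by
      have h := congrArg Quiver.Hom.unop (mulCompIso_naturality i.mul (𝟙 (op z)) f.op)
      exact Eq.trans (congrArg (· ≫ (mulCompIso i.mul (op z) (op y)).hom.unop)
        (@MonoidalCategory.id_tensorHom C _ T.monoidal z _ _ f).symm) (h.symm.trans
          (congrArg ((mulCompIso i.mul (op z) (op x)).hom.unop ≫ ·)
            (@MonoidalCategory.id_tensorHom C _ S.monoidal z _ _ f))))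
    (fun x y z => by
      have h := mulCompIso_assoc_inv i.mul i.assoc_comm (op x) (op y) (op z)
      rw [toFrobeniusData_assocIso_inv, toFrobeniusData_assocIso_inv] at h
      refine Eq.trans ?_ ((congrArg Quiver.Hom.unop h).trans ?_)
      · exact congrArg (· ≫ ((mulCompIso i.mul _ _).hom.unop ≫
          (S.monoidal.associator x y z).hom))
            (@MonoidalCategory.tensorHom_id C _ T.monoidal _ _ _ z).symm
      · exact congrArg (fun k => (T.monoidal.associator x y z).hom ≫ k ≫
          (mulCompIso i.mul _ _).hom.unop) (@MonoidalCategory.id_tensorHom C _ T.monoidal x _ _ _))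
    (fun x => by
      have h := mulCompIso_leftUnit_inv i.mul i.one i.leftUnit_comm (op x)
      rw [toFrobeniusData_leftUnitIso_inv, toFrobeniusData_leftUnitIso_inv] at h
      refine (congrArg Quiver.Hom.unop h).trans ?_
      exact congrArg (· ≫ ((mulCompIso i.mul _ _).hom.unop ≫ (S.monoidal.leftUnitor x).hom))
        (@MonoidalCategory.tensorHom_id C _ T.monoidal _ _ _ x))
    (fun x => by
      have h := mulCompIso_rightUnit_inv i.mul i.one i.rightUnit_comm (op x)
      rw [toFrobeniusData_rightUnitIso_inv, toFrobeniusData_rightUnitIso_inv] at h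
      refine (congrArg Quiver.Hom.unop h).trans ?_
      exact congrArg (· ≫ ((mulCompIso i.mul _ _).hom.unop ≫ (S.monoidal.rightUnitor x).hom))
        (@MonoidalCategory.id_tensorHom C _ T.monoidal x _ _ _))

/-- Isomorphic Frobenius structures come from isomorphic `⋆`-autonomous structures. -/
noncomputable def isoOfFrobeniusIso
    (i : FrobeniusData.Iso S.toFrobeniusData T.toFrobeniusData) : Iso S T where
  monoidal := @Functor.CoreMonoidal.toMonoidal C _ S.monoidal C _ T.monoidal (𝟭 C)
    (coreMonoidalOfIso i)
  dual := dualIso i.form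
  homEquiv_comm x y z k := by
    let μ (x y : C) : T.monoidal.tensorObj x y ⟶ S.monoidal.tensorObj x y :=
      (mulCompIso i.mul (op x) (op y)).hom.unop
    -- The invariance square on elements. Below, Yoneda rewrites both occurrences of the form
    -- isomorphism as composition with `dualHom`.
    have h : formEquiv i.form (op x) (op (T.monoidal.tensorObj y z))
          (𝟙 x ≫ S.toFrobeniusData.invar (op x) (op y) (op z) k ≫ (S.D.map (μ y z)).unop) =
        T.toFrobeniusData.invar (op x) (op y) (op z)
          (formEquiv i.form (op (T.monoidal.tensorObj x y)) (op z)
            (μ x y ≫ k ≫ (S.D.map (𝟙 z)).unop)) :=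
      (FrobeniusData.invariance_comm_iff i.mul i.form).1 i.invariance_comm
        (op x) (op y) (op z) k
    let e : dualForm S.D ≅ dualForm T.D := i.form
    have h₁ : formEquiv e (op (T.monoidal.tensorObj x y)) (op z)
        (μ x y ≫ k ≫ (S.D.map (𝟙 z)).unop) = μ x y ≫ k ≫ dualHom e z :=
      (formEquiv_eq_comp e _).trans (by simp; rfl)
    have h₂ : formEquiv e (op x) (op (T.monoidal.tensorObj y z))
        (𝟙 x ≫ S.homEquiv x y z k ≫ (S.D.map (μ y z)).unop) = S.homEquiv x y z k ≫
          dualHom e (S.monoidal.tensorObj y z) ≫ (T.D.map (μ y z)).unop :=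
      (formEquiv_eq_comp e _).trans (by
        simp only [Category.id_comp, Category.assoc, dualHom_naturality]
        rfl)
    refine ((congrArg (T.homEquiv x y z) h₁.symm).trans
      (T.toFrobeniusData_invar x y z _).symm).trans (h.symm.trans (Eq.trans ?_ h₂))
    exact congrArg (fun q => formEquiv e (op x) (op (T.monoidal.tensorObj y z))
      (𝟙 x ≫ q ≫ (S.D.map (μ y z)).unop)) (S.toFrobeniusData_invar x y z k)

end StarAutonomous

end ProfBicat

/-! ### Adjoint profunctors and Cauchy completeness -/

namespace ProfBicat

open Bicategory

namespace Prof

variable {X Y Z : Prof.{u}}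

/-- Makes the coherence cell hidden in `⊗≫` explicit, so that the zig-zag can be computed on
elements. -/
theorem leftZigzag_eq {P : X ⟶ Y} {Q : Y ⟶ X} (s : 𝟙 X ⟶ P ≫ Q) (t : Q ≫ P ⟶ 𝟙 Y) :
    leftZigzag s t = s ▷ P ≫ (α_ P Q P).hom ≫ P ◁ t := by
  simp [bicategoricalComp]

theorem rightZigzag_eq {P : X ⟶ Y} {Q : Y ⟶ X} (s : 𝟙 X ⟶ P ≫ Q) (t : Q ≫ P ⟶ 𝟙 Y) :
    rightZigzag s t = Q ◁ s ≫ (α_ Q P Q).inv ≫ t ▷ Q := by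
  simp [bicategoricalComp]

/-- The corepresentable profunctor `(x, y) ↦ Hom(F x, y)` of a functor, as a 1-cell. -/
def costar (F : X.carrier ⥤ Y.carrier) : Y ⟶ X :=
  show Profunctor.{u} Y.carrier X.carrier from
  { obj := fun y =>
      { obj := fun x => F.obj x.unop ⟶ y
        map := fun g => ↾(fun k => F.map g.unop ≫ k) }
    map := fun h => { app := fun x => ↾(fun k : F.obj x.unop ⟶ _ => k ≫ h) } }

/-- The unit of `F_* ⊣ F^*`. -/
def starUnit (F : X.carrier ⥤ Y.carrier) : 𝟙 X ⟶ star F ≫ costar F :=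
  show Profunctor.id ⟶ comp (star F) (costar F) from
  { app := fun x =>
      { app := fun x' => ↾(fun f : x'.unop ⟶ x =>
          CoendComp.mk (P := star F) (Q := costar F) (F.obj x) (𝟙 (F.obj x)) (F.map f))
        naturality := fun x' x'' g => by
          ext f
          exact congrArg (CoendComp.mk (P := star F) (Q := costar F) _ _) (F.map_comp g.unop f) }
    naturality := fun x x' h => by
      ext x'' (f : x''.unop ⟶ x)
      have hs := CoendComp.sound (P := star F) (Q := costar F) (a := x') (c := x'')
        (F.map h) (𝟙 (F.obj x')) (F.map f)
      refine Eq.trans ?_ (hs.symm.trans ?_)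
      · exact congrArg (CoendComp.mk (P := star F) (Q := costar F) _ _) (F.map_comp f h)
      · exact congrArg (CoendComp.mk (P := star F) (Q := costar F) _ · _)
          ((Category.comp_id _).trans (Category.id_comp _).symm) }

/-- The counit of `F_* ⊣ F^*`. -/
def starCounit (F : X.carrier ⥤ Y.carrier) : costar F ≫ star F ⟶ 𝟙 Y :=
  show comp (costar F) (star F) ⟶ Profunctor.id from
  { app := fun y =>
      { app := fun y' => ↾(CoendComp.lift (P := costar F) (Q := star F) (X := y'.unop ⟶ y)
          (fun x (p : F.obj x ⟶ y) (q : y'.unop ⟶ F.obj x) => q ≫ p)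
          (fun f p q => (Category.assoc (obj := Y.carrier) q (F.map f) p).symm))
        naturality := fun y' y'' g => by
          ext t
          induction t using CoendComp.ind with | _ x p q
          exact Category.assoc (obj := Y.carrier) g.unop q p }
    naturality := fun y y' h => by
      ext y'' t
      induction t using CoendComp.ind with | _ x p q
      exact (Category.assoc (obj := Y.carrier) q p h).symm }

/-- The adjunction `F_* ⊣ F^*`. -/
def starAdjunction (F : X.carrier ⥤ Y.carrier) : Bicategory.Adjunction (star F) (costar F) where
  unit := starUnit F
  counit := starCounit F
  left_triangle := by
    rw [leftZigzag_eq]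
    refine cell_ext fun x y t => ?_
    induction t using CoendComp.ind with | _ x' f p
    change x' ⟶ x at f
    change unop y ⟶ F.obj x' at p
    change CoendComp.mk (P := star F) (Q := Profunctor.id) (F.obj x) (𝟙 (F.obj x)) (p ≫ F.map f) =
      CoendComp.mk (P := star F) (Q := Profunctor.id) (unop y) (p ≫ F.map f) (𝟙 (unop y))
    -- Both classes arise from the arrow `p ≫ F.map f`, placed in the second or in the first factor,
    -- and one coend step moves it across.
    have hs := CoendComp.sound (P := star F) (Q := Profunctor.id) (a := x) (c := y)
      (p ≫ F.map f) (𝟙 (F.obj x)) (𝟙 (unop y))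
    refine Eq.trans ?_ (hs.symm.trans ?_)
    · exact congrArg (CoendComp.mk (P := star F) (Q := Profunctor.id) _ _) (Category.id_comp _).symm
    · exact congrArg (CoendComp.mk (P := star F) (Q := Profunctor.id) _ · _) (Category.comp_id _)
  right_triangle := by
    rw [rightZigzag_eq]
    refine cell_ext fun y x t => ?_
    induction t using CoendComp.ind with | _ x' p f
    change F.obj x' ⟶ y at p
    change unop x ⟶ x' at f
    change CoendComp.mk (P := Profunctor.id) (Q := costar F) (F.obj x') (𝟙 (F.obj x') ≫ p) (F.map f) =
      CoendComp.mk (P := Profunctor.id) (Q := costar F) y (𝟙 y) (F.map f ≫ p)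
    have hs := CoendComp.sound (P := Profunctor.id) (Q := costar F) (a := y) (c := x)
      p (𝟙 y) (F.map f)
    refine Eq.trans ?_ hs
    exact congrArg (CoendComp.mk (P := Profunctor.id) (Q := costar F) _ · _)
      ((Category.id_comp _).trans (Category.comp_id _).symm)

instance (F : X.carrier ⥤ Y.carrier) : IsLeftAdjoint (star F : X ⟶ Y) :=
  .mk (starAdjunction F)

section Cauchy

variable {P : X ⟶ Y} {Q : Y ⟶ X}

/-- The left triangle identity evaluated at `p'`. It says that the single element `p` generates
every `P(-, x)`, with the counit choosing the arrow along which to restrict. -/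
theorem adjunction_triangle (adj : Bicategory.Adjunction P Q) {x : X.carrier} {y b : Y.carrier} (p : (P.obj x).obj (op b))
    (r : (Q.obj b).obj (op x))
    (h : (adj.unit.app x).app (op x) (𝟙 x) = CoendComp.mk (P := P) (Q := Q) b p r)
    (p' : (P.obj x).obj (op y)) :
    (P.obj x).map (Quiver.Hom.op
      (show y ⟶ b from (adj.counit.app b).app (op y) (CoendComp.mk (P := Q) (Q := P) x r p'))) p =
      p' := by
  have h1 : (adj.unit ▷ P ≫ (α_ P Q P).hom ≫ P ◁ adj.counit) ≫ (ρ_ P).hom = (λ_ P).hom := by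
    rw [← leftZigzag_eq, adj.left_triangle, Category.assoc, Iso.inv_hom_id, Category.comp_id]
  have h2 := types_congr_hom (NatTrans.congr_app (NatTrans.congr_app h1 x) (op y))
    (CoendComp.mk (P := Profunctor.id) (Q := P) x (𝟙 x) p')
  refine Eq.trans ?_ (h2.trans (types_congr_hom (NatTrans.congr_app (P.map_id x) (op y)) p'))
  exact congrArg (fun t : CoendComp P Q x (op x) => ((ρ_ P).hom.app x).app (op y)
    (((P ◁ adj.counit).app x).app (op y) (((α_ P Q P).hom.app x).app (op y)
      (CoendComp.mk (P := P ≫ Q) (Q := P) x t p')))) h.symm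

/-- A 1-cell with a right adjoint into a Cauchy complete category has universal elements. -/
theorem exists_universal_of_adjunction (adj : Bicategory.Adjunction P Q)
    [IsIdempotentComplete Y.carrier] (x : X.carrier) :
    ∃ (b : Y.carrier) (p : (P.obj x).obj (op b)), ∀ y : Y.carrier,
      Function.Bijective (fun f : y ⟶ b => (P.obj x).map f.op p) := by
  obtain ⟨b, p, r, h⟩ : ∃ b p r,
      (adj.unit.app x).app (op x) (𝟙 x) = CoendComp.mk (P := P) (Q := Q) b p r := by
    generalize (adj.unit.app x).app (op x) (𝟙 x) = t
    induction t using CoendComp.ind with | _ b p r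
    exact ⟨b, p, r, rfl⟩
  -- A natural section of the map `f ↦ P(f) p`, so `P(-, x)` is a retract of `Hom(-, b)`.
  let s (y : Y.carrier) (p' : (P.obj x).obj (op y)) : y ⟶ b :=
    (adj.counit.app b).app (op y) (CoendComp.mk (P := Q) (Q := P) x r p')
  have hs (y : Y.carrier) (p' : (P.obj x).obj (op y)) : (P.obj x).map (s y p').op p = p' :=
    adjunction_triangle adj p r h p'
  have hnat {y y' : Y.carrier} (g : y ⟶ y') (p' : (P.obj x).obj (op y')) :
      s y ((P.obj x).map g.op p') = g ≫ s y' p' :=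
    NatTrans.naturality_apply (adj.counit.app b) g.op (CoendComp.mk (P := Q) (Q := P) x r p')
  -- Under Yoneda `s b p` is the idempotent of this retract.
  have hidem : s b p ≫ s b p = s b p := by rw [← hnat, hs]
  obtain ⟨c, i, e, hie, hei⟩ := IsIdempotentComplete.idempotents_split b (s b p) hidem
  -- The image `c` of the idempotent represents `P(-, x)`, with `p` restricted along the inclusion
  -- `i` as universal element and `s y p' ≫ e` as the arrow classifying `p'`.
  refine ⟨c, (P.obj x).map i.op p, fun y => Function.bijective_iff_has_inverse.2
    ⟨fun p' => s y p' ≫ e, fun f => ?_, fun p' => ?_⟩⟩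
  · change s y ((P.obj x).map f.op ((P.obj x).map i.op p)) ≫ e = f
    rw [hnat, hnat, ← hei]
    simp [hie]
  · change (P.obj x).map (s y p' ≫ e).op ((P.obj x).map i.op p) = p'
    rw [Rep.map_map, Category.assoc, hei, ← Rep.map_map, hs, hs]

/-- A 1-cell with universal elements is representable by a functor. -/
theorem nonempty_rep (h : ∀ x : X.carrier, ∃ (b : Y.carrier) (p : (P.obj x).obj (op b)),
    ∀ y : Y.carrier, Function.Bijective (fun f : y ⟶ b => (P.obj x).map f.op p)) :
    Nonempty (Rep P) := by
  choose F p hp using h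
  -- The action on morphisms is forced by universality, and functoriality follows from uniqueness.
  choose m hm using fun {x x' : X.carrier} (f : x ⟶ x') =>
    (hp x' (F x)).2 ((P.map f).app _ (p x))
  refine ⟨{
    functor := { obj := F, map := fun f => m f, map_id := fun x => ?_, map_comp := fun {x x' x''} f g => ?_ }
    elem := p
    map_elem := fun f => (hm f).symm
    bijective := hp }⟩
  · refine (hp x _).1 ((hm _).trans (Eq.trans ?_ (Rep.map_id P (p x)).symm))
    exact types_congr_hom (NatTrans.congr_app (P.map_id x) _) (p x)
  · refine (hp x'' _).1 ((hm _).trans ?_)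
    change _ = (P.obj x'').map (m f ≫ m g).op (p x'')
    rw [← Rep.map_map]
    refine Eq.trans ?_ (congrArg ((P.obj x'').map (m f).op) (hm g).symm)
    refine Eq.trans ?_ (NatTrans.naturality_apply (P.map g) (m f).op (p x'))
    refine Eq.trans ?_ (congrArg ((P.map g).app _) (hm f).symm)
    exact types_congr_hom (NatTrans.congr_app (P.map_comp f g) _) (p x)

theorem nonempty_rep_of_isLeftAdjoint [IsIdempotentComplete Y.carrier] [IsLeftAdjoint P] :
    Nonempty (Rep P) :=
  nonempty_rep (exists_universal_of_adjunction (Adjunction.ofIsLeftAdjoint P))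

end Cauchy

end Prof
end ProfBicat

/-! ### Currying a form, and the left zig-zag -/

namespace ProfBicat

open Bicategory

namespace Prof

variable {X Y Z : Prof.{u}}

section Curry

variable (σ : X ⊠ Y ⟶ tensorUnit) (κ : tensorUnit ⟶ Y ⊠ X)

/-- The values of a 1-cell out of the unit. -/
def Coform (y : Y.carrier) (x : X.carrier) : Type u := (κ.obj ⟨PUnit.unit⟩).obj (op (y, x))

/-- The action of morphisms on the values of a 1-cell out of the unit. -/
def coformMap {y y' : Y.carrier} {x x' : X.carrier} (g : y' ⟶ y) (f : x' ⟶ x)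
    (k : Coform κ y x) : Coform κ y' x' :=
  (κ.obj ⟨PUnit.unit⟩).map (Quiver.Hom.op (X := (y', x')) (Y := (y, x)) (Prod.mkHom g f)) k

theorem coformMap_id (y : Y.carrier) (x : X.carrier) (k : Coform κ y x) :
    coformMap κ (𝟙 y) (𝟙 x) k = k :=
  types_congr_hom ((κ.obj ⟨PUnit.unit⟩).map_id (op (y, x))) k

theorem coformMap_comp {y y' y'' : Y.carrier} {x x' x'' : X.carrier} (g : y' ⟶ y) (g' : y'' ⟶ y')
    (f : x' ⟶ x) (f' : x'' ⟶ x') (k : Coform κ y x) :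
    coformMap κ (g' ≫ g) (f' ≫ f) k = coformMap κ g' f' (coformMap κ g f k) :=
  types_congr_hom ((κ.obj ⟨PUnit.unit⟩).map_comp
    (Quiver.Hom.op (X := (y', x')) (Y := (y, x)) (Prod.mkHom g f))
    (Quiver.Hom.op (X := (y'', x'')) (Y := (y', x')) (Prod.mkHom g' f'))) k

/-- A form on `X ⊠ Y` as a 1-cell from `X` to the opposite of `Y`. -/
def curry : X ⟶ Prof.of Y.carrierᵒᵖ :=
  show Profunctor.{u} X.carrier Y.carrierᵒᵖ from
  { obj := fun x =>
      { obj := fun w => Form σ x w.unop.unop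
        map := fun g => ↾(formMap σ (𝟙 x) g.unop.unop)
        map_id := fun w => by ext q; exact formMap_id σ _ _ q
        map_comp := fun g h => by
          ext q
          refine Eq.trans ?_ (formMap_comp σ (𝟙 x) (𝟙 x) g.unop.unop h.unop.unop q)
          exact congrArg (formMap σ · _ q) (Category.comp_id _).symm }
    map := fun f =>
      { app := fun w => ↾(formMap σ f (𝟙 w.unop.unop))
        naturality := fun w w' g => by
          ext q
          refine (formMap_comp σ _ _ _ _ q).symm.trans (Eq.trans ?_ (formMap_comp σ _ _ _ _ q))
          congr 1
          · exact (Category.id_comp f).trans (Category.comp_id f).symm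
          · exact (Category.comp_id _).trans (Category.id_comp _).symm }
    map_id := fun x => by ext w q; exact formMap_id σ _ _ q
    map_comp := fun f g => by
      ext w q
      refine Eq.trans ?_ (formMap_comp σ f g (𝟙 _) (𝟙 _) q)
      exact congrArg (formMap σ _ · q) (Category.comp_id _).symm }

/-- A 1-cell from the unit to `Y ⊠ X` as a 1-cell from the opposite of `Y` to `X`. -/
def cocurry : Prof.of Y.carrierᵒᵖ ⟶ X :=
  show Profunctor.{u} Y.carrierᵒᵖ X.carrier from
  { obj := fun w =>
      { obj := fun x => Coform κ w.unop x.unop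
        map := fun f => ↾(coformMap κ (𝟙 w.unop) f.unop)
        map_id := fun x => by ext k; exact coformMap_id κ _ _ k
        map_comp := fun f f' => by
          ext k
          refine Eq.trans ?_ (coformMap_comp κ (𝟙 _) (𝟙 _) f.unop f'.unop k)
          exact congrArg (coformMap κ · _ k) (Category.comp_id _).symm }
    map := fun g =>
      { app := fun x => ↾(coformMap κ g.unop (𝟙 x.unop))
        naturality := fun x x' f => by
          ext k
          refine (coformMap_comp κ _ _ _ _ k).symm.trans (Eq.trans ?_ (coformMap_comp κ _ _ _ _ k))
          congr 1
          · exact (Category.comp_id _).trans (Category.id_comp _).symm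
          · exact (Category.id_comp _).trans (Category.comp_id _).symm }
    map_id := fun w => by ext x k; exact coformMap_id κ _ _ k
    map_comp := fun g g' => by
      ext x k
      refine Eq.trans ?_ (coformMap_comp κ g.unop g'.unop (𝟙 _) (𝟙 _) k)
      exact congrArg (coformMap κ _ · k) (Category.comp_id _).symm }

/-- A 1-cell from the opposite of `Y` to `X` as a 1-cell from the unit to `Y ⊠ X`. -/
def uncocurry (R : Prof.of Y.carrierᵒᵖ ⟶ X) : tensorUnit ⟶ Y ⊠ X :=
  show Profunctor.{u} (Discrete PUnit.{u + 1}) (Y.carrier × X.carrier) from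
  (Functor.const _).obj
    { obj := fun w => (R.obj (op w.unop.1)).obj (op w.unop.2)
      map := fun {w w'} g => (R.obj (op w.unop.1)).map g.unop.2.op ≫ (R.map g.unop.1.op).app _
      map_id := fun w => by
        ext p
        exact (types_congr_hom (NatTrans.congr_app (R.map_id _) _) _).trans
          (types_congr_hom ((R.obj _).map_id _) p)
      map_comp := fun {w w' w''} g g' => by
        ext p
        refine (types_congr_hom (NatTrans.congr_app
          (R.map_comp (X := op w.unop.1) g.unop.1.op g'.unop.1.op) _) _).trans ?_
        refine congrArg ((R.map g'.unop.1.op).app _) ?_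
        refine (congrArg ((R.map g.unop.1.op).app _) (types_congr_hom
          ((R.obj (op w.unop.1)).map_comp g.unop.2.op g'.unop.2.op) p)).trans ?_
        exact NatTrans.naturality_apply (R.map g.unop.1.op) g'.unop.2.op _ }

/-- `cocurry` is left inverse to `uncocurry`. -/
def cocurryUncocurry (R : Prof.of Y.carrierᵒᵖ ⟶ X) : cocurry (uncocurry R) ≅ R :=
  cellMk (fun _ _ => Equiv.refl _)
    (fun w _ _ _ _ => types_congr_hom (NatTrans.congr_app (R.map_id w) _) _)
    (fun {w _} f x p => congrArg ((R.map f).app x) (types_congr_hom ((R.obj w).map_id x) p))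

theorem curryMk_sound {x : X.carrier} {z : X.carrier} {y y' : Y.carrier} (v : y ⟶ y')
    (s : Form σ x y) (k : Coform κ y' z) :
    (CoendComp.mk (op y') (formMap σ (𝟙 x) v s) k :
      CoendComp (curry σ) (cocurry κ) x (op z)) =
      CoendComp.mk (op y) s (coformMap κ v (𝟙 z) k) :=
  CoendComp.sound (P := curry σ) (Q := cocurry κ) (c := op z) v.op s k

/-- The last three factors of the left zig-zag, after substitution along the structural functors. -/
def zigzagLeftTail : X ⊠ (Y ⊠ X) ⟶ X :=
  restrict (B := (X ⊠ Y) ⊠ X) (prod.inverseAssociator X.carrier Y.carrier X.carrier)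
    (show (X ⊠ Y) ⊠ X ⟶ X from Functor.comp (σ ⊠₁ 𝟙 X)
      ((Functor.whiskeringLeft _ _ _).obj (prod.leftInverseUnitor X.carrier).op))

/-- The left zig-zag, after substitution along the structural functors. -/
def zigzagLeftRestrict : X ⟶ X :=
  restrict (B := X ⊠ tensorUnit) (prod.rightInverseUnitor X.carrier)
    ((𝟙 X ⊠₁ κ) ≫ zigzagLeftTail σ)

/-- Elements of the left zig-zag. -/
def zigzagLeftMk {x z : X.carrier} (a : X.carrier) (y : Y.carrier) (c : X.carrier) (f : a ⟶ x)
    (k : Coform κ y c) (s : Form σ a y) (g : z ⟶ c) :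
    ((zigzagLeftRestrict σ κ).obj x).obj (op z) :=
  CoendComp.mk (P := 𝟙 X ⊠₁ κ)
    (Q := zigzagLeftTail σ)
    (a := (prod.rightInverseUnitor X.carrier).obj x) (c := op z) (a, (y, c)) (f, k)
    (show Form σ a y × (z ⟶ c) from (s, g))

theorem zigzagLeftMk_sound {x z a a' : X.carrier} {y y' : Y.carrier} {c c' : X.carrier}
    (u : a ⟶ a') (v : y ⟶ y') (w : c ⟶ c') (f : a' ⟶ x)
    (k : Coform κ y' c') (s : Form σ a y) (g : z ⟶ c) :
    zigzagLeftMk σ κ a y c (u ≫ f) (coformMap κ v w k) s g =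
      zigzagLeftMk σ κ a' y' c' f k (formMap σ u v s) (g ≫ w) :=
  CoendComp.sound (P := 𝟙 X ⊠₁ κ)
    (Q := zigzagLeftTail σ)
    (a := (prod.rightInverseUnitor X.carrier).obj x) (c := op z)
    (b := (a, (y, c))) (b' := (a', (y', c'))) (Prod.mkHom u (Prod.mkHom v w)) (f, k)
    (show Form σ a y × (z ⟶ c) from (s, g))

/-- A normal form: two coend steps move `f` into the form and `g` into the coform. This removes both
copies of `X` from the coend, leaving the coend over `Y` that computes `curry σ ≫ cocurry κ`. -/
theorem zigzagLeftMk_eq {x z a : X.carrier} {y : Y.carrier} {c : X.carrier} (f : a ⟶ x)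
    (k : Coform κ y c) (s : Form σ a y) (g : z ⟶ c) :
    zigzagLeftMk σ κ a y c f k s g =
      zigzagLeftMk σ κ x y z (𝟙 x) (coformMap κ (𝟙 y) g k) (formMap σ f (𝟙 y) s) (𝟙 z) := by
  have h1 := zigzagLeftMk_sound σ κ f (𝟙 y) (𝟙 z) (𝟙 x) (coformMap κ (𝟙 y) g k) s (𝟙 z)
  have h2 := zigzagLeftMk_sound σ κ (𝟙 a) (𝟙 y) g f k s (𝟙 z)
  rw [Category.comp_id, coformMap_id, Category.comp_id] at h1
  rw [Category.id_comp, formMap_id, Category.id_comp] at h2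
  exact h2.symm.trans h1

/-- The left zig-zag as a composite of curried 1-cells. -/
def zigzagLeftCell : zigzagLeftRestrict σ κ ≅ curry σ ≫ cocurry κ :=
  cellMk (P := zigzagLeftRestrict σ κ) (fun x z =>
    { toFun := CoendComp.lift (X := CoendComp (curry σ) (cocurry κ) x z)
        (fun (b : X.carrier × (Y.carrier × X.carrier)) (p : (b.1 ⟶ x) × Coform κ b.2.1 b.2.2)
          (q : Form σ b.1 b.2.1 × (z.unop ⟶ b.2.2)) =>
          CoendComp.mk (P := curry σ) (Q := cocurry κ) (op b.2.1)
            (formMap σ p.1 (𝟙 b.2.1) q.1) (coformMap κ (𝟙 b.2.1) q.2 p.2))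
        (fun {b b'} f p q => by
          obtain ⟨a, y, c⟩ := b
          obtain ⟨a', y', c'⟩ := b'
          obtain ⟨u, v, w⟩ := f
          obtain ⟨f, k⟩ := p
          obtain ⟨s, g⟩ := q
          change a ⟶ a' at u
          change y ⟶ y' at v
          change c ⟶ c' at w
          change a' ⟶ x at f
          change unop z ⟶ c at g
          change Form σ a y at s
          change Coform κ y' c' at k
          change (CoendComp.mk (op y) (formMap σ (u ≫ f) (𝟙 y) s)
            (coformMap κ (𝟙 y) g (coformMap κ v w k)) : CoendComp (curry σ) (cocurry κ) x z) =
              CoendComp.mk (op y') (formMap σ f (𝟙 y') (formMap σ u v s))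
                (coformMap κ (𝟙 y') (g ≫ w) k)
          -- Functoriality absorbs `u` and `w`; only `v`, in the variable that is still integrated
          -- over, needs a coend step.
          have h := curryMk_sound σ κ (z := unop z) v (formMap σ (u ≫ f) (𝟙 y) s)
            (coformMap κ (𝟙 y') (g ≫ w) k)
          refine Eq.trans ?_ (h.symm.trans ?_)
          · refine congrArg (CoendComp.mk (P := curry σ) (Q := cocurry κ) _ _) ?_
            exact (coformMap_comp κ v (𝟙 y) w g k).symm.trans (Eq.trans (by simp)
              (coformMap_comp κ (𝟙 y') v (g ≫ w) (𝟙 z.unop) k))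
          · refine congrArg (CoendComp.mk (P := curry σ) (Q := cocurry κ) _ · _) ?_
            exact (formMap_comp σ (u ≫ f) (𝟙 x) (𝟙 y) v s).symm.trans (Eq.trans (by simp)
              (formMap_comp σ u f v (𝟙 y') s)))
      invFun := CoendComp.lift (X := ((zigzagLeftRestrict σ κ).obj x).obj z)
        (fun (y : Y.carrierᵒᵖ) (s : Form σ x y.unop) (k : Coform κ y.unop z.unop) =>
          zigzagLeftMk σ κ x y.unop z.unop (𝟙 x) k s (𝟙 z.unop))
        (fun {y y'} v s k => by
          have h := zigzagLeftMk_sound σ κ (𝟙 x) v.unop (𝟙 z.unop) (𝟙 x) k s (𝟙 z.unop)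
          rw [Category.comp_id, Category.comp_id] at h
          exact h.symm)
      left_inv := fun t => by
        induction t using CoendComp.ind with | _ b p q
        exact (zigzagLeftMk_eq σ κ p.1 p.2 q.1 q.2).symm
      right_inv := fun t => by
        induction t using CoendComp.ind with | _ y s k
        exact congrArg₂ (CoendComp.mk (P := curry σ) (Q := cocurry κ) y)
          (formMap_id σ x y.unop s) (coformMap_id κ y.unop z.unop k) })
    (fun x z z' g t => by
        induction t using CoendComp.ind with | _ b p q
        refine congrArg₂ (CoendComp.mk (P := curry σ) (Q := cocurry κ) (op b.2.1)) ?_ ?_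
        · exact congrArg (formMap σ p.1 (𝟙 b.2.1))
            (types_congr_hom ((σ.obj (b.1, b.2.1)).map_id (op ⟨PUnit.unit⟩)) q.1)
        · refine Eq.trans ?_ (coformMap_comp κ (𝟙 b.2.1) (𝟙 b.2.1) q.2 g.unop p.2)
          exact congrArg (coformMap κ · (g.unop ≫ q.2) p.2) (Category.comp_id _).symm)
    (fun f z t => by
        induction t using CoendComp.ind with | _ b p q
        refine congrArg₂ (CoendComp.mk (P := curry σ) (Q := cocurry κ) (op b.2.1)) ?_ ?_
        · refine Eq.trans ?_ (formMap_comp σ p.1 f (𝟙 b.2.1) (𝟙 b.2.1) q.1)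
          exact congrArg (formMap σ (p.1 ≫ f) · q.1) (Category.comp_id _).symm
        · exact congrArg (coformMap κ (𝟙 b.2.1) q.2)
            (types_congr_hom (NatTrans.congr_app (κ.map_id ⟨PUnit.unit⟩) (op b.2)) p.2))

/-- The left zig-zag of a pairing as a composite of curried 1-cells. -/
def zigzagLeftIso :
    rightUnitInv X ≫ (𝟙 X ⊠₁ κ) ≫ assocInv X Y X ≫ (σ ⊠₁ 𝟙 X) ≫ leftUnit X ≅
      curry σ ≫ cocurry κ :=
  -- The unitor at the end has an inverse functor as left adjoint, so by `compStar` composing with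
  -- it is substitution; the other structural 1-cells are removed by co-Yoneda.
  whiskerLeftIso _ (whiskerLeftIso _ (whiskerLeftIso _
    (compStar (F := leftUnitFunctor X) (G := prod.leftInverseUnitor X.carrier)
      (prod.leftUnitorEquivalence X.carrier).symm.toAdjunction (σ ⊠₁ 𝟙 X)) ≪≫
      starRestrict _ _)) ≪≫ starRestrict _ _ ≪≫ zigzagLeftCell σ κ

end Curry

end Prof
end ProfBicat

/-! ### Transposition, and the right zig-zag -/

namespace ProfBicat

open Bicategory

namespace Prof

variable {X Y Z : Prof.{u}}

/-- The mate of an endo-1-cell of the opposite of `Y`: `(y, y') ↦ P(y', y)`. -/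
def uncross (P : Prof.of Y.carrierᵒᵖ ⟶ Prof.of Y.carrierᵒᵖ) : Y ⟶ Y :=
  show Profunctor.{u} Y.carrier Y.carrier from
  { obj := fun y =>
      { obj := fun w => (P.obj w).obj (op (op y))
        map := fun g => (P.map g).app (op (op y))
        map_id := fun w => NatTrans.congr_app (P.map_id w) _
        map_comp := fun g h => NatTrans.congr_app (P.map_comp g h) _ }
    map := fun f =>
      { app := fun w => (P.obj w).map f.op.op
        naturality := fun _ _ g => ((P.map g).naturality f.op.op).symm }
    map_id := fun _ => NatTrans.ext (funext fun w => (P.obj w).map_id _)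
    map_comp := fun f g => NatTrans.ext (funext fun w => (P.obj w).map_comp f.op.op g.op.op) }

/-- Functoriality of `uncross` on invertible 2-cells. -/
def uncrossMap {P Q : Prof.of Y.carrierᵒᵖ ⟶ Prof.of Y.carrierᵒᵖ} (e : P ≅ Q) :
    uncross P ≅ uncross Q :=
  cellMk (fun y w => ((e.app w).app (op (op y))).toEquiv)
    (fun y _ _ g p => types_congr_hom (NatTrans.congr_app (e.hom.naturality g) (op (op y))) p)
    (fun f w p => NatTrans.naturality_apply (e.hom.app w) f.op.op p)

/-- The invertible 2-cell with a given image under `uncross`. -/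
def uncrossPreimage {P Q : Prof.of Y.carrierᵒᵖ ⟶ Prof.of Y.carrierᵒᵖ}
    (e : uncross P ≅ uncross Q) : P ≅ Q :=
  cellMk (fun w v => ((e.app v.unop.unop).app w).toEquiv)
    (fun w _ _ g p => types_congr_hom (NatTrans.congr_app (e.hom.naturality g.unop.unop) w) p)
    (fun f w p => NatTrans.naturality_apply (e.hom.app w.unop.unop) f p)

/-- `uncross` preserves identities. -/
def uncrossId (Y : Prof.{u}) : uncross (𝟙 (Prof.of Y.carrierᵒᵖ)) ≅ 𝟙 Y :=
  cellMk (fun y w => (opEquiv (op y) w : (op y ⟶ w) ≃ (w.unop ⟶ y))) (fun _ _ _ _ _ => rfl)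
    (fun _ _ _ => rfl)

section Zigzag

variable (σ : X ⊠ Y ⟶ tensorUnit) (κ : tensorUnit ⟶ Y ⊠ X)

theorem cocurryMk_sound {x x' : X.carrier} {y z : Y.carrier} (v : x ⟶ x')
    (k : Coform κ z x') (s : Form σ x y) :
    (CoendComp.mk x (coformMap κ (𝟙 z) v k) s :
      CoendComp (cocurry κ) (curry σ) (op z) (op (op y))) =
      CoendComp.mk x' k (formMap σ v (𝟙 y) s) :=
  CoendComp.sound (P := cocurry κ) (Q := curry σ) (a := op z) (c := op (op y)) v k s

/-- The last three factors of the right zig-zag, after substitution along the structural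
functors. -/
def zigzagRightTail : (Y ⊠ X) ⊠ Y ⟶ Y :=
  restrict (assocFunctor Y X Y)
    (show Y ⊠ (X ⊠ Y) ⟶ Y from Functor.comp (𝟙 Y ⊠₁ σ)
      ((Functor.whiskeringLeft _ _ _).obj (prod.rightInverseUnitor Y.carrier).op))

/-- The right zig-zag, after substitution along the structural functors. -/
def zigzagRightRestrict : Y ⟶ Y :=
  restrict (B := tensorUnit ⊠ Y) (prod.leftInverseUnitor Y.carrier)
    ((κ ⊠₁ 𝟙 Y) ≫ zigzagRightTail σ)

/-- Elements of the right zig-zag. -/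
def zigzagRightMk {y z : Y.carrier} (a : Y.carrier) (x : X.carrier) (c : Y.carrier)
    (k : Coform κ a x) (h : c ⟶ y) (g : z ⟶ a) (s : Form σ x c) :
    ((zigzagRightRestrict σ κ).obj y).obj (op z) :=
  CoendComp.mk (P := κ ⊠₁ 𝟙 Y) (Q := zigzagRightTail σ)
    (a := (prod.leftInverseUnitor Y.carrier).obj y) (c := op z) ((a, x), c) (k, h)
    (show (z ⟶ a) × Form σ x c from (g, s))

theorem zigzagRightMk_sound {y z a a' : Y.carrier} {x x' : X.carrier} {c c' : Y.carrier}
    (u : a ⟶ a') (v : x ⟶ x') (w : c ⟶ c') (k : Coform κ a' x') (h : c' ⟶ y) (g : z ⟶ a)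
    (s : Form σ x c) :
    zigzagRightMk σ κ a x c (coformMap κ u v k) (w ≫ h) g s =
      zigzagRightMk σ κ a' x' c' k h (g ≫ u) (formMap σ v w s) :=
  CoendComp.sound (P := κ ⊠₁ 𝟙 Y) (Q := zigzagRightTail σ)
    (a := (prod.leftInverseUnitor Y.carrier).obj y) (c := op z)
    (b := ((a, x), c)) (b' := ((a', x'), c')) (Prod.mkHom (Prod.mkHom u v) w) (k, h)
    (show (z ⟶ a) × Form σ x c from (g, s))

/-- The mirror normal form: `g` moves into the coform and `h` into the form, so that only the coend
over `X` remains. -/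
theorem zigzagRightMk_eq {y z a : Y.carrier} {x : X.carrier} {c : Y.carrier}
    (k : Coform κ a x) (h : c ⟶ y) (g : z ⟶ a) (s : Form σ x c) :
    zigzagRightMk σ κ a x c k h g s =
      zigzagRightMk σ κ z x y (coformMap κ g (𝟙 x) k) (𝟙 y) (𝟙 z) (formMap σ (𝟙 x) h s) := by
  have h1 := zigzagRightMk_sound σ κ (𝟙 z) (𝟙 x) h (coformMap κ g (𝟙 x) k) (𝟙 y) (𝟙 z) s
  have h2 := zigzagRightMk_sound σ κ g (𝟙 x) (𝟙 c) k h (𝟙 z) s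
  rw [Category.comp_id, coformMap_id, Category.comp_id] at h1
  rw [Category.id_comp, formMap_id, Category.id_comp] at h2
  exact h2.symm.trans h1

/-- The right zig-zag as a composite of curried 1-cells. -/
def zigzagRightCell : zigzagRightRestrict σ κ ≅ uncross (cocurry κ ≫ curry σ) :=
  cellMk (P := zigzagRightRestrict σ κ) (fun y z =>
    { toFun := CoendComp.lift (X := CoendComp (cocurry κ) (curry σ) z (op (op y)))
        (fun (b : (Y.carrier × X.carrier) × Y.carrier) (p : Coform κ b.1.1 b.1.2 × (b.2 ⟶ y))
          (q : (z.unop ⟶ b.1.1) × Form σ b.1.2 b.2) =>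
          CoendComp.mk (P := cocurry κ) (Q := curry σ) b.1.2
            (coformMap κ q.1 (𝟙 b.1.2) p.1) (formMap σ (𝟙 b.1.2) p.2 q.2))
        (fun {b b'} f p q => by
          obtain ⟨⟨a, x⟩, c⟩ := b
          obtain ⟨⟨a', x'⟩, c'⟩ := b'
          obtain ⟨⟨u, v⟩, w⟩ := f
          obtain ⟨k, h⟩ := p
          obtain ⟨g, s⟩ := q
          change a ⟶ a' at u
          change x ⟶ x' at v
          change c ⟶ c' at w
          change c' ⟶ y at h
          change unop z ⟶ a at g
          change Form σ x c at s
          change Coform κ a' x' at k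
          change (CoendComp.mk x (coformMap κ g (𝟙 x) (coformMap κ u v k))
            (formMap σ (𝟙 x) (w ≫ h) s) : CoendComp (cocurry κ) (curry σ) z (op (op y))) =
              CoendComp.mk x' (coformMap κ (g ≫ u) (𝟙 x') k)
                (formMap σ (𝟙 x') h (formMap σ v w s))
          have hv := cocurryMk_sound σ κ v (coformMap κ (g ≫ u) (𝟙 x') k)
            (formMap σ (𝟙 x) (w ≫ h) s)
          refine Eq.trans ?_ (hv.trans ?_)
          · refine congrArg (CoendComp.mk (P := cocurry κ) (Q := curry σ) _ · _) ?_
            exact (coformMap_comp κ u g v (𝟙 x) k).symm.trans (Eq.trans (by simp)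
              (coformMap_comp κ (g ≫ u) (𝟙 z.unop) (𝟙 x') v k))
          · refine congrArg (CoendComp.mk (P := cocurry κ) (Q := curry σ) _ _) ?_
            exact (formMap_comp σ (𝟙 x) v (w ≫ h) (𝟙 y) s).symm.trans (Eq.trans (by simp)
              (formMap_comp σ v (𝟙 x') w h s)))
      invFun := CoendComp.lift (X := ((zigzagRightRestrict σ κ).obj y).obj z)
        (fun (x : X.carrier) (k : Coform κ z.unop x) (s : Form σ x y) =>
          zigzagRightMk σ κ z.unop x y k (𝟙 y) (𝟙 z.unop) s)
        (fun {x x'} v k s => by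
          have h := zigzagRightMk_sound σ κ (𝟙 z.unop) v (𝟙 y) k (𝟙 y) (𝟙 z.unop) s
          rw [Category.comp_id, Category.comp_id] at h
          exact h)
      left_inv := fun t => by
        induction t using CoendComp.ind with | _ b p q
        exact (zigzagRightMk_eq σ κ p.1 p.2 q.1 q.2).symm
      right_inv := fun t => by
        induction t using CoendComp.ind with | _ x k s
        exact congrArg₂ (CoendComp.mk (P := cocurry κ) (Q := curry σ) x)
          (coformMap_id κ z.unop x k) (formMap_id σ x y s) })
    (fun y z z' g t => by
        induction t using CoendComp.ind with | _ b p q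
        refine congrArg₂ (CoendComp.mk (P := cocurry κ) (Q := curry σ) b.1.2) ?_ ?_
        · refine Eq.trans ?_ (coformMap_comp κ q.1 g.unop (𝟙 b.1.2) (𝟙 b.1.2) p.1)
          exact congrArg (coformMap κ (g.unop ≫ q.1) · p.1) (Category.comp_id _).symm
        · exact congrArg (formMap σ (𝟙 b.1.2) p.2)
            (types_congr_hom ((σ.obj (b.1.2, b.2)).map_id (op ⟨PUnit.unit⟩)) q.2))
    (fun f z t => by
        induction t using CoendComp.ind with | _ b p q
        refine congrArg₂ (CoendComp.mk (P := cocurry κ) (Q := curry σ) b.1.2) ?_ ?_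
        · exact congrArg (coformMap κ q.1 (𝟙 b.1.2))
            (types_congr_hom (NatTrans.congr_app (κ.map_id ⟨PUnit.unit⟩) (op b.1)) p.1)
        · refine Eq.trans ?_ (formMap_comp σ (𝟙 b.1.2) (𝟙 b.1.2) p.2 f q.2)
          exact congrArg (formMap σ · (p.2 ≫ f) q.2) (Category.comp_id _).symm)

/-- The right zig-zag of a pairing as a composite of curried 1-cells. -/
def zigzagRightIso :
    leftUnitInv Y ≫ (κ ⊠₁ 𝟙 Y) ≫ assoc Y X Y ≫ (𝟙 Y ⊠₁ σ) ≫ rightUnit Y ≅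
      uncross (cocurry κ ≫ curry σ) :=
  whiskerLeftIso _ (whiskerLeftIso _ (whiskerLeftIso _
    (compStar (F := rightUnitFunctor Y) (G := prod.rightInverseUnitor Y.carrier)
      (prod.rightUnitorEquivalence Y.carrier).symm.toAdjunction (𝟙 Y ⊠₁ σ)) ≪≫
      starRestrict _ _)) ≪≫ starRestrict _ _ ≪≫ zigzagRightCell σ κ

end Zigzag

end Prof
end ProfBicat

/-! ### Biexact pairings as equivalences -/

namespace ProfBicat

open Bicategory

namespace Prof

variable {X Y Z : Prof.{u}}

/-- Mutually inverse 1-cells are adjoint. -/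
def adjunctionOfIso {P : X ⟶ Y} {Q : Y ⟶ X} (s : 𝟙 X ≅ P ≫ Q) (t : Q ≫ P ≅ 𝟙 Y) :
    Bicategory.Adjunction P Q :=
  -- The given isomorphisms need not satisfy the triangle identities, so the counit is corrected.
  let e := Bicategory.Equivalence.mkOfAdjointifyCounit s t
  ⟨e.unit.hom, e.counit.hom, e.left_triangle_hom, e.right_triangle_hom⟩

/-- Morphisms of the terminal category are identities, so a form carries no action on the target
side. -/
theorem map_eq_self (τ : X ⟶ tensorUnit) (x : X.carrier) {b b' : tensorUnit.carrierᵒᵖ}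
    (g : b ⟶ b') (q : (τ.obj x).obj (op ⟨PUnit.unit⟩)) : (τ.obj x).map g q = q := by
  obtain rfl : g = 𝟙 b := Subsingleton.elim _ _
  exact types_congr_hom ((τ.obj x).map_id _) q

section Biexact

variable {σ : X ⊠ Y ⟶ tensorUnit}

/-- A form whose curried 1-cell is represented by an equivalence is a biexact pairing. -/
theorem nonempty_biexactPairing {F : X.carrier ⥤ Y.carrierᵒᵖ} [F.IsEquivalence]
    (e : curry σ ≅ star (B := Prof.of Y.carrierᵒᵖ) F) : Nonempty (BiexactPairing σ) := by
  -- The coevaluation is the inverse equivalence, made a 1-cell and uncurried; the zig-zags are then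
  -- the unit and counit isomorphisms of the equivalence.
  let R : Prof.of Y.carrierᵒᵖ ⟶ X := star (A := Prof.of Y.carrierᵒᵖ) F.inv
  let r : cocurry (uncocurry R) ≅ R := cocurryUncocurry R
  exact ⟨{
    coev := uncocurry R
    zigzagLeft := zigzagLeftIso σ (uncocurry R) ≪≫ whiskerRightIso e _ ≪≫ whiskerLeftIso _ r ≪≫
      starStar (B := Prof.of Y.carrierᵒᵖ) F F.inv ≪≫ starIso F.asEquivalence.unitIso.symm
    zigzagRight := zigzagRightIso σ (uncocurry R) ≪≫ uncrossMap (whiskerRightIso r _ ≪≫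
      whiskerLeftIso _ e ≪≫
      starStar (A := Prof.of Y.carrierᵒᵖ) (C := Prof.of Y.carrierᵒᵖ) F.inv F ≪≫
      starIso (A := Prof.of Y.carrierᵒᵖ) (B := Prof.of Y.carrierᵒᵖ)
        F.asEquivalence.counitIso) ≪≫ uncrossId Y }⟩

/-- The natural isomorphism between representing functors induced by an invertible 2-cell. -/
noncomputable def Rep.natIso {P Q : X ⟶ Y} [Rep P] [Rep Q] (s : P ≅ Q) : functor P ≅ functor Q :=
  NatIso.ofComponents (fun x => appIso s x) (fun f => app_naturality s.hom f)

/-- Between Cauchy complete categories, the curried 1-cell of a biexact pairing is represented by an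
equivalence. -/
theorem exists_equivalence_of_biexactPairing [IsIdempotentComplete X.carrier]
    [IsIdempotentComplete Y.carrier] (p : BiexactPairing σ) :
    ∃ F : X.carrier ⥤ Y.carrierᵒᵖ, F.IsEquivalence ∧
      Nonempty (curry σ ≅ star (B := Prof.of Y.carrierᵒᵖ) F) := by
  let s : curry σ ≫ cocurry p.coev ≅ 𝟙 X := (zigzagLeftIso σ p.coev).symm ≪≫ p.zigzagLeft
  -- The right zig-zag determines the composite on the opposite of `Y` only after transposition,
  -- which `uncrossPreimage` undoes.
  let t : cocurry p.coev ≫ curry σ ≅ 𝟙 (Prof.of Y.carrierᵒᵖ) :=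
    uncrossPreimage ((zigzagRightIso σ p.coev).symm ≪≫ p.zigzagRight ≪≫ (uncrossId Y).symm)
  -- Each of two mutually inverse 1-cells is a left adjoint, so both are represented, and the
  -- isomorphisms `s` and `t` pass to the representing functors.
  have : IsLeftAdjoint (curry σ) := .mk (adjunctionOfIso s.symm t)
  have : IsLeftAdjoint (cocurry p.coev) :=
    .mk (adjunctionOfIso t.symm s)
  have : IsIdempotentComplete (Prof.of Y.carrierᵒᵖ).carrier :=
    inferInstanceAs (IsIdempotentComplete Y.carrierᵒᵖ)
  obtain ⟨hc⟩ := nonempty_rep_of_isLeftAdjoint (P := curry σ)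
  obtain ⟨hk⟩ := nonempty_rep_of_isLeftAdjoint (P := cocurry p.coev)
  refine ⟨Rep.functor (curry σ), ?_, ⟨(Rep.isoStar (curry σ)).symm⟩⟩
  exact (CategoryTheory.Equivalence.mk (Rep.functor (curry σ)) (Rep.functor (cocurry p.coev))
    (Rep.natIso s).symm (Rep.natIso t)).isEquivalence_functor

/-- Forms with isomorphic curried 1-cells are isomorphic. -/
def uncurryIso {τ : X ⊠ Y ⟶ tensorUnit} (e : curry σ ≅ curry τ) : σ ≅ τ :=
  cellMk (fun a _ => ((e.app a.1).app (op (op a.2))).toEquiv)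
    (fun a _ _ g (q : Form σ a.1 a.2) =>
      (congrArg ((e.hom.app a.1).app (op (op a.2))) (map_eq_self σ a g q)).trans
        (map_eq_self τ a g ((e.hom.app a.1).app (op (op a.2)) q)).symm)
    (fun {a a'} f b (q : Form σ a.1 a.2) => by
      let E (x : X.carrier) (y : Y.carrier) (q : Form σ x y) : Form τ x y :=
        (e.hom.app x).app (op (op y)) q
      have h1 : E a'.1 a'.2 (formMap σ f.1 (𝟙 a'.2) (formMap σ (𝟙 a.1) f.2 q)) =
          formMap τ f.1 (𝟙 a'.2) (E a.1 a'.2 (formMap σ (𝟙 a.1) f.2 q)) :=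
        types_congr_hom (NatTrans.congr_app (e.hom.naturality f.1) (op (op a'.2))) _
      have h2 : E a.1 a'.2 (formMap σ (𝟙 a.1) f.2 q) = formMap τ (𝟙 a.1) f.2 (E a.1 a.2 q) :=
        NatTrans.naturality_apply (e.hom.app a.1) f.2.op.op q
      -- Joint naturality follows from naturality in each variable, since a pair of morphisms acts
      -- as one after the other.
      rw [h2, ← formMap_comp, ← formMap_comp, Category.id_comp, Category.comp_id] at h1
      exact h1)

end Biexact

end Prof

namespace StarAutonomous
open Prof

variable {C : Type u} [SmallCategory C]

/-- For `G ⊣ F`, the curried form `Hom(x, G y)` is represented by `F`. -/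
def curryDualForm {G : Cᵒᵖᵒᵖ ⥤ Cᵒᵖ} {F : Cᵒᵖ ⥤ Cᵒᵖᵒᵖ} (adj : G ⊣ F) :
    curry (dualForm (opOp C ⋙ G)) ≅ star (A := Prof.of Cᵒᵖ) (B := Prof.of Cᵒᵖᵒᵖ) F :=
  cellMk (fun x w => ((opEquiv _ _).symm.trans (adj.homEquiv w.unop x) :
     (x.unop ⟶ (G.obj w.unop).unop) ≃ (w.unop ⟶ F.obj x)))
    (fun x w w' g (k : x.unop ⟶ (G.obj w.unop).unop) => by
      refine Eq.trans (congrArg (adj.homEquiv w'.unop x) (Quiver.Hom.unop_inj ?_))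
        (adj.homEquiv_naturality_left g.unop k.op)
      exact Category.id_comp _)
    (fun {x x'} f w (k : x.unop ⟶ (G.obj w.unop).unop) => by
      refine Eq.trans (congrArg (adj.homEquiv w.unop x') (Quiver.Hom.unop_inj ?_))
        (adj.homEquiv_naturality_right k.op f)
      change f.unop ≫ k ≫ (G.map (𝟙 _)).unop = f.unop ≫ k
      rw [G.map_id]
      exact congrArg (f.unop ≫ ·) (Category.comp_id k))

end StarAutonomous
end ProfBicat

/-! ### Assembling the correspondence -/

namespace ProfBicat

open Bicategory Prof

variable {C : Type u} [SmallCategory C]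

namespace StarAutonomous

/-- `curryDualForm` concerns forms given by `opOp C ⋙ G`. With `G = unopUnop C ⋙ D` this is `D` by
definition, and the curried form is represented by the inverse of `G`. -/
theorem nonempty_biexactPairing_dualForm (D : C ⥤ Cᵒᵖ) [D.IsEquivalence] :
    Nonempty (BiexactPairing (dualForm D)) :=
  let G : Cᵒᵖᵒᵖ ⥤ Cᵒᵖ := unopUnop C ⋙ D
  have : G.IsEquivalence := Functor.isEquivalence_trans _ _
  nonempty_biexactPairing (σ := dualForm D) (X := Prof.of Cᵒᵖ) (Y := Prof.of Cᵒᵖ) (F := G.inv)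
    (curryDualForm G.asEquivalence.toAdjunction)

theorem toFrobeniusData_isDaggerFrobenius (S : StarAutonomous C) :
    S.toFrobeniusData.IsDaggerFrobenius where
  isPseudomonoid := S.toFrobeniusData_isPseudomonoid
  biexact := have := S.isEquivalence; nonempty_biexactPairing_dualForm S.D
  mul_adjoint :=
    letI := S.monoidal
    inferInstanceAs (IsLeftAdjoint (star (tensorFunctor (Prof.of Cᵒᵖ))))
  one_adjoint :=
    letI := S.monoidal
    inferInstanceAs (IsLeftAdjoint (star (unitFunctor (Prof.of Cᵒᵖ))))

theorem toFrobeniusData_isRepresentable (S : StarAutonomous C) :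
    S.toFrobeniusData.IsRepresentable :=
  letI := S.monoidal
  ⟨⟨tensorFunctor (Prof.of Cᵒᵖ), ⟨CategoryTheory.Iso.refl _⟩⟩,
    ⟨unitFunctor (Prof.of Cᵒᵖ), ⟨CategoryTheory.Iso.refl _⟩⟩,
    S.D, S.isEquivalence, ⟨CategoryTheory.Iso.refl _⟩⟩

end StarAutonomous

namespace FrobeniusData

variable {P : FrobeniusData (Prof.of Cᵒᵖ)}

theorem IsDaggerFrobenius.isRepresentable [IsIdempotentComplete C] (h : P.IsDaggerFrobenius) :
    P.IsRepresentable := by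
  have : IsIdempotentComplete (Prof.of Cᵒᵖ).carrier := inferInstanceAs (IsIdempotentComplete Cᵒᵖ)
  have := h.mul_adjoint
  have := h.one_adjoint
  obtain ⟨hm⟩ := nonempty_rep_of_isLeftAdjoint (P := P.mul)
  obtain ⟨ho⟩ := nonempty_rep_of_isLeftAdjoint (P := P.one)
  obtain ⟨F, hF, ⟨e⟩⟩ := exists_equivalence_of_biexactPairing h.biexact.some
  -- The duality is the inverse of the functor `F` representing the curried form, because `Hom(x,
  -- F⁻¹ y)` curries to a 1-cell represented by `F`.
  refine ⟨⟨Rep.functor P.mul, ⟨(Rep.isoStar P.mul).symm⟩⟩,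
    ⟨Rep.functor P.one, ⟨(Rep.isoStar P.one).symm⟩⟩, opOp C ⋙ F.inv, ?_, ⟨?_⟩⟩
  · exact Functor.isEquivalence_trans _ _
  · exact uncurryIso (e ≪≫ (StarAutonomous.curryDualForm F.asEquivalence.symm.toAdjunction).symm)

theorem IsDaggerFrobenius.exists_starAutonomous (h : P.IsDaggerFrobenius)
    (hr : P.IsRepresentable) : ∃ S : StarAutonomous C, Nonempty (Iso S.toFrobeniusData P) := by
  obtain ⟨⟨F, ⟨m⟩⟩, ⟨G, ⟨o⟩⟩, D, hD, ⟨e⟩⟩ := hr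
  let := Rep.ofIso m
  let := Rep.ofIso o
  exact ⟨P.toStarAutonomous h.isPseudomonoid D e, ⟨P.toStarAutonomousIso h.isPseudomonoid D e⟩⟩

end FrobeniusData

end ProfBicat

theorem mainTheorem4 (C : Type u) [SmallCategory C] :
    (∀ S : ProfBicat.StarAutonomous C,
      S.toFrobeniusData.IsDaggerFrobenius ∧ S.toFrobeniusData.IsRepresentable) ∧
    (∃ reconstruct :
        {P : ProfBicat.FrobeniusData (ProfBicat.Prof.of Cᵒᵖ) //
          P.IsDaggerFrobenius ∧ P.IsRepresentable} → ProfBicat.StarAutonomous C,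
      (∀ P, Nonempty (ProfBicat.FrobeniusData.Iso (reconstruct P).toFrobeniusData P.1)) ∧
      (∀ (S : ProfBicat.StarAutonomous C)
        (h : S.toFrobeniusData.IsDaggerFrobenius ∧ S.toFrobeniusData.IsRepresentable),
        Nonempty (ProfBicat.StarAutonomous.Iso (reconstruct ⟨S.toFrobeniusData, h⟩) S))) ∧
    (IsIdempotentComplete C →
      ∀ P : ProfBicat.FrobeniusData (ProfBicat.Prof.of Cᵒᵖ),
        P.IsDaggerFrobenius → P.IsRepresentable) := by
  refine ⟨fun S => ⟨S.toFrobeniusData_isDaggerFrobenius, S.toFrobeniusData_isRepresentable⟩, ?_,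
    fun _ _ h => h.isRepresentable⟩
  -- `Ψ` is a choice of preimage under `Φ`, up to isomorphism.
  choose reconstruct iso using fun P : {P : ProfBicat.FrobeniusData (ProfBicat.Prof.of Cᵒᵖ) //
    P.IsDaggerFrobenius ∧ P.IsRepresentable} => P.2.1.exists_starAutonomous P.2.2
  -- The chosen isomorphism at `P = Φ(S)` compares two structures in the image of `Φ`, hence
  -- descends to `Ψ(Φ(S)) ≅ S`.
  exact ⟨reconstruct, iso, fun S h => (iso ⟨S.toFrobeniusData, h⟩).map fun i =>
    ProfBicat.StarAutonomous.isoOfFrobeniusIso i⟩
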